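/- Let $n\ge 1$, $Q=2n+2$, and let $\mathbb{H}^n=\mathbb{R}^{2n}\times\mathbb{R}$ be the Heisenberg group with law $(x,t)\cdot(y,s)=(x+y,\,t+s+x^{t}Jy)$, $J=2\begin{pmatrix}0&-I_n\\ I_n&0\end{pmatrix}$, Lebesgue (Haar) measure $|\cdot|$, Koranyi norm $\rho(x,t)=(|x|^4+t^2)^{1/4}$ and $\rho$-balls $B(z_0,\delta)=\{w:\rho(z_0^{-1}\cdot w)<\delta\}$; put $\lambda B(z_0,\delta)=B(z_0,\lambda\delta)$. For a multi-index $I=(i_1,\dots,i_{2n+1})$ let $d(I)=i_1+\dots+i_{2n}+2i_{2n+1}$, $z^I=x_1^{i_1}\cdots x_{2n}^{i_{2n}}t^{i_{2n+1}}$ and $X^I=X_1^{i_1}\cdots X_{2n+1}^{i_{2n+1}}$, where $X_i=\partial_{x_i}+2x_{i+n}\partial_t$, $X_{i+n}=\partial_{x_{i+n}}-2x_i\partial_t$ ($1\le i\le n$), $X_{2n+1}=\partial_t$. Let $0<p\le 1<p_0\le\infty$, let $N\ge \lfloor Q(p^{-1}-1)\rfloor+1$ be an integer, let $1<q<\frac{n+1}{n}$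 and let $\beta\ge1$. A measurable $a:\mathbb{H}^n\to\mathbb{C}$ is a $(p,p_0,N)$-atom centered at the ball $B$ if $\operatorname{supp}(a)\subset B$, $\|a\|_{L^{p_0}}\le|B|^{1/p_0-1/p}$ and $\int a(z)z^I\,dz=0$ whenever $d(I)\le N$. Let $c_n=\big[n(n+2)\int_{\mathbb{H}^n}|x|^2(\rho(x,t)^4+1)^{-(n+4)/2}\,dx\,dt\big]^{-1}$. Let $E^q_1$ be the quotient of $L^q_{loc}(\mathbb{H}^n)$ by the space of complex polynomials $\sum_{d(I)\le1}c_Iz^I$. For $G\in E^q_1$ put $$N_{q,2}(G;z)=\inf_{g\in G}\ \sup_{r>0}\ r^{-2}\Big(|B(z,r)|^{-1}\int_{B(z,r)}|g(w)|^q\,dw\Big)^{1/q}.$$ Let $Mf(z)=\sup_{B'\ni z}|B'|^{-1}\int_{B'}|f|$, the supremum being over all $\rho$-balls $B'$ containing $z$, and $$T^*_Ia(z)=\sup_{\epsilon>0}\Big|\int_{\rho(w^{-1}\cdot z)>\epsilon}(X^I\rho^{-2n})(w^{-1}\cdot z)\,a(w)\,dw\Big| .$$ Then there is a constant $C$, depending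 only on $n,p,p_0,N,q,\beta$, such that for every ball $B=B(z_0,\delta)$, $\delta>0$, and every $(p,p_0,N)$-atom $a$ centered at $B$, the integral $$b(z)=(a*c_n\rho^{-2n})(z)=\int_{\mathbb{H}^n}a(w)\,c_n\,\rho(w^{-1}\cdot z)^{-2n}\,dw$$ converges absolutely for almost every $z$, $b\in L^q_{loc}(\mathbb{H}^n)$, and the class $\widetilde b$ of $b$ in $E^q_1$ satisfies, for all $z\in\mathbb{H}^n$ (as an inequality in $[0,\infty]$), $$N_{q,2}(\widetilde b;z)\le C\Big(|B|^{-1/p}\,[M\chi_B(z)]^{\frac{2+Q/q}{Q}}+\chi_{4\beta^2B}(z)\,Ma(z)+\chi_{4\beta^2B}(z)\sum_{d(I)=2}T^*_Ia(z)\Big).$$ -/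

import Mathlib

open MeasureTheory
open scoped ENNReal NNReal

noncomputable section

/-- The space `ℝ²ⁿ × ℝ` underlying the Heisenberg group. A point is `(x, t)`; the `2n` coordinates
of `x` are indexed by `Fin n ⊕ Fin n`, so that `x (inl i)` is `x_i` and `x (inr i)` is `x_{i+n}`. The vector space structure, the
topology and the Lebesgue measure are those of `ℝ²ⁿ × ℝ`; the multiplication is defined below. -/
abbrev Heis (n : ℕ) : Type := EuclideanSpace ℝ (Fin n ⊕ Fin n) × ℝ

namespace Heis

variable {n : ℕ}

/-- The skew-symmetric matrix `J = 2 [[0, -I], [I, 0]]`. -/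
def matJ (n : ℕ) : Matrix (Fin n ⊕ Fin n) (Fin n ⊕ Fin n) ℝ := (2 : ℝ) • Matrix.J (Fin n) ℝ

/-- The group law `(x, t) · (y, s) = (x + y, t + s + xᵗ J y)`. -/
instance : Mul (Heis n) :=
  ⟨fun z w => (z.1 + w.1, z.2 + w.2 + dotProduct z.1.ofLp ((matJ n).mulVec w.1.ofLp))⟩

instance : One (Heis n) := ⟨((0 : EuclideanSpace ℝ (Fin n ⊕ Fin n)), (0 : ℝ))⟩

instance : Inv (Heis n) := ⟨fun z => (-z.1, -z.2)⟩

theorem mul_def (z w : Heis n) :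
    z * w = (z.1 + w.1, z.2 + w.2 + dotProduct z.1.ofLp ((matJ n).mulVec w.1.ofLp)) := rfl

theorem one_def : (1 : Heis n) = ((0 : EuclideanSpace ℝ (Fin n ⊕ Fin n)), (0 : ℝ)) := rfl

theorem inv_def (z : Heis n) : z⁻¹ = (-z.1, -z.2) := rfl

theorem dot_matJ (x y : Fin n ⊕ Fin n → ℝ) :
    dotProduct x ((matJ n).mulVec y) =
      2 * ∑ i, (x (Sum.inr i) * y (Sum.inl i) - x (Sum.inl i) * y (Sum.inr i)) := by
  have h : (matJ n).mulVec y =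
      Sum.elim (fun i => -(2 * y (Sum.inr i))) (fun i => 2 * y (Sum.inl i)) := by
    funext j
    rw [matJ, Matrix.smul_mulVec, Matrix.J]
    rcases j with j | j
    · simp [Matrix.mulVec, dotProduct, Fintype.sum_sum_type, Matrix.fromBlocks, Matrix.one_apply]
    · simp [Matrix.mulVec, dotProduct, Fintype.sum_sum_type, Matrix.fromBlocks, Matrix.one_apply]
  rw [h, dotProduct, Fintype.sum_sum_type, Finset.mul_sum, ← Finset.sum_add_distrib]
  refine Finset.sum_congr rfl fun i _ => ?_
  simp only [Sum.elim_inl, Sum.elim_inr]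
  ring

instance : Group (Heis n) :=
  Group.ofLeftAxioms
    (by
      intro a b c
      simp only [mul_def]
      refine Prod.ext (add_assoc _ _ _) ?_
      simp only [WithLp.ofLp_add, Matrix.mulVec_add, dotProduct_add, add_dotProduct]
      ring)
    (by
      intro a
      simp only [mul_def, one_def]
      refine Prod.ext (zero_add _) ?_
      simp)
    (by
      intro a
      simp only [mul_def, one_def, inv_def]
      refine Prod.ext (neg_add_cancel _) ?_
      simp only [WithLp.ofLp_neg, neg_dotProduct, dot_matJ]
      simp [mul_comm])

/-- The Koranyi norm `ρ(x, t) = (|x|⁴ + t²)^{1/4}`. -/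
def rho (z : Heis n) : ℝ := (‖z.1‖ ^ 4 + z.2 ^ 2) ^ (1 / 4 : ℝ)

/-- The `ρ`-ball `B(z₀, δ)`. -/
def rball (z₀ : Heis n) (δ : ℝ) : Set (Heis n) := {w | rho (z₀⁻¹ * w) < δ}

/-- The homogeneous dimension `Q = 2n + 2`. -/
def homDim (n : ℕ) : ℝ := 2 * (n : ℝ) + 2

/-! ### Multi-indices, monomials and vector fields -/

/-- A multi-index `(i_1, …, i_{2n}, i_{2n+1})`; the last entry is the second component. -/
abbrev MultiIndex (n : ℕ) : Type := (Fin n ⊕ Fin n → ℕ) × ℕ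

/-- The homogeneous degree `d(I) = i_1 + ⋯ + i_{2n} + 2 i_{2n+1}`. -/
def hdeg (I : MultiIndex n) : ℕ := ∑ j, I.1 j + 2 * I.2

/-- The monomial `z^I`. -/
def monomial (I : MultiIndex n) (z : Heis n) : ℝ := (∏ j, z.1 j ^ I.1 j) * z.2 ^ I.2

/-- The left invariant fields `X_i = ∂_{x_i} + 2 x_{i+n} ∂_t` and
`X_{i+n} = ∂_{x_{i+n}} - 2 x_i ∂_t`, for `1 ≤ i ≤ n`. -/
def fieldX (j : Fin n ⊕ Fin n) (f : Heis n → ℝ) (z : Heis n) : ℝ :=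
  match j with
  | Sum.inl i =>
    fderiv ℝ f z (EuclideanSpace.single (Sum.inl i) (1 : ℝ), 2 * z.1 (Sum.inr i))
  | Sum.inr i =>
    fderiv ℝ f z (EuclideanSpace.single (Sum.inr i) (1 : ℝ), -(2 * z.1 (Sum.inl i)))

/-- The field `X_{2n+1} = ∂_t`. -/
def fieldT (f : Heis n → ℝ) (z : Heis n) : ℝ :=
  fderiv ℝ f z ((0 : EuclideanSpace ℝ (Fin n ⊕ Fin n)), (1 : ℝ))

/-- `X^I = X_1^{i_1} X_2^{i_2} ⋯ X_{2n}^{i_{2n}} X_{2n+1}^{i_{2n+1}}`, in this order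
(`X_1` is applied last). -/
def fieldPow (I : MultiIndex n) (f : Heis n → ℝ) : Heis n → ℝ :=
  (List.finRange n).foldr (fun i g => (fieldX (Sum.inl i))^[I.1 (Sum.inl i)] g)
    ((List.finRange n).foldr (fun i g => (fieldX (Sum.inr i))^[I.1 (Sum.inr i)] g)
      (fieldT^[I.2] f))

/-! ### The fundamental solution and potentials -/

/-- The kernel `ρ^{-2n}`. -/
def kernel (z : Heis n) : ℝ := (rho z ^ (2 * n))⁻¹

/-- The constant `c_n = [n (n + 2) ∫ |x|² (ρ(x,t)⁴ + 1)^{-(n+4)/2} dx dt]⁻¹`. -/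
def fundConst (n : ℕ) : ℝ :=
  ((n : ℝ) * ((n : ℝ) + 2) *
    ∫ z : Heis n, ‖z.1‖ ^ 2 * (rho z ^ 4 + 1) ^ (-((n : ℝ) + 4) / 2))⁻¹

/-- The integrand `w ↦ a(w) c_n ρ(w⁻¹ · z)^{-2n}` of the potential of `a` at `z`. -/
def potentialIntegrand (a : Heis n → ℂ) (z w : Heis n) : ℂ :=
  a w * ((fundConst n * kernel (w⁻¹ * z) : ℝ) : ℂ)

/-- The potential `b = a * c_n ρ^{-2n}`. -/
def potential (a : Heis n → ℂ) (z : Heis n) : ℂ := ∫ w, potentialIntegrand a z w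

/-! ### Maximal operators -/

/-- The (uncentred) Hardy–Littlewood maximal function over `ρ`-balls. -/
def maximalFn (f : Heis n → ℂ) (z : Heis n) : ℝ≥0∞ :=
  ⨆ (c : Heis n) (r : ℝ) (_ : 0 < r) (_ : z ∈ rball c r),
    (volume (rball c r))⁻¹ * ∫⁻ w in rball c r, ‖f w‖ₑ

/-- The maximal truncated integral `T*_I` with kernel `X^I ρ^{-2n}`. -/
def truncMax (I : MultiIndex n) (a : Heis n → ℂ) (z : Heis n) : ℝ≥0∞ :=
  ⨆ (ε : ℝ) (_ : 0 < ε),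
    ‖∫ w in {w : Heis n | ε < rho (w⁻¹ * z)},
      ((fieldPow I kernel (w⁻¹ * z) : ℝ) : ℂ) * a w‖ₑ

/-! ### Atoms -/

/-- The number `N_p`. -/
def critOrder (n : ℕ) (p : ℝ) : ℕ := if p ≤ 1 then ⌊homDim n * (p⁻¹ - 1)⌋₊ + 1 else 0

/-- `a` is a `(p, p₀, N)`-atom centred at the `ρ`-ball `B(z₀, δ)`. -/
structure IsAtom (p : ℝ) (p₀ : ℝ≥0∞) (N : ℕ) (z₀ : Heis n) (δ : ℝ) (a : Heis n → ℂ) : Prop where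
  aestronglyMeasurable : AEStronglyMeasurable a volume
  support_subset : Function.support a ⊆ rball z₀ δ
  eLpNorm_le : eLpNorm a p₀ volume ≤ volume (rball z₀ δ) ^ ((p₀⁻¹).toReal - 1 / p)
  moment : ∀ I : MultiIndex n, hdeg I ≤ N → ∫ z, a z * ((monomial I z : ℝ) : ℂ) = 0

/-! ### The spaces `L^q_loc` and `E^q_k`, and the maximal function `N_{q,γ}` -/

/-- `g` belongs to `L^q` of every compact set. -/
structure MemLqLoc (q : ℝ) (g : Heis n → ℂ) : Prop where
  aestronglyMeasurable : AEStronglyMeasurable g volume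
  memLp : ∀ K : Set (Heis n), IsCompact K → MemLp g (ENNReal.ofReal q) (volume.restrict K)

theorem MemLqLoc.congr {q : ℝ} {f g : Heis n → ℂ} (hf : MemLqLoc q f) (h : f =ᵐ[volume] g) :
    MemLqLoc q g :=
  ⟨hf.1.congr h, fun K hK => (memLp_congr_ae (ae_restrict_of_ae h)).1 (hf.2 K hK)⟩

/-- The space `L^q_loc` of classes of functions modulo almost everywhere equality. -/
def LqLoc (n : ℕ) (q : ℝ) : Submodule ℂ (Heis n →ₘ[volume] ℂ) where
  carrier := {g | MemLqLoc q g}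
  add_mem' {f g} hf hg :=
    MemLqLoc.congr ⟨hf.1.add hg.1, fun K hK => (hf.2 K hK).add (hg.2 K hK)⟩
      (AEEqFun.coeFn_add f g).symm
  zero_mem' :=
    MemLqLoc.congr (f := 0) ⟨aestronglyMeasurable_zero, fun _ _ => MemLp.zero⟩
      AEEqFun.coeFn_zero.symm
  smul_mem' c f hf :=
    MemLqLoc.congr ⟨hf.1.const_smul c, fun K hK => (hf.2 K hK).const_smul c⟩
      (AEEqFun.coeFn_smul c f).symm

instance (n : ℕ) (q : ℝ) : AddCommGroup (LqLoc n q) := Submodule.addCommGroup (LqLoc n q)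

theorem continuous_monomial (I : MultiIndex n) : Continuous (monomial I : Heis n → ℝ) := by
  have h3 : ∀ j, Continuous (fun z : Heis n => z.1 j) := fun j =>
    (EuclideanSpace.proj (𝕜 := ℝ) j).continuous.comp continuous_fst
  exact (continuous_finsetProd _ fun j _ => (h3 j).pow _).mul (continuous_snd.pow _)

theorem aestronglyMeasurable_monomial (I : MultiIndex n) :
    AEStronglyMeasurable (fun z : Heis n => ((monomial I z : ℝ) : ℂ)) volume :=
  (Complex.continuous_ofReal.comp (continuous_monomial I)).aestronglyMeasurable

/-- `𝒫_k`: the polynomials, with complex coefficients, of homogeneous degree at most `k`. -/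
def polys (n k : ℕ) : Submodule ℂ (Heis n →ₘ[volume] ℂ) :=
  Submodule.span ℂ
    {g | ∃ I : MultiIndex n, hdeg I ≤ k ∧
      g = AEEqFun.mk (fun z => ((monomial I z : ℝ) : ℂ)) (aestronglyMeasurable_monomial I)}

/-- The quotient `E^q_k` of `L^q_loc` by `𝒫_k`. -/
abbrev Eqk (n : ℕ) (q : ℝ) (k : ℕ) : Type := LqLoc n q ⧸ (polys n k).submoduleOf (LqLoc n q)

/-- The class in `E^q_k` of a function `b ∈ L^q_loc`. -/
def Eqk.ofFun {q : ℝ} (k : ℕ) (b : Heis n → ℂ) (hb : MemLqLoc q b) : Eqk n q k :=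
  Submodule.Quotient.mk
    ⟨AEEqFun.mk b hb.1, hb.congr (AEEqFun.coeFn_mk b hb.1).symm⟩

/-- The seminorm `|g|_{q,B} = (|B|⁻¹ ∫_B |g|^q)^{1/q}`. -/
def qavg (q : ℝ) (B : Set (Heis n)) (g : Heis n → ℂ) : ℝ≥0∞ :=
  ((volume B)⁻¹ * ∫⁻ w in B, ‖g w‖ₑ ^ q) ^ (1 / q)

/-- The maximal function `η_{q,γ}(g; z) = sup_{r > 0} r^{-γ} |g|_{q,B(z,r)}`. -/
def eta (q γ : ℝ) (g : Heis n → ℂ) (z : Heis n) : ℝ≥0∞ :=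
  ⨆ (r : ℝ) (_ : 0 < r), ENNReal.ofReal (r ^ (-γ)) * qavg q (rball z r) g

/-- The maximal function `N_{q,γ}(G; z) = inf {η_{q,γ}(g; z) : g ∈ G}` of a class `G ∈ E^q_k`. -/
def bigN {q : ℝ} {k : ℕ} (γ : ℝ) (G : Eqk n q k) (z : Heis n) : ℝ≥0∞ :=
  ⨅ (g : LqLoc n q) (_ : (Submodule.Quotient.mk g : Eqk n q k) = G),
    eta q γ (g : Heis n →ₘ[volume] ℂ) z

end Heis

end

noncomputable section

namespace Heis

variable {n : ℕ}

/-! ### The Koranyi norm -/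

/-! Up to the factor `c_n`, `b` is `pot a`. As `N_{q,2}` is an infimum over representatives, it
suffices, for each `z`, to subtract one polynomial of homogeneous degree at most one. The one taken
is the left Taylor polynomial of the potential at `z`, formed by applying `1` and the `X_j` to
`ρ^{-2n}` under the integral. The difference `potRem a z v` is `a` integrated against the
first-order Taylor remainder of `ρ^{-2n}`. Its `L^q` averages over `B(z, r)` have to be at most `r²`
times the right-hand side (`bigN_potential_le`).

If `z ∈ 4β²B` and `Ma(z) < ∞`, the integral is split at `ρ(w⁻¹z) = 4r` (`exists_qavg_potRem_le`). In
the near part no cancellation is used: each term of the remainder is bounded by its size, the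
kernels of degree `-2n` and `-2n-1` at `z` through dyadic shells and `Ma(z)`, the kernel at `v`
through a Young-type inequality, which needs `2nq < Q`, that is `q < (n+1)/n`. In the far part one
more Taylor term is subtracted. The third-order error has degree `-2n-3 < -Q` and is again
controlled by `Ma(z)`. The second-order term consists of singular integrals truncated at `ε = 4r`,
hence is bounded by the `T*_I a(z)`.

If `z` is outside `4β²B`, then `l = ρ(z₀⁻¹z) ≥ 4δ` and the moments of `a` enter
(`exists_qavg_potRem_le_of_isCancelling`). Only those of degree at most one are needed: `δ_s w`
moves vertically only at order `s²`, so a smooth function of `w` is affine in the horizontal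
variables up to `O(ρ(w)²)`. Expanding in `w` and in `z⁻¹v` at once gives `|potRem| ≲ r² δ²
l^{-(2n+4)} ‖a‖₁` for `r ≤ l/4`. For `r > l/4` the potential is estimated by its global `L^q` norm
(`exists_Lq_pot_le`) and the affine part pointwise. Both bounds are at most a constant times `r²
δ^{-Q} (δ/l)^{2+Q/q} ‖a‖₁`. The claim follows from `‖a‖₁ ≤ |B|^{1-1/p}` and `Mχ_B(z) ≥ (δ/2l)^Q`.

The Taylor constants are uniform because homogeneity reduces every estimate to `ρ(u) = 1`, where
compactness and calculus in two real parameters suffice. -/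

theorem rho_nonneg (z : Heis n) : 0 ≤ rho z := Real.rpow_nonneg (by positivity) _

theorem rho_pow_four (z : Heis n) : rho z ^ 4 = ‖z.1‖ ^ 4 + z.2 ^ 2 := by
  rw [rho, ← Real.rpow_natCast, ← Real.rpow_mul (by positivity)]
  norm_num

theorem rho_inv (z : Heis n) : rho z⁻¹ = rho z := by
  simp [rho, inv_def]

theorem norm_fst_le_rho (z : Heis n) : ‖z.1‖ ≤ rho z := by
  refine le_of_pow_le_pow_left₀ (n := 4) (by norm_num) (rho_nonneg z) ?_
  rw [rho_pow_four]
  nlinarith [sq_nonneg z.2]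

theorem abs_snd_le_rho_sq (z : Heis n) : |z.2| ≤ rho z ^ 2 := by
  refine abs_le_of_sq_le_sq ?_ (sq_nonneg _)
  have h : (rho z ^ 2) ^ 2 = rho z ^ 4 := by ring
  rw [h, rho_pow_four]
  nlinarith [pow_nonneg (norm_nonneg z.1) 4]

theorem rho_eq_zero_iff (z : Heis n) : rho z = 0 ↔ z = 0 := by
  constructor
  · intro h
    have h1 := norm_fst_le_rho z
    have h2 := abs_snd_le_rho_sq z
    rw [h] at h1 h2
    refine Prod.ext (norm_le_zero_iff.1 h1) (abs_nonpos_iff.1 (by simpa using h2))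
  · rintro rfl
    simp [rho]

theorem one_eq_zero : (1 : Heis n) = 0 := rfl

theorem rho_pos {z : Heis n} (hz : z ≠ 0) : 0 < rho z :=
  (rho_nonneg z).lt_of_ne fun h => hz ((rho_eq_zero_iff z).1 h.symm)

theorem continuous_rho : Continuous (rho : Heis n → ℝ) := by
  unfold rho
  exact ((continuous_fst.norm.pow 4).add (continuous_snd.pow 2)).rpow_const
    fun _ => Or.inr (by norm_num)

/-- The rotation `x ↦ Jᵗx / 2`. -/
def rotJ (x : EuclideanSpace ℝ (Fin n ⊕ Fin n)) : EuclideanSpace ℝ (Fin n ⊕ Fin n) :=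
  WithLp.toLp 2 (Sum.elim (fun i => x (Sum.inr i)) fun i => -x (Sum.inl i))

theorem dot_matJ_eq_inner (x y : EuclideanSpace ℝ (Fin n ⊕ Fin n)) :
    dotProduct x.ofLp ((matJ n).mulVec y.ofLp) = 2 * inner ℝ (rotJ x) y := by
  rw [dot_matJ, PiLp.inner_apply, Fintype.sum_sum_type, ← Finset.sum_add_distrib]
  congr 1
  refine Finset.sum_congr rfl fun i _ => ?_
  simp [rotJ]
  ring

theorem norm_rotJ (x : EuclideanSpace ℝ (Fin n ⊕ Fin n)) : ‖rotJ x‖ = ‖x‖ := by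
  rw [EuclideanSpace.norm_eq, EuclideanSpace.norm_eq, Fintype.sum_sum_type, Fintype.sum_sum_type]
  congr 1
  simp [rotJ, add_comm]

theorem inner_rotJ_self (x : EuclideanSpace ℝ (Fin n ⊕ Fin n)) : inner ℝ (rotJ x) x = 0 := by
  have h := dot_matJ_eq_inner x x
  rw [dot_matJ] at h
  simp only [mul_comm (x (Sum.inr _)), sub_self, Finset.sum_const_zero, mul_zero] at h
  linarith

/-- Bessel's inequality: `x` and `rotJ x` are orthogonal of equal length, and the squared norm of
`|x|² y` minus its components along them is nonnegative. -/
theorem inner_sq_add_inner_rotJ_sq_le (x y : EuclideanSpace ℝ (Fin n ⊕ Fin n)) :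
    inner ℝ x y ^ 2 + inner ℝ (rotJ x) y ^ 2 ≤ ‖x‖ ^ 2 * ‖y‖ ^ 2 := by
  rcases eq_or_ne x 0 with rfl | hx
  · have : rotJ (0 : EuclideanSpace ℝ (Fin n ⊕ Fin n)) = 0 := by
      rw [← norm_eq_zero, norm_rotJ, norm_zero]
    simp [this]
  have hx' : 0 < ‖x‖ ^ 2 := by positivity
  set a := inner ℝ x y
  set b := inner ℝ (rotJ x) y
  have key : ‖(‖x‖ ^ 2) • y - a • x - b • rotJ x‖ ^ 2
      = ‖x‖ ^ 2 * (‖x‖ ^ 2 * ‖y‖ ^ 2 - (a ^ 2 + b ^ 2)) := by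
    have e1 : inner ℝ x (rotJ x) = 0 := by rw [real_inner_comm]; exact inner_rotJ_self x
    have e2 : inner ℝ y x = a := real_inner_comm _ _
    have e3 : inner ℝ y (rotJ x) = b := real_inner_comm _ _
    rw [← real_inner_self_eq_norm_sq]
    simp only [inner_sub_left, inner_sub_right, inner_smul_left, inner_smul_right,
      real_inner_self_eq_norm_sq, inner_rotJ_self, e1, e2, e3, norm_rotJ, conj_trivial]
    ring
  have h0 : 0 ≤ ‖x‖ ^ 2 * (‖x‖ ^ 2 * ‖y‖ ^ 2 - (a ^ 2 + b ^ 2)) := key ▸ sq_nonneg _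
  nlinarith [nonneg_of_mul_nonneg_right h0 hx']

/-- Writing `ρ²` as the modulus of `|x|² + it` reduces the triangle inequality for `ρ` to the one in
`ℂ`. -/
theorem rho_sq_eq_norm (z : Heis n) : rho z ^ 2 = ‖(⟨‖z.1‖ ^ 2, z.2⟩ : ℂ)‖ := by
  rw [← sq_eq_sq₀ (sq_nonneg _) (norm_nonneg _), ← pow_mul, rho_pow_four, Complex.sq_norm,
    Complex.normSq_mk]
  ring

/-- Cygan's triangle inequality. -/
theorem rho_mul_le (z w : Heis n) : rho (z * w) ≤ rho z + rho w := by
  refine le_of_pow_le_pow_left₀ (n := 2) (by norm_num)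
    (add_nonneg (rho_nonneg z) (rho_nonneg w)) ?_
  -- In the coordinate `|x|² + it` the group law is addition plus twice a Hermitian cross term. Its
  -- modulus is at most `ρ(z) ρ(w)`, so the total is at most `(ρ(z) + ρ(w))²`.
  have e : (⟨‖(z * w).1‖ ^ 2, (z * w).2⟩ : ℂ)
      = (⟨‖z.1‖ ^ 2, z.2⟩ : ℂ) + ⟨‖w.1‖ ^ 2, w.2⟩
        + 2 * ⟨inner ℝ z.1 w.1, inner ℝ (rotJ z.1) w.1⟩ := by
    apply Complex.ext
    · simp only [mul_def, norm_add_sq_real, Complex.add_re, Complex.mul_re, Complex.re_ofNat,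
        Complex.im_ofNat]
      ring
    · simp only [mul_def, dot_matJ_eq_inner, Complex.add_im, Complex.mul_im, Complex.re_ofNat,
        Complex.im_ofNat]
      ring
  have hc : ‖(⟨inner ℝ z.1 w.1, inner ℝ (rotJ z.1) w.1⟩ : ℂ)‖ ≤ rho z * rho w := by
    refine le_of_pow_le_pow_left₀ (n := 2) (by norm_num)
      (mul_nonneg (rho_nonneg z) (rho_nonneg w)) ?_
    rw [Complex.sq_norm, Complex.normSq_mk, ← sq, ← sq, mul_pow]
    refine (inner_sq_add_inner_rotJ_sq_le _ _).trans ?_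
    gcongr
    · exact norm_fst_le_rho z
    · exact norm_fst_le_rho w
  rw [rho_sq_eq_norm, e]
  refine (norm_add_le _ _).trans ?_
  have h1 := norm_add_le (⟨‖z.1‖ ^ 2, z.2⟩ : ℂ) ⟨‖w.1‖ ^ 2, w.2⟩
  rw [← rho_sq_eq_norm, ← rho_sq_eq_norm] at h1
  rw [norm_mul, Complex.norm_ofNat]
  nlinarith

theorem rho_inv_mul_comm (z w : Heis n) : rho (z⁻¹ * w) = rho (w⁻¹ * z) := by
  rw [← rho_inv, mul_inv_rev, inv_inv]

theorem le_rho_mul (z w : Heis n) : rho z - rho w ≤ rho (z * w) := by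
  have h := rho_mul_le (z * w) w⁻¹
  rw [mul_inv_cancel_right, rho_inv] at h
  linarith

theorem le_rho_mul' (z w : Heis n) : rho w - rho z ≤ rho (z * w) := by
  have h := rho_mul_le z⁻¹ (z * w)
  rw [inv_mul_cancel_left, rho_inv] at h
  linarith

/-! ### Dilations -/

/-- The dilation `(x, t) ↦ (l x, l² t)`. -/
def dil (l : ℝ) (z : Heis n) : Heis n := (l • z.1, l ^ 2 * z.2)

theorem dil_mul (l : ℝ) (z w : Heis n) : dil l (z * w) = dil l z * dil l w := by
  simp only [dil, mul_def, smul_add, WithLp.ofLp_smul, Matrix.mulVec_smul, smul_dotProduct,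
    dotProduct_smul, smul_eq_mul]
  refine Prod.ext rfl ?_
  simp only
  ring

theorem dil_inv (l : ℝ) (z : Heis n) : dil l z⁻¹ = (dil l z)⁻¹ := by
  simp [dil, inv_def]

theorem dil_dil (l m : ℝ) (z : Heis n) : dil l (dil m z) = dil (l * m) z := by
  simp only [dil, smul_smul]
  refine Prod.ext rfl ?_
  simp only
  ring

theorem dil_one (z : Heis n) : dil 1 z = z := by simp [dil]

theorem dil_zero (z : Heis n) : dil 0 z = 0 := by simp [dil]

theorem rho_dil {l : ℝ} (hl : 0 ≤ l) (z : Heis n) : rho (dil l z) = l * rho z := by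
  refine (pow_left_inj₀ (rho_nonneg _) (mul_nonneg hl (rho_nonneg z)) (n := 4) (by norm_num)).1 ?_
  rw [mul_pow, rho_pow_four, rho_pow_four, dil, norm_smul, Real.norm_of_nonneg hl]
  ring

/-- The radius `l = 0` is admitted, so that zero increments can be normalized like all others. -/
theorem exists_eq_dil {l : ℝ} {z : Heis n} (h : rho z ≤ l) :
    ∃ w : Heis n, rho w ≤ 1 ∧ dil l w = z := by
  rcases (rho_nonneg z).trans h |>.eq_or_lt with h0 | h0
  · have : z = 0 := (rho_eq_zero_iff z).1 (le_antisymm (h0 ▸ h) (rho_nonneg z))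
    exact ⟨0, by simp [(rho_eq_zero_iff (0 : Heis n)).2 rfl], by simp [dil, this]⟩
  · refine ⟨dil l⁻¹ z, ?_, by rw [dil_dil, mul_inv_cancel₀ h0.ne', dil_one]⟩
    rw [rho_dil (by positivity), inv_mul_le_iff₀ h0, mul_one]
    exact h

theorem exists_eq_dil_rho {z : Heis n} (h : z ≠ 0) :
    ∃ w : Heis n, rho w = 1 ∧ dil (rho z) w = z := by
  have h0 := rho_pos h
  refine ⟨dil (rho z)⁻¹ z, ?_, by rw [dil_dil, mul_inv_cancel₀ h0.ne', dil_one]⟩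
  rw [rho_dil (by positivity), inv_mul_cancel₀ h0.ne']

theorem isCompact_rho_le (r : ℝ) : IsCompact {z : Heis n | rho z ≤ r} := by
  refine Metric.isCompact_of_isClosed_isBounded (isClosed_le continuous_rho continuous_const) ?_
  refine (Metric.isBounded_closedBall (x := (0 : Heis n)) (r := max r (r ^ 2))).subset ?_
  intro z hz
  rw [mem_closedBall_zero_iff, Prod.norm_def]
  refine max_le_max ((norm_fst_le_rho z).trans hz) ((abs_snd_le_rho_sq z).trans ?_)
  exact pow_le_pow_left₀ (rho_nonneg z) hz 2

theorem isCompact_rho_eq (r : ℝ) : IsCompact {z : Heis n | rho z = r} :=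
  (isCompact_rho_le r).of_isClosed_subset (isClosed_eq continuous_rho continuous_const)
    fun _ hz => le_of_eq hz

/-! ### The topological group structure and the Haar measure -/

theorem contDiff_dot_matJ : ContDiff ℝ ⊤ (fun p : EuclideanSpace ℝ (Fin n ⊕ Fin n) ×
    EuclideanSpace ℝ (Fin n ⊕ Fin n) => dotProduct p.1.ofLp ((matJ n).mulVec p.2.ofLp)) := by
  simp only [dot_matJ]
  fun_prop

theorem contDiff_mul : ContDiff ℝ ⊤ (fun p : Heis n × Heis n => p.1 * p.2) := by
  simp only [mul_def]
  refine ContDiff.prodMk (by fun_prop) (ContDiff.add (by fun_prop) ?_)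
  exact contDiff_dot_matJ.comp (f := fun p : Heis n × Heis n => (p.1.1, p.2.1)) (by fun_prop)

theorem contDiff_inv : ContDiff ℝ ⊤ (fun p : Heis n => p⁻¹) := by
  simp only [inv_def]
  fun_prop

instance : IsTopologicalGroup (Heis n) where
  continuous_mul := contDiff_mul.continuous
  continuous_inv := contDiff_inv.continuous

/-- Left translation is a shear: a translation in `x` followed, for each fixed `x`, by a translation
in `t`. -/
theorem measurePreserving_mul_left (z : Heis n) :
    MeasurePreserving (fun w : Heis n => z * w) volume volume := by
  refine (measurePreserving_add_left volume z.1).skew_product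
    (g := fun x s => z.2 + s + dotProduct z.1.ofLp ((matJ n).mulVec x.ofLp)) ?_ ?_
  · have : Continuous fun w : Heis n => (z * w).2 := continuous_snd.comp (continuous_const_mul z)
    exact this.measurable
  · refine Filter.Eventually.of_forall fun x => ?_
    have := (measurePreserving_add_left (volume : Measure ℝ)
      (z.2 + dotProduct z.1.ofLp ((matJ n).mulVec x.ofLp))).map_eq
    rw [← this]
    congr 1
    funext s
    ring

instance : (volume : Measure (Heis n)).IsMulLeftInvariant :=
  ⟨fun z => (measurePreserving_mul_left z).map_eq⟩

theorem mem_rball {z w : Heis n} {r : ℝ} : w ∈ rball z r ↔ rho (z⁻¹ * w) < r := Iff.rfl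

theorem isOpen_rball (z : Heis n) (r : ℝ) : IsOpen (rball z r) :=
  isOpen_lt (continuous_rho.comp (continuous_const_mul z⁻¹)) continuous_const

theorem measurableSet_rball (z : Heis n) (r : ℝ) : MeasurableSet (rball z r) :=
  (isOpen_rball z r).measurableSet

theorem volume_rball_eq (z : Heis n) (r : ℝ) : volume (rball z r) = volume (rball (1 : Heis n) r) := by
  have : rball z r = (fun w => z⁻¹ * w) ⁻¹' rball 1 r := by
    ext w
    simp [rball]
  rw [this, measure_preimage_mul]

theorem map_dil {l : ℝ} (hl : 0 < l) :
    (volume : Measure (Heis n)).map (dil l) = ENNReal.ofReal (l ^ (2 * n + 2))⁻¹ • volume := by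
  have h : (dil l : Heis n → Heis n) = Prod.map (fun x => l • x) (fun t => l ^ 2 • t) := rfl
  rw [h, Measure.volume_eq_prod, ← Measure.map_prod_map _ _ (by fun_prop) (by fun_prop),
    Measure.map_addHaar_smul _ hl.ne', Measure.map_addHaar_smul _ (by positivity),
    Measure.prod_smul_left, Measure.prod_smul_right, smul_smul, ← ENNReal.ofReal_mul (abs_nonneg _),
    ← abs_mul, ← mul_inv]
  congr 2
  rw [abs_of_pos (by positivity)]
  simp [two_mul, pow_add]

theorem volume_rball (z : Heis n) {r : ℝ} (hr : 0 < r) :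
    volume (rball z r) = ENNReal.ofReal (r ^ (2 * n + 2)) * volume (rball (1 : Heis n) 1) := by
  rw [volume_rball_eq]
  have h1 : dil r⁻¹ ⁻¹' rball (1 : Heis n) 1 = rball 1 r := by
    ext w
    simp only [mem_rball, Set.mem_preimage, inv_one, one_mul]
    rw [rho_dil (by positivity), inv_mul_lt_iff₀ hr, mul_one]
  have h2 := congrArg (fun μ => μ (rball (1 : Heis n) 1)) (map_dil (n := n) (inv_pos.2 hr))
  simp only [Measure.smul_apply, smul_eq_mul] at h2
  rw [Measure.map_apply (by unfold dil; fun_prop) (measurableSet_rball _ _), h1] at h2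
  rw [h2]
  simp

theorem volume_rball_one_pos : 0 < volume (rball (1 : Heis n) 1) :=
  (isOpen_rball _ _).measure_pos volume ⟨1, by simp [rball, one_eq_zero, (rho_eq_zero_iff (0 : Heis n)).2 rfl]⟩

theorem volume_rball_one_lt_top : volume (rball (1 : Heis n) 1) < ∞ := by
  refine (measure_mono ?_).trans_lt (isCompact_rho_le (n := n) 1).measure_lt_top
  intro w hw
  simpa using (mem_rball.1 hw).le

end Heis

end

noncomputable section

namespace Heis

variable {n : ℕ}

/-! ### Integrals of powers against measures of polynomial growth -/

/-- The function is dominated by a sum of constants `v k` on balls of radius `r k`. The growth of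
`ν` makes the `k`-th contribution a term of a geometric series. It serves both shells shrinking to
the centre and shells going to infinity. -/
theorem lintegral_le_tsum_of_shells {X : Type*} [MeasurableSpace X] {ρ : X → ℝ}
    (hρ : Measurable ρ) {Q : ℝ} {ν : Measure X} {M : ℝ≥0∞}
    (hν : ∀ r : ℝ, 0 < r → ν {x | ρ x < r} ≤ M * ENNReal.ofReal (r ^ Q))
    {f : X → ℝ≥0∞} {A x : ℝ} (hA : 0 ≤ A) (hx0 : 0 ≤ x) (hx1 : x < 1) {r v : ℕ → ℝ}
    (hr : ∀ k, 0 < r k) (hv : ∀ k, 0 ≤ v k)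
    (h : ∀ k, v k * r k ^ Q = A * x ^ k)
    (hf : ∀ y, f y ≠ 0 → ∃ k, ρ y < r k ∧ f y ≤ ENNReal.ofReal (v k)) :
    ∫⁻ y, f y ∂ν ≤ ENNReal.ofReal (A * (1 - x)⁻¹) * M := by
  have hm : ∀ k, MeasurableSet {y | ρ y < r k} := fun k => measurableSet_lt hρ measurable_const
  calc ∫⁻ y, f y ∂ν
      ≤ ∫⁻ y, ∑' k, ({y | ρ y < r k}).indicator (fun _ => ENNReal.ofReal (v k)) y ∂ν := by
        refine lintegral_mono fun y => ?_
        by_cases hy : f y = 0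
        · rw [hy]; exact zero_le
        · obtain ⟨k, hk1, hk2⟩ := hf y hy
          refine hk2.trans (le_trans ?_ (ENNReal.le_tsum k))
          have hk1 : y ∈ {y | ρ y < r k} := hk1
          rw [Set.indicator_of_mem hk1]
    _ = ∑' k, ENNReal.ofReal (v k) * ν {y | ρ y < r k} := by
        rw [lintegral_tsum fun k => (measurable_const.indicator (hm k)).aemeasurable]
        refine tsum_congr fun k => ?_
        rw [lintegral_indicator_const (hm k)]
    _ ≤ ∑' k, ENNReal.ofReal (A * x ^ k) * M := by
        refine ENNReal.tsum_le_tsum fun k => ?_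
        rw [← h k, ENNReal.ofReal_mul (hv k), mul_assoc]
        gcongr
        rw [mul_comm]
        exact hν _ (hr k)
    _ = ENNReal.ofReal (A * (1 - x)⁻¹) * M := by
        rw [ENNReal.tsum_mul_right, ← ENNReal.ofReal_tsum_of_nonneg
          (fun k => mul_nonneg hA (pow_nonneg hx0 k))
          ((summable_geometric_of_lt_one hx0 hx1).mul_left A), tsum_mul_left,
          tsum_geometric_of_lt_one hx0 hx1]

/-- The constant does not depend on the space or the measure. This allows `ν` to be Lebesgue measure
as well as `|a| dw`, whose growth constant contains `Ma(z)`. -/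
theorem exists_lintegral_rpow_near_le {s Q : ℝ} (hsQ : s < Q) (hs : 0 < s) : ∃ C : ℝ≥0,
    ∀ {X : Type} [MeasurableSpace X] (ρ : X → ℝ) (_ : Measurable ρ) (_ : ∀ x, 0 ≤ ρ x)
      (ν : Measure X) (M : ℝ≥0∞)
      (_ : ∀ r : ℝ, 0 < r → ν {x | ρ x < r} ≤ M * ENNReal.ofReal (r ^ Q)) (R : ℝ) (_ : 0 < R),
      ∫⁻ x in {x | ρ x < R}, ENNReal.ofReal (ρ x ^ (-s)) ∂ν ≤
        C * ENNReal.ofReal (R ^ (Q - s)) * M := by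
  set x : ℝ := (1 / 2 : ℝ) ^ (Q - s) with hx
  have hx0 : 0 ≤ x := by positivity
  have hx1 : x < 1 := Real.rpow_lt_one (by norm_num) (by norm_num) (by linarith)
  refine ⟨Real.toNNReal ((1 / 2) ^ (-s) * 2 ^ Q * (1 - x)⁻¹), ?_⟩
  intro X _ ρ hρ hρ0 ν M hν R hR
  rw [← lintegral_indicator (measurableSet_lt hρ measurable_const)]
  refine (lintegral_le_tsum_of_shells hρ hν
    (A := (1 / 2) ^ (-s) * 2 ^ Q * R ^ (Q - s)) (x := x) (by positivity) hx0 hx1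
    -- On the `k`-th shell only `ρ ≤ 2^{-k} R` is known, while the growth bound is for strict balls;
    -- the extra factor `2` makes the inclusion strict.
    (r := fun k => (1 / 2) ^ k * (2 * R)) (v := fun k => ((1 / 2) ^ (k + 1) * R) ^ (-s))
    (fun k => by positivity) (fun k => by positivity) ?_ ?_).trans ?_
  · intro k
    have e1 : x ^ k = ((1 / 2 : ℝ) ^ k) ^ (-s) * ((1 / 2 : ℝ) ^ k) ^ Q := by
      rw [← Real.rpow_add (by positivity), neg_add_eq_sub, hx, ← Real.rpow_natCast,
        ← Real.rpow_natCast, ← Real.rpow_mul (by norm_num), ← Real.rpow_mul (by norm_num), mul_comm]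
    have e2 : R ^ (Q - s) = R ^ (-s) * R ^ Q := by
      rw [← Real.rpow_add hR, neg_add_eq_sub]
    rw [e1, e2, pow_succ, Real.mul_rpow (by positivity) hR.le, Real.mul_rpow (by positivity)
      (by positivity), Real.mul_rpow (by positivity) (by positivity), Real.mul_rpow (by positivity)
      (by positivity)]
    ring
  · intro y hy
    have hyR : ρ y < R := by
      by_contra hn
      exact hy (Set.indicator_of_notMem (s := {x | ρ x < R}) hn _)
    have hyR' : y ∈ {x | ρ x < R} := hyR
    rw [Set.indicator_of_mem hyR'] at hy ⊢
    -- Points with `ρ y = 0` lie in no shell. There `0 ^ (-s) = 0` by convention, so they do not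
    -- contribute.
    have hpos : 0 < ρ y := by
      refine (hρ0 y).lt_of_ne fun h0 => hy ?_
      rw [← h0, Real.zero_rpow (by linarith), ENNReal.ofReal_zero]
    obtain ⟨k, hk1, hk2⟩ := exists_nat_pow_near_of_lt_one (div_pos hpos hR)
      ((div_le_one hR).2 hyR.le) (by norm_num : (0 : ℝ) < 1 / 2) (by norm_num)
    rw [lt_div_iff₀ hR] at hk1
    rw [div_le_iff₀ hR] at hk2
    refine ⟨k, ?_, ENNReal.ofReal_le_ofReal ?_⟩
    · have : 0 < (1 / 2 : ℝ) ^ k * R := by positivity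
      linarith
    · exact Real.rpow_le_rpow_of_nonpos (by positivity) hk1.le (by linarith)
  · refine le_of_eq ?_
    congr 1
    have h1 : 0 < 1 - x := by linarith
    rw [show ∀ c : ℝ, ((c.toNNReal : ℝ≥0) : ℝ≥0∞) = ENNReal.ofReal c from fun c => rfl,
      ← ENNReal.ofReal_mul (by positivity)]
    congr 1
    ring

theorem exists_lintegral_rpow_far_le {s Q : ℝ} (hsQ : Q < s) (hs : 0 < s) : ∃ C : ℝ≥0,
    ∀ {X : Type} [MeasurableSpace X] (ρ : X → ℝ) (_ : Measurable ρ)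
      (ν : Measure X) (M : ℝ≥0∞)
      (_ : ∀ r : ℝ, 0 < r → ν {x | ρ x < r} ≤ M * ENNReal.ofReal (r ^ Q)) (R : ℝ) (_ : 0 < R),
      ∫⁻ x in {x | R ≤ ρ x}, ENNReal.ofReal (ρ x ^ (-s)) ∂ν ≤
        C * ENNReal.ofReal (R ^ (Q - s)) * M := by
  set x : ℝ := (2 : ℝ) ^ (Q - s) with hx
  have hx0 : 0 ≤ x := by positivity
  have hx1 : x < 1 := Real.rpow_lt_one_of_one_lt_of_neg (by norm_num) (by linarith)
  refine ⟨Real.toNNReal (2 ^ Q * (1 - x)⁻¹), ?_⟩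
  intro X _ ρ hρ ν M hν R hR
  rw [← lintegral_indicator (measurableSet_le measurable_const hρ)]
  refine (lintegral_le_tsum_of_shells hρ hν
    (A := 2 ^ Q * R ^ (Q - s)) (x := x) (by positivity) hx0 hx1
    (r := fun k => 2 ^ (k + 1) * R) (v := fun k => (2 ^ k * R) ^ (-s))
    (fun k => by positivity) (fun k => by positivity) ?_ ?_).trans ?_
  · intro k
    have e1 : x ^ k = ((2 : ℝ) ^ k) ^ (-s) * ((2 : ℝ) ^ k) ^ Q := by
      rw [← Real.rpow_add (by positivity), neg_add_eq_sub, hx, ← Real.rpow_natCast,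
        ← Real.rpow_natCast, ← Real.rpow_mul (by norm_num), ← Real.rpow_mul (by norm_num), mul_comm]
    have e2 : R ^ (Q - s) = R ^ (-s) * R ^ Q := by
      rw [← Real.rpow_add hR, neg_add_eq_sub]
    rw [e1, e2, pow_succ, Real.mul_rpow (by positivity) hR.le, Real.mul_rpow (by positivity)
      (by positivity), Real.mul_rpow (by positivity) (by positivity)]
    ring
  · intro y hy
    have hyR : R ≤ ρ y := by
      by_contra hn
      exact hy (Set.indicator_of_notMem (s := {x | R ≤ ρ x}) hn _)
    have hyR' : y ∈ {x | R ≤ ρ x} := hyR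
    rw [Set.indicator_of_mem hyR']
    obtain ⟨k, hk1, hk2⟩ := exists_nat_pow_near ((one_le_div hR).2 hyR)
      (by norm_num : (1 : ℝ) < 2)
    rw [le_div_iff₀ hR] at hk1
    rw [div_lt_iff₀ hR] at hk2
    refine ⟨k, hk2, ENNReal.ofReal_le_ofReal ?_⟩
    exact Real.rpow_le_rpow_of_nonpos (by positivity) hk1 (by linarith)
  · refine le_of_eq ?_
    congr 1
    have h1 : 0 < 1 - x := by linarith
    rw [show ∀ c : ℝ, ((c.toNNReal : ℝ≥0) : ℝ≥0∞) = ENNReal.ofReal c from fun c => rfl,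
      ← ENNReal.ofReal_mul (by positivity)]
    congr 1
    ring

/-! ### An inequality of Young type -/

/-- Hölder's inequality for the factorization `f k = f^{1-1/q} · (f^{1/q} k)`; equivalently Jensen's
inequality for the measure `f dμ`. -/
theorem lintegral_mul_rpow_le {X : Type*} [MeasurableSpace X] {μ : Measure X} {f k : X → ℝ≥0∞}
    (hf : AEMeasurable f μ) (hk : AEMeasurable k μ) {q : ℝ} (hq : 1 < q) :
    (∫⁻ w, f w * k w ∂μ) ^ q ≤ (∫⁻ w, f w ∂μ) ^ (q - 1) * ∫⁻ w, f w * k w ^ q ∂μ := by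
  have hq0 : 0 < q := by linarith
  have hpq : (q / (q - 1)).HolderConjugate q := (Real.HolderConjugate.conjExponent hq).symm
  have e : ∀ w, f w * k w = f w ^ ((q - 1) / q) * (f w ^ (1 / q) * k w) := by
    intro w
    rw [← mul_assoc, ← ENNReal.rpow_add_of_nonneg _ _ (div_nonneg (by linarith) hq0.le)
      (by positivity)]
    rw [← add_div, sub_add_cancel, div_self hq0.ne', ENNReal.rpow_one]
  have h := ENNReal.lintegral_mul_le_Lp_mul_Lq μ hpq (f := fun w => f w ^ ((q - 1) / q))
    (g := fun w => f w ^ (1 / q) * k w) (hf.pow_const _) ((hf.pow_const _).mul hk)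
  have hq1 : q - 1 ≠ 0 := by linarith
  simp only [Pi.mul_apply, ← e] at h
  have e1 : ∀ w, (f w ^ ((q - 1) / q)) ^ (q / (q - 1)) = f w := fun w => by
    rw [← ENNReal.rpow_mul, show (q - 1) / q * (q / (q - 1)) = 1 by field_simp, ENNReal.rpow_one]
  have e2 : ∀ w, (f w ^ (1 / q) * k w) ^ q = f w * k w ^ q := fun w => by
    rw [ENNReal.mul_rpow_of_nonneg _ _ hq0.le, ← ENNReal.rpow_mul, one_div_mul_cancel hq0.ne',
      ENNReal.rpow_one]
  simp only [e1, e2] at h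
  refine (ENNReal.rpow_le_rpow h hq0.le).trans_eq ?_
  rw [ENNReal.mul_rpow_of_nonneg _ _ hq0.le, ← ENNReal.rpow_mul, ← ENNReal.rpow_mul,
    one_div_mul_cancel hq0.ne', ENNReal.rpow_one]
  congr 2
  field_simp

theorem measurable_rho : Measurable (rho : Heis n → ℝ) := continuous_rho.measurable

/-- Convolution with a kernel cut off at distance `R` maps `L¹` to `L^q`. -/
theorem lintegral_conv_rpow_le {f : Heis n → ℝ≥0∞} (hf : AEMeasurable f volume)
    {k : Heis n → ℝ≥0∞} (hk : Measurable k) {q : ℝ} (hq : 1 < q) {S : Set (Heis n)} {R : ℝ}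
    (hS : MeasurableSet S) (hR : ∀ w, f w ≠ 0 → ∀ v ∈ S, rho (w⁻¹ * v) < R) :
    ∫⁻ v in S, (∫⁻ w, f w * k (w⁻¹ * v)) ^ q ≤
      (∫⁻ w, f w) ^ q * ∫⁻ u in {u : Heis n | rho u < R}, k u ^ q := by
  have hm2 : Measurable fun p : Heis n × Heis n => k (p.2⁻¹ * p.1) :=
    hk.comp (by fun_prop)
  have hq0 : 0 < q := by linarith
  calc ∫⁻ v in S, (∫⁻ w, f w * k (w⁻¹ * v)) ^ q
      ≤ ∫⁻ v in S, (∫⁻ w, f w) ^ (q - 1) * ∫⁻ w, f w * k (w⁻¹ * v) ^ q := by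
        refine lintegral_mono fun v => lintegral_mul_rpow_le hf ?_ hq
        exact (hm2.comp (measurable_const.prodMk measurable_id)).aemeasurable
    _ = (∫⁻ w, f w) ^ (q - 1) * ∫⁻ v in S, ∫⁻ w, f w * k (w⁻¹ * v) ^ q := by
        refine lintegral_const_mul'' _ ?_
        have h1 : AEMeasurable (fun p : Heis n × Heis n => f p.2 * k (p.2⁻¹ * p.1) ^ q)
            ((volume.restrict S).prod volume) :=
          hf.comp_snd.mul (hm2.pow_const q).aemeasurable
        exact h1.lintegral_prod_right'
    _ = (∫⁻ w, f w) ^ (q - 1) * ∫⁻ w, f w * ∫⁻ v in S, k (w⁻¹ * v) ^ q := by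
        rw [lintegral_lintegral_swap]
        · congr 1
          refine lintegral_congr fun w => ?_
          rw [lintegral_const_mul]
          exact (hm2.comp (measurable_id.prodMk measurable_const)).pow_const q
        · exact hf.comp_snd.mul (hm2.pow_const q).aemeasurable
    _ ≤ (∫⁻ w, f w) ^ (q - 1) * ∫⁻ w, f w * ∫⁻ u in {u : Heis n | rho u < R}, k u ^ q := by
        refine mul_le_mul_right (lintegral_mono fun w => ?_) _
        by_cases hw : f w = 0
        · simp [hw]
        · refine mul_le_mul_right ?_ _
          -- For fixed `w` substitute `u = w⁻¹v` by left invariance. Since `f w ≠ 0`, the image of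
          -- `S` stays inside `{ρ < R}`.
          rw [← lintegral_indicator hS,
            ← lintegral_indicator (measurableSet_lt measurable_rho measurable_const),
            ← lintegral_mul_left_eq_self (Set.indicator _ fun u => k u ^ q) w⁻¹]
          refine lintegral_mono fun v => ?_
          by_cases hv : v ∈ S
          · have h2 : w⁻¹ * v ∈ {u : Heis n | rho u < R} := hR w hw v hv
            rw [Set.indicator_of_mem hv, Set.indicator_of_mem h2]
          · rw [Set.indicator_of_notMem hv]
            exact zero_le
    _ = _ := by
        rw [lintegral_mul_const'' _ hf, ← mul_assoc]
        congr 1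
        have := ENNReal.rpow_add_of_nonneg (x := ∫⁻ w, f w) (q - 1) 1 (by linarith) zero_le_one
        rw [sub_add_cancel, ENNReal.rpow_one] at this
        exact this.symm

end Heis

end

noncomputable section

namespace Heis

open scoped ContDiff

variable {n : ℕ}

/-! ### Homogeneous functions and the left invariant fields -/

theorem dil_ne_zero {l : ℝ} (hl : 0 < l) {z : Heis n} (hz : z ≠ 0) : dil l z ≠ 0 := by
  intro h
  have h1 := rho_dil hl.le z
  rw [h, (rho_eq_zero_iff _).2 rfl] at h1
  exact (mul_pos hl (rho_pos hz)).ne h1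

/-- The dilations as continuous linear maps. -/
def dilL (l : ℝ) : Heis n →L[ℝ] Heis n :=
  (l • ContinuousLinearMap.id ℝ _).prodMap (l ^ 2 • ContinuousLinearMap.id ℝ _)

/-- `f` is smooth away from the origin and homogeneous of degree `-d`. -/
structure IsHomog (d : ℕ) (f : Heis n → ℝ) : Prop where
  contDiffOn : ContDiffOn ℝ ∞ f {0}ᶜ
  map_dil : ∀ l : ℝ, 0 < l → ∀ z : Heis n, z ≠ 0 → f (dil l z) = (l ^ d)⁻¹ * f z

theorem IsHomog.contDiffAt {d : ℕ} {f : Heis n → ℝ} (hf : IsHomog d f) {z : Heis n} (hz : z ≠ 0) :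
    ContDiffAt ℝ ∞ f z :=
  hf.contDiffOn.contDiffAt (isOpen_compl_singleton.mem_nhds hz)

theorem IsHomog.differentiableAt {d : ℕ} {f : Heis n → ℝ} (hf : IsHomog d f) {z : Heis n}
    (hz : z ≠ 0) : DifferentiableAt ℝ f z :=
  (hf.contDiffAt hz).differentiableAt (by simp)

theorem IsHomog.measurable {d : ℕ} {f : Heis n → ℝ} (hf : IsHomog d f) : Measurable f :=
  measurable_of_continuousOn_compl_singleton 0 hf.contDiffOn.continuousOn

/-- Continuity gives a bound on the compact unit sphere, and homogeneity carries it to all other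
points. -/
theorem IsHomog.exists_bound {d : ℕ} {f : Heis n → ℝ} (hf : IsHomog d f) :
    ∃ C : ℝ, 0 ≤ C ∧ ∀ z : Heis n, z ≠ 0 → |f z| ≤ C * (rho z ^ d)⁻¹ := by
  have hne : ∀ z : Heis n, rho z = 1 → z ≠ 0 := by
    rintro z hz rfl
    rw [(rho_eq_zero_iff _).2 rfl] at hz
    exact zero_ne_one hz
  obtain ⟨C, hC⟩ := (isCompact_rho_eq (n := n) 1).exists_bound_of_continuousOn
    (hf.contDiffOn.continuousOn.mono fun z hz => hne z hz)
  refine ⟨max C 0, le_max_right _ _, fun z hz => ?_⟩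
  obtain ⟨w, hw1, hw⟩ := exists_eq_dil_rho hz
  have h0 := rho_pos hz
  rw [← hw, hf.map_dil _ h0 w (hne w hw1), hw, abs_mul, abs_of_pos (by positivity), mul_comm]
  gcongr
  exact (hC w hw1).trans (le_max_left _ _)

theorem IsHomog.fderiv_dil {d : ℕ} {f : Heis n → ℝ} (hf : IsHomog d f) {l : ℝ} (hl : 0 < l)
    {z : Heis n} (hz : z ≠ 0) (v : Heis n) :
    fderiv ℝ f (dil l z) (dil l v) = (l ^ d)⁻¹ * fderiv ℝ f z v := by
  have h1 : HasFDerivAt (fun p => f (dilL l p)) ((fderiv ℝ f (dil l z)).comp (dilL l)) z :=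
    HasFDerivAt.comp z (hf.differentiableAt (dil_ne_zero hl hz)).hasFDerivAt
      (dilL l).hasFDerivAt
  have h2 : HasFDerivAt (fun p => (l ^ d)⁻¹ * f p) ((l ^ d)⁻¹ • fderiv ℝ f z) z :=
    (hf.differentiableAt hz).hasFDerivAt.const_mul _
  have h3 : (fun p => f (dilL l p)) =ᶠ[nhds z] fun p => (l ^ d)⁻¹ * f p := by
    filter_upwards [isOpen_compl_singleton.mem_nhds hz] with p hp
    exact hf.map_dil l hl p hp
  have h4 := h1.unique (h2.congr_of_eventuallyEq h3)
  exact congrArg (fun L : Heis n →L[ℝ] ℝ => L v) h4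

/-- The left invariant field `X_j` as a vector valued function. -/
def vecX (j : Fin n ⊕ Fin n) (z : Heis n) : Heis n :=
  (EuclideanSpace.single j (1 : ℝ),
    dotProduct z.1.ofLp ((matJ n).mulVec (EuclideanSpace.single j (1 : ℝ)).ofLp))

theorem fieldX_eq (j : Fin n ⊕ Fin n) (f : Heis n → ℝ) (z : Heis n) :
    fieldX j f z = fderiv ℝ f z (vecX j z) := by
  rcases j with i | i
  · simp only [fieldX, vecX, dot_matJ]
    simp
  · simp only [fieldX, vecX, dot_matJ]
    simp

theorem contDiff_vecX (j : Fin n ⊕ Fin n) : ContDiff ℝ ∞ (vecX j : Heis n → Heis n) := by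
  unfold vecX
  simp only [dot_matJ]
  fun_prop

theorem vecX_dil {l : ℝ} (hl : 0 < l) (j : Fin n ⊕ Fin n) (z : Heis n) :
    vecX j (dil l z) = l⁻¹ • dil l (vecX j z) := by
  refine Prod.ext ?_ ?_
  · simp [vecX, dil, smul_smul, hl.ne']
  · simp only [vecX, dil, WithLp.ofLp_smul, smul_dotProduct, Prod.smul_snd, smul_eq_mul]
    field_simp

/-- Horizontal fields cost one degree and `∂_t` costs two. Two horizontal fields, or one `∂_t`,
applied to `ρ^{-2n}` thus give the critical degree `-Q`, where only truncated integrals are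
available. -/
theorem IsHomog.fieldX {d : ℕ} {f : Heis n → ℝ} (hf : IsHomog d f) (j : Fin n ⊕ Fin n) :
    IsHomog (d + 1) (fieldX j f) := by
  have e : Heis.fieldX j f = fun z => fderiv ℝ f z (vecX j z) := funext (fieldX_eq j f)
  rw [e]
  constructor
  · exact (hf.contDiffOn.fderiv_of_isOpen isOpen_compl_singleton (by simp)).clm_apply
      (contDiff_vecX j).contDiffOn
  · intro l hl z hz
    rw [vecX_dil hl, map_smul, hf.fderiv_dil hl hz, smul_eq_mul, pow_succ, mul_inv]
    ring

theorem IsHomog.fieldT {d : ℕ} {f : Heis n → ℝ} (hf : IsHomog d f) :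
    IsHomog (d + 2) (fieldT f) := by
  constructor
  · exact (hf.contDiffOn.fderiv_of_isOpen isOpen_compl_singleton (by simp)).clm_apply
      contDiffOn_const
  · intro l hl z hz
    have h : ((0 : EuclideanSpace ℝ (Fin n ⊕ Fin n)), (1 : ℝ))
        = (l ^ 2)⁻¹ • dil l ((0 : EuclideanSpace ℝ (Fin n ⊕ Fin n)), (1 : ℝ)) := by
      refine Prod.ext ?_ ?_
      · simp [dil]
      · simp [dil, hl.ne']
    rw [Heis.fieldT, h, map_smul, hf.fderiv_dil hl hz, smul_eq_mul, pow_add, mul_inv, Heis.fieldT]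
    ring

theorem rho_pow_two_mul (z : Heis n) : rho z ^ (2 * n) = (‖z.1‖ ^ 4 + z.2 ^ 2) ^ ((n : ℝ) / 2) := by
  rw [rho, ← Real.rpow_natCast, ← Real.rpow_mul (by positivity)]
  congr 1
  push_cast
  ring

theorem isHomog_kernel : IsHomog (2 * n) (kernel : Heis n → ℝ) := by
  constructor
  · intro z hz
    have hz' : ‖z.1‖ ^ 4 + z.2 ^ 2 ≠ 0 := by
      rw [← rho_pow_four]
      exact (pow_pos (rho_pos hz) 4).ne'
    have h1 : ContDiffAt ℝ ∞ (fun z : Heis n => ((‖z.1‖ ^ 2) ^ 2 + z.2 ^ 2) ^ ((n : ℝ) / 2)) z := by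
      refine ContDiffAt.rpow_const_of_ne ?_ ?_
      · exact (((contDiff_fst.norm_sq ℝ).pow 2).add (contDiff_snd.pow 2)).contDiffAt
      · rw [← pow_mul]; exact hz'
    have e : (kernel : Heis n → ℝ) =
        fun z : Heis n => (((‖z.1‖ ^ 2) ^ 2 + z.2 ^ 2) ^ ((n : ℝ) / 2))⁻¹ := by
      funext z
      rw [kernel, rho_pow_two_mul, ← pow_mul]
    rw [e]
    refine (h1.inv ?_).contDiffWithinAt
    rw [← pow_mul]
    exact (Real.rpow_pos_of_pos (lt_of_le_of_ne (by positivity) hz'.symm) _).ne'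
  · intro l hl z _
    rw [kernel, kernel, rho_dil hl.le, mul_pow, mul_inv]

/-! ### Second order derivatives -/

/-- By the product rule the Hessian appears together with the derivative of the field `X_k` along
`X_j`. That derivative is vertical and constant, because the `t`-component of `X_k` is linear in
`x`. -/
theorem fieldX_fieldX_eq {f : Heis n → ℝ} {z : Heis n} (hf : ContDiffAt ℝ ∞ f z)
    (j k : Fin n ⊕ Fin n) :
    fieldX j (fieldX k f) z = fderiv ℝ (fderiv ℝ f) z (vecX j z) (vecX k z)
      + dotProduct (EuclideanSpace.single j (1 : ℝ)).ofLp
          ((matJ n).mulVec (EuclideanSpace.single k (1 : ℝ)).ofLp) * fieldT f z := by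
  have e : fieldX k f = fun z => fderiv ℝ f z (vecX k z) := funext (fieldX_eq k f)
  have h1 : HasFDerivAt (fderiv ℝ f) (fderiv ℝ (fderiv ℝ f) z) z :=
    ((hf.fderiv_right (m := ∞) (by simp)).differentiableAt (by simp)).hasFDerivAt
  have h2 : HasFDerivAt (vecX k) (fderiv ℝ (vecX k) z) z :=
    ((contDiff_vecX k).differentiable (by simp) z).hasFDerivAt
  have h3 : fderiv ℝ (vecX k) z (vecX j z) =
      dotProduct (EuclideanSpace.single j (1 : ℝ)).ofLp
          ((matJ n).mulVec (EuclideanSpace.single k (1 : ℝ)).ofLp) •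
        ((0 : EuclideanSpace ℝ (Fin n ⊕ Fin n)), (1 : ℝ)) := by
    have h4 : HasDerivAt (fun s : ℝ => vecX k (z + s • vecX j z))
        (fderiv ℝ (vecX k) z (vecX j z)) 0 := by
      have h2' : HasFDerivAt (vecX k) (fderiv ℝ (vecX k) z) (z + (0 : ℝ) • vecX j z) := by
        simpa using h2
      refine HasFDerivAt.comp_hasDerivAt (f := fun s : ℝ => z + s • vecX j z) (0 : ℝ) h2' ?_
      simpa using ((hasDerivAt_id (0 : ℝ)).smul_const (vecX j z)).const_add z
    have h5 : HasDerivAt (fun s : ℝ => vecX k (z + s • vecX j z))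
        (dotProduct (EuclideanSpace.single j (1 : ℝ)).ofLp
          ((matJ n).mulVec (EuclideanSpace.single k (1 : ℝ)).ofLp) •
        ((0 : EuclideanSpace ℝ (Fin n ⊕ Fin n)), (1 : ℝ))) 0 := by
      have h6 : (fun s : ℝ => vecX k (z + s • vecX j z)) = fun s : ℝ => vecX k z +
          s • (dotProduct (EuclideanSpace.single j (1 : ℝ)).ofLp
          ((matJ n).mulVec (EuclideanSpace.single k (1 : ℝ)).ofLp) •
        ((0 : EuclideanSpace ℝ (Fin n ⊕ Fin n)), (1 : ℝ))) := by
        funext s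
        refine Prod.ext ?_ ?_
        · simp [vecX]
        · simp only [vecX, Prod.fst_add, Prod.smul_fst, WithLp.ofLp_add, WithLp.ofLp_smul,
            add_dotProduct, smul_dotProduct, Prod.snd_add, Prod.smul_snd, smul_eq_mul, mul_one]
      rw [h6]
      simpa only [one_smul, id] using ((hasDerivAt_id (0 : ℝ)).smul_const _).const_add (vecX k z)
    exact h4.unique h5
  rw [fieldX_eq, e, (h1.clm_apply h2).fderiv]
  simp only [add_apply, ContinuousLinearMap.comp_apply,
    ContinuousLinearMap.flip_apply, h3, map_smul, smul_eq_mul, fieldT]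
  ring

theorem dot_matJ_swap (x y : Fin n ⊕ Fin n → ℝ) :
    dotProduct y ((matJ n).mulVec x) = -dotProduct x ((matJ n).mulVec y) := by
  rw [dot_matJ, dot_matJ, ← mul_neg, ← Finset.sum_neg_distrib]
  congr 1
  refine Finset.sum_congr rfl fun i _ => ?_
  ring

/-- The Hessian is symmetric and `J` antisymmetric, so only twice the vertical term survives in the
commutator. It is needed because `X^I` allows a single order of the factors. -/
theorem fieldX_fieldX_comm {f : Heis n → ℝ} {z : Heis n} (hf : ContDiffAt ℝ ∞ f z)
    (j k : Fin n ⊕ Fin n) :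
    fieldX j (fieldX k f) z = fieldX k (fieldX j f) z
      + 2 * dotProduct (EuclideanSpace.single j (1 : ℝ)).ofLp
          ((matJ n).mulVec (EuclideanSpace.single k (1 : ℝ)).ofLp) * fieldT f z := by
  rw [fieldX_fieldX_eq hf, fieldX_fieldX_eq hf, dot_matJ_swap
    (EuclideanSpace.single j (1 : ℝ)).ofLp (EuclideanSpace.single k (1 : ℝ)).ofLp]
  have h : fderiv ℝ (fderiv ℝ f) z (vecX j z) (vecX k z) =
      fderiv ℝ (fderiv ℝ f) z (vecX k z) (vecX j z) :=
    (hf.isSymmSndFDerivAt (by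
      simp only [minSmoothness_of_isRCLikeNormedField]
      exact WithTop.coe_le_coe.2 (le_top : (2 : ℕ∞) ≤ ⊤))).eq _ _
  rw [h]
  ring

/-! ### Second-order products as ordered monomials `X^I` -/

theorem foldr_iterate_zero {α ι : Type*} (op : ι → α → α) (e : ι → ℕ) (g : α) (L : List ι)
    (h : ∀ i ∈ L, e i = 0) : L.foldr (fun i g => (op i)^[e i] g) g = g := by
  induction L with
  | nil => rfl
  | cons x xs ih =>
    rw [List.foldr_cons, ih fun i hi => h i (List.mem_cons_of_mem _ hi), h x List.mem_cons_self]
    rfl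

theorem foldr_iterate_single {α : Type*} {m : ℕ} (op : Fin m → α → α) (e : Fin m → ℕ) (g : α)
    (L : List (Fin m)) (hL : L.Nodup) (i : Fin m) (hi : i ∈ L) (h : ∀ j ≠ i, e j = 0) :
    L.foldr (fun i g => (op i)^[e i] g) g = (op i)^[e i] g := by
  induction L with
  | nil => simp at hi
  | cons x xs ih =>
    rw [List.nodup_cons] at hL
    rw [List.foldr_cons]
    by_cases hx : i = x
    · subst hx
      rw [foldr_iterate_zero]
      intro j hj
      exact h j fun hji => hL.1 (hji ▸ hj)
    · rw [ih hL.2 ((List.mem_cons.1 hi).resolve_left hx), h x (Ne.symm hx)]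
      rfl

theorem foldr_iterate_pair {α : Type*} {m : ℕ} (op : Fin m → α → α) (e : Fin m → ℕ) (g : α)
    (L : List (Fin m)) (hL : L.Pairwise (· < ·)) (i k : Fin m) (hik : i < k) (hi : i ∈ L)
    (hk : k ∈ L) (h : ∀ j, j ≠ i → j ≠ k → e j = 0) :
    L.foldr (fun i g => (op i)^[e i] g) g = (op i)^[e i] ((op k)^[e k] g) := by
  induction L with
  | nil => simp at hi
  | cons x xs ih =>
    rw [List.pairwise_cons] at hL
    rw [List.foldr_cons]
    by_cases hx : i = x
    · subst hx
      congr 1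
      have hk' : k ∈ xs := (List.mem_cons.1 hk).resolve_left hik.ne'
      have hni : i ∉ xs := fun hmem => lt_irrefl _ (hL.1 i hmem)
      -- Since `i` does not occur in the tail, its exponent may be set to zero there, which reduces
      -- the tail to a single active index.
      have h1 := foldr_iterate_single op (fun j => if j = i then 0 else e j) g xs
        (hL.2.imp fun hab => hab.ne) k hk' fun j hj => by
          by_cases hji : j = i
          · simp [hji]
          · simp [hji, h j hji hj]
      simp only [hik.ne', if_false] at h1
      rw [← h1]
      refine List.foldr_ext _ _ _ fun a ha b => ?_
      have hai : a ≠ i := fun h' => hni (h' ▸ ha)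
      simp [hai]
    · have hi' := (List.mem_cons.1 hi).resolve_left hx
      have hxi := hL.1 i hi'
      have hkx : k ≠ x := (hxi.trans hik).ne'
      rw [ih hL.2 hi' ((List.mem_cons.1 hk).resolve_left hkx), h x hxi.ne (hxi.trans hik).ne]
      rfl

theorem fieldPow_elim (e₁ e₂ : Fin n → ℕ) (m : ℕ) (f : Heis n → ℝ) :
    fieldPow (Sum.elim e₁ e₂, m) f =
      (List.finRange n).foldr (fun i g => (fieldX (Sum.inl i))^[e₁ i] g)
        ((List.finRange n).foldr (fun i g => (fieldX (Sum.inr i))^[e₂ i] g) (fieldT^[m] f)) := rfl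

theorem exists_fieldPow_eq_of_lt_inl {i k : Fin n} (hik : i ≤ k) : ∃ I : MultiIndex n,
    hdeg I = 2 ∧ ∀ f, fieldPow I f = fieldX (Sum.inl i) (fieldX (Sum.inl k) f) := by
  refine ⟨(Sum.elim (Pi.single i 1 + Pi.single k 1) 0, 0), ?_, fun f => ?_⟩
  · simp [hdeg, Finset.sum_add_distrib]
  · rw [fieldPow_elim, foldr_iterate_zero (fun i => fieldX (Sum.inr i)) 0 _ _ fun _ _ => rfl]
    rcases hik.eq_or_lt with rfl | hlt
    · rw [foldr_iterate_single _ _ _ _ (List.nodup_finRange n) i (List.mem_finRange i)]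
      · simp
      · intro j hj; simp [hj]
    · rw [foldr_iterate_pair _ _ _ _ (List.pairwise_lt_finRange n) i k hlt (List.mem_finRange i)
        (List.mem_finRange k)]
      · simp [hlt.ne, hlt.ne']
      · intro j hj hj'; simp [hj, hj']

theorem exists_fieldPow_eq_of_lt_inr {i k : Fin n} (hik : i ≤ k) : ∃ I : MultiIndex n,
    hdeg I = 2 ∧ ∀ f, fieldPow I f = fieldX (Sum.inr i) (fieldX (Sum.inr k) f) := by
  refine ⟨(Sum.elim 0 (Pi.single i 1 + Pi.single k 1), 0), ?_, fun f => ?_⟩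
  · simp [hdeg, Finset.sum_add_distrib]
  · rw [fieldPow_elim, foldr_iterate_zero (fun i => fieldX (Sum.inl i)) 0 _ _ fun _ _ => rfl]
    rcases hik.eq_or_lt with rfl | hlt
    · rw [foldr_iterate_single _ _ _ _ (List.nodup_finRange n) i (List.mem_finRange i)]
      · simp
      · intro j hj; simp [hj]
    · rw [foldr_iterate_pair _ _ _ _ (List.pairwise_lt_finRange n) i k hlt (List.mem_finRange i)
        (List.mem_finRange k)]
      · simp [hlt.ne, hlt.ne']
      · intro j hj hj'; simp [hj, hj']

theorem exists_fieldPow_eq_inl_inr (i k : Fin n) : ∃ I : MultiIndex n,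
    hdeg I = 2 ∧ ∀ f, fieldPow I f = fieldX (Sum.inl i) (fieldX (Sum.inr k) f) := by
  refine ⟨(Sum.elim (Pi.single i 1) (Pi.single k 1), 0), ?_, fun f => ?_⟩
  · simp [hdeg]
  · rw [fieldPow_elim, foldr_iterate_single (fun i => fieldX (Sum.inr i)) _ _ _
      (List.nodup_finRange n) k (List.mem_finRange k),
      foldr_iterate_single (fun i => fieldX (Sum.inl i)) _ _ _ (List.nodup_finRange n) i (List.mem_finRange i)]
    · simp
    · intro j hj; simp [hj]
    · intro j hj; simp [hj]

theorem exists_fieldPow_eq_fieldT : ∃ I : MultiIndex n, hdeg I = 2 ∧ ∀ f, fieldPow I f = fieldT f := by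
  refine ⟨(Sum.elim 0 0, 1), by simp [hdeg], fun f => ?_⟩
  rw [fieldPow_elim, foldr_iterate_zero (fun i => fieldX (Sum.inr i)) 0 _ _ fun _ _ => rfl,
    foldr_iterate_zero (fun i => fieldX (Sum.inl i)) 0 _ _ fun _ _ => rfl]
  rfl

/-- Each second order derivative `X_j X_k` is of the form `X^I`, up to the order of the factors. -/
theorem exists_fieldPow_eq (j k : Fin n ⊕ Fin n) : ∃ I : MultiIndex n, hdeg I = 2 ∧
    ((∀ f, fieldPow I f = fieldX j (fieldX k f)) ∨ ∀ f, fieldPow I f = fieldX k (fieldX j f)) := by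
  rcases j with i | i <;> rcases k with k | k
  · rcases le_total i k with h | h
    · obtain ⟨I, h1, h2⟩ := exists_fieldPow_eq_of_lt_inl h
      exact ⟨I, h1, Or.inl h2⟩
    · obtain ⟨I, h1, h2⟩ := exists_fieldPow_eq_of_lt_inl h
      exact ⟨I, h1, Or.inr h2⟩
  · obtain ⟨I, h1, h2⟩ := exists_fieldPow_eq_inl_inr i k
    exact ⟨I, h1, Or.inl h2⟩
  -- In `X^I` the fields `X_1, …, X_n` stand to the left of `X_{n+1}, …, X_{2n}`, so only the
  -- reversed product is available.
  · obtain ⟨I, h1, h2⟩ := exists_fieldPow_eq_inl_inr k i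
    exact ⟨I, h1, Or.inr h2⟩
  · rcases le_total i k with h | h
    · obtain ⟨I, h1, h2⟩ := exists_fieldPow_eq_of_lt_inr h
      exact ⟨I, h1, Or.inl h2⟩
    · obtain ⟨I, h1, h2⟩ := exists_fieldPow_eq_of_lt_inr h
      exact ⟨I, h1, Or.inr h2⟩

end Heis

end

noncomputable section

namespace Heis

open scoped ContDiff

variable {n : ℕ}

/-! ### Taylor estimates in one and two real variables -/

theorem abs_sub_le_of_hasDerivAt {φ φ' : ℝ → ℝ} {t M : ℝ} (ht : 0 ≤ t)
    (h : ∀ s, HasDerivAt φ (φ' s) s) (hM : ∀ s ∈ Set.Icc 0 t, |φ' s| ≤ M) :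
    |φ t - φ 0| ≤ M * t := by
  have := (convex_Icc (0 : ℝ) t).norm_image_sub_le_of_norm_hasDerivWithin_le
    (f := φ) (f' := φ') (C := M) (fun s _ => (h s).hasDerivWithinAt) hM
    (Set.left_mem_Icc.2 ht) (Set.right_mem_Icc.2 ht)
  simpa [abs_of_nonneg ht] using this

/-- The mean value inequality applied twice, the second time to `φ s - s φ'(0)`; the sharp factor
`1/2` is not needed. -/
theorem abs_taylor_one_le {φ φ' φ'' : ℝ → ℝ} {t M : ℝ} (ht : 0 ≤ t)
    (h : ∀ s, HasDerivAt φ (φ' s) s) (h' : ∀ s, HasDerivAt φ' (φ'' s) s)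
    (hM : ∀ s ∈ Set.Icc 0 t, |φ'' s| ≤ M) : |φ t - φ 0 - t * φ' 0| ≤ M * t ^ 2 := by
  have hM0 : 0 ≤ M := (abs_nonneg _).trans (hM 0 (Set.left_mem_Icc.2 ht))
  have h1 : ∀ s, HasDerivAt (fun s => φ s - s * φ' 0) (φ' s - φ' 0) s := fun s => by
    refine ((h s).sub ((hasDerivAt_id s).mul_const (φ' 0))).congr_deriv ?_
    simp
  have h2 := abs_sub_le_of_hasDerivAt (M := M * t) ht h1 fun s hs => by
    refine (abs_sub_le_of_hasDerivAt hs.1 h' fun r hr => hM r ⟨hr.1, hr.2.trans hs.2⟩).trans ?_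
    exact mul_le_mul_of_nonneg_left hs.2 hM0
  calc |φ t - φ 0 - t * φ' 0| = |φ t - t * φ' 0 - (φ 0 - 0 * φ' 0)| := by congr 1; ring
    _ ≤ M * t * t := h2
    _ = M * t ^ 2 := by ring

theorem abs_taylor_two_le {φ φ' φ'' φ''' : ℝ → ℝ} {t M : ℝ} (ht : 0 ≤ t)
    (h : ∀ s, HasDerivAt φ (φ' s) s) (h' : ∀ s, HasDerivAt φ' (φ'' s) s)
    (h'' : ∀ s, HasDerivAt φ'' (φ''' s) s)
    (hM : ∀ s ∈ Set.Icc 0 t, |φ''' s| ≤ M) :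
    |φ t - φ 0 - t * φ' 0 - t ^ 2 / 2 * φ'' 0| ≤ M * t ^ 3 := by
  have hM0 : 0 ≤ M := (abs_nonneg _).trans (hM 0 (Set.left_mem_Icc.2 ht))
  have h1 : ∀ s, HasDerivAt (fun s => φ s - s * φ' 0 - s ^ 2 / 2 * φ'' 0)
      (φ' s - φ' 0 - s * φ'' 0) s := fun s => by
    have := ((h s).sub ((hasDerivAt_id s).mul_const (φ' 0))).sub
      ((((hasDerivAt_id s).pow 2).div_const 2).mul_const (φ'' 0))
    refine this.congr_deriv ?_
    simp
  have h2 := abs_sub_le_of_hasDerivAt (M := M * t ^ 2) ht h1 fun s hs => by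
    have h3 := abs_taylor_one_le hs.1 h' h'' fun r hr => hM r ⟨hr.1, hr.2.trans hs.2⟩
    refine h3.trans ?_
    have := pow_le_pow_left₀ hs.1 hs.2 2
    exact mul_le_mul_of_nonneg_left this hM0
  calc |φ t - φ 0 - t * φ' 0 - t ^ 2 / 2 * φ'' 0|
      = |φ t - t * φ' 0 - t ^ 2 / 2 * φ'' 0 - (φ 0 - 0 * φ' 0 - 0 ^ 2 / 2 * φ'' 0)| := by
        congr 1; ring
    _ ≤ M * t ^ 2 * t := h2
    _ = M * t ^ 3 := by ring

section Directional

variable {V : Type*} [NormedAddCommGroup V] [NormedSpace ℝ V]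

/-- The derivative in the direction `v`. -/
def dirDeriv (v : V) (F : V → ℝ) (p : V) : ℝ := fderiv ℝ F p v

theorem contDiff_dirDeriv {F : V → ℝ} (hF : ContDiff ℝ ∞ F) (v : V) :
    ContDiff ℝ ∞ (dirDeriv v F) :=
  (hF.fderiv_right (by simp)).clm_apply contDiff_const

theorem dirDeriv_comm {F : V → ℝ} (hF : ContDiff ℝ ∞ F) (v w : V) :
    dirDeriv v (dirDeriv w F) = dirDeriv w (dirDeriv v F) := by
  funext p
  have h1 : DifferentiableAt ℝ (fderiv ℝ F) p :=
    ((hF.fderiv_right (m := ∞) (by simp)).differentiable (by simp)) p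
  have h2 : ∀ a b : V, dirDeriv a (dirDeriv b F) p = fderiv ℝ (fderiv ℝ F) p a b := fun a b => by
    change fderiv ℝ (fun p => fderiv ℝ F p b) p a = _
    rw [fderiv_clm_apply h1 (differentiableAt_const b)]
    simp
  rw [h2, h2]
  refine (hF.contDiffAt.isSymmSndFDerivAt ?_).eq _ _
  simp only [minSmoothness_of_isRCLikeNormedField]
  exact WithTop.coe_le_coe.2 (le_top : (2 : ℕ∞) ≤ ⊤)

theorem hasDerivAt_dirDeriv {F : V → ℝ} (hF : ContDiff ℝ ∞ F) {γ : ℝ → V} {v : V} {s : ℝ}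
    (hγ : HasDerivAt γ v s) : HasDerivAt (fun s => F (γ s)) (dirDeriv v F (γ s)) s :=
  ((hF.differentiable (by simp)) (γ s)).hasFDerivAt.comp_hasDerivAt s hγ

end Directional

section Parametric

variable {P : Type*} [NormedAddCommGroup P] [NormedSpace ℝ P]

/-- The partial derivative in the first real variable. -/
def pdFst (F : P × ℝ × ℝ → ℝ) : P × ℝ × ℝ → ℝ := dirDeriv (0, 1, 0) F

/-- The partial derivative in the second real variable. -/
def pdSnd (F : P × ℝ × ℝ → ℝ) : P × ℝ × ℝ → ℝ := dirDeriv (0, 0, 1) F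

theorem hasDerivAt_pdFst {F : P × ℝ × ℝ → ℝ} (hF : ContDiff ℝ ∞ F) (p : P) (s t : ℝ) :
    HasDerivAt (fun s => F (p, s, t)) (pdFst F (p, s, t)) s :=
  hasDerivAt_dirDeriv hF (γ := fun s => (p, s, t)) (v := (0, 1, 0))
    ((hasDerivAt_const s p).prodMk ((hasDerivAt_id s).prodMk (hasDerivAt_const s t)))

theorem hasDerivAt_pdSnd {F : P × ℝ × ℝ → ℝ} (hF : ContDiff ℝ ∞ F) (p : P) (s t : ℝ) :
    HasDerivAt (fun t => F (p, s, t)) (pdSnd F (p, s, t)) t :=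
  hasDerivAt_dirDeriv hF (γ := fun t => (p, s, t)) (v := (0, 0, 1))
    ((hasDerivAt_const t p).prodMk ((hasDerivAt_const t s).prodMk (hasDerivAt_id t)))

theorem exists_bound_unit_square {F : P × ℝ × ℝ → ℝ} (hF : ContDiff ℝ ∞ F) {S : Set P}
    (hS : IsCompact S) :
    ∃ M, 0 ≤ M ∧ ∀ p ∈ S, ∀ s ∈ Set.Icc (0 : ℝ) 1, ∀ t ∈ Set.Icc (0 : ℝ) 1, |F (p, s, t)| ≤ M := by
  obtain ⟨C, hC⟩ := (hS.prod ((isCompact_Icc (a := (0 : ℝ)) (b := 1)).prod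
    (isCompact_Icc (a := (0 : ℝ)) (b := 1)))).exists_bound_of_continuousOn
    hF.continuous.continuousOn
  exact ⟨max C 0, le_max_right _ _, fun p hp s hs t ht =>
    (hC (p, s, t) ⟨hp, hs, ht⟩).trans (le_max_left _ _)⟩

theorem Icc_subset_unit {t s : ℝ} (ht : t ∈ Set.Icc (0 : ℝ) 1) (hs : s ∈ Set.Icc 0 t) :
    s ∈ Set.Icc (0 : ℝ) 1 := ⟨hs.1, hs.2.trans ht.2⟩

theorem exists_taylor_pdFst {F : P × ℝ × ℝ → ℝ} (hF : ContDiff ℝ ∞ F) {S : Set P}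
    (hS : IsCompact S) : ∃ M, 0 ≤ M ∧ ∀ p ∈ S, ∀ s ∈ Set.Icc (0 : ℝ) 1,
      |F (p, s, 0) - F (p, 0, 0) - s * pdFst F (p, 0, 0)| ≤ M * s ^ 2 := by
  have h1 := contDiff_dirDeriv hF ((0, 1, 0) : P × ℝ × ℝ)
  have h2 := contDiff_dirDeriv h1 ((0, 1, 0) : P × ℝ × ℝ)
  obtain ⟨M, hM0, hM⟩ := exists_bound_unit_square h2 hS
  refine ⟨M, hM0, fun p hp s hs => ?_⟩
  exact abs_taylor_one_le (φ := fun s => F (p, s, 0)) hs.1 (fun s => hasDerivAt_pdFst hF p s 0)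
    (fun s => hasDerivAt_pdFst h1 p s 0)
    fun r hr => hM p hp r (Icc_subset_unit hs hr) 0 ⟨le_rfl, zero_le_one⟩

theorem exists_taylor_pdSnd {F : P × ℝ × ℝ → ℝ} (hF : ContDiff ℝ ∞ F) {S : Set P}
    (hS : IsCompact S) : ∃ M, 0 ≤ M ∧ ∀ p ∈ S, ∀ t ∈ Set.Icc (0 : ℝ) 1,
      |F (p, 0, t) - F (p, 0, 0) - t * pdSnd F (p, 0, 0) - t ^ 2 / 2 * pdSnd (pdSnd F) (p, 0, 0)|
        ≤ M * t ^ 3 := by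
  have h1 := contDiff_dirDeriv hF ((0, 0, 1) : P × ℝ × ℝ)
  have h2 := contDiff_dirDeriv h1 ((0, 0, 1) : P × ℝ × ℝ)
  have h3 := contDiff_dirDeriv h2 ((0, 0, 1) : P × ℝ × ℝ)
  obtain ⟨M, hM0, hM⟩ := exists_bound_unit_square h3 hS
  refine ⟨M, hM0, fun p hp t ht => ?_⟩
  exact abs_taylor_two_le (φ := fun t => F (p, 0, t)) ht.1 (fun t => hasDerivAt_pdSnd hF p 0 t)
    (fun t => hasDerivAt_pdSnd h1 p 0 t) (fun t => hasDerivAt_pdSnd h2 p 0 t)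
    fun r hr => hM p hp 0 ⟨le_rfl, zero_le_one⟩ r (Icc_subset_unit ht hr)

/-- The second `s`-derivative of `g` is itself the first-order Taylor remainder in `t` of `∂_s² F`,
hence `O(t²)`; Taylor's estimate in `s` adds the factor `s²`. The derivative `g₁` is left free so
that it can later be computed by the chain rule on the group. -/
theorem exists_taylor_mixed {F : P × ℝ × ℝ → ℝ} (hF : ContDiff ℝ ∞ F) {S : Set P}
    (hS : IsCompact S) : ∃ M, 0 ≤ M ∧ ∀ p ∈ S, ∀ s ∈ Set.Icc (0 : ℝ) 1, ∀ t ∈ Set.Icc (0 : ℝ) 1,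
      ∀ (g : ℝ → ℝ) (g₁ : ℝ), (∀ s, g s = F (p, s, t) - F (p, s, 0) - t * pdSnd F (p, s, 0)) →
        HasDerivAt g g₁ 0 → |g s - g 0 - s * g₁| ≤ M * (s ^ 2 * t ^ 2) := by
  have h1 := contDiff_dirDeriv hF ((0, 1, 0) : P × ℝ × ℝ)
  have h2 := contDiff_dirDeriv h1 ((0, 1, 0) : P × ℝ × ℝ)
  have h3 := contDiff_dirDeriv h2 ((0, 0, 1) : P × ℝ × ℝ)
  have h4 := contDiff_dirDeriv h3 ((0, 0, 1) : P × ℝ × ℝ)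
  have k1 := contDiff_dirDeriv hF ((0, 0, 1) : P × ℝ × ℝ)
  have k2 := contDiff_dirDeriv k1 ((0, 1, 0) : P × ℝ × ℝ)
  obtain ⟨M, hM0, hM⟩ := exists_bound_unit_square h4 hS
  refine ⟨M, hM0, fun p hp s hs t ht g g₁ hg hg₁ => ?_⟩
  -- Commuting the partial derivatives exhibits the second derivative of `g` as a Taylor remainder
  -- in `t`.
  have e : pdFst (pdFst (pdSnd F)) = pdSnd (pdFst (pdFst F)) := by
    rw [pdFst, pdFst, pdSnd, dirDeriv_comm hF, dirDeriv_comm h1]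
    rfl
  set g' : ℝ → ℝ := fun s => pdFst F (p, s, t) - pdFst F (p, s, 0) - t * pdFst (pdSnd F) (p, s, 0)
  have d1 : ∀ s, HasDerivAt g (g' s) s := fun s => by
    rw [funext hg]
    exact ((hasDerivAt_pdFst hF p s t).sub (hasDerivAt_pdFst hF p s 0)).sub
      ((hasDerivAt_pdFst k1 p s 0).const_mul t)
  have d2 : ∀ s, HasDerivAt g' (pdFst (pdFst F) (p, s, t) - pdFst (pdFst F) (p, s, 0)
      - t * pdSnd (pdFst (pdFst F)) (p, s, 0)) s := fun s => by
    rw [← e]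
    exact ((hasDerivAt_pdFst h1 p s t).sub (hasDerivAt_pdFst h1 p s 0)).sub
      ((hasDerivAt_pdFst k2 p s 0).const_mul t)
  rw [hg₁.unique (d1 0)]
  refine (abs_taylor_one_le (M := M * t ^ 2) hs.1 d1 d2 fun r hr => ?_).trans_eq (by ring)
  exact abs_taylor_one_le (φ := fun t => pdFst (pdFst F) (p, r, t)) ht.1
    (fun t => hasDerivAt_pdSnd h2 p r t) (fun t => hasDerivAt_pdSnd h3 p r t)
    fun r' hr' => hM p hp r (Icc_subset_unit hs hr) r' (Icc_subset_unit ht hr')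

end Parametric

/-! ### Taylor polynomials on the Heisenberg group -/

/-- The first order term `∑ h_j X_j f(u)` of the left Taylor expansion. -/
def taylorOne (f : Heis n → ℝ) (u h : Heis n) : ℝ := ∑ j, h.1 j * fieldX j f u

/-- Twice the second order term of the left Taylor expansion. -/
def taylorTwo (f : Heis n → ℝ) (u h : Heis n) : ℝ :=
  ∑ j, ∑ k, h.1 j * h.1 k * fieldX j (fieldX k f) u + 2 * h.2 * fieldT f u

/-- The horizontal tangent vector at `u` with components `h.1`. -/
def vecH (u h : Heis n) : Heis n := (h.1, dotProduct u.1.ofLp ((matJ n).mulVec h.1.ofLp))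

/-- The curve `t ↦ u · δ_t h` is a parabola, with horizontal velocity at `t = 0` and vertical
acceleration. Its derivatives at `0` produce the left Taylor terms. -/
theorem mul_dil_eq (u h : Heis n) (t : ℝ) :
    u * dil t h = u + t • vecH u h + t ^ 2 • ((0 : EuclideanSpace ℝ (Fin n ⊕ Fin n)), h.2) := by
  refine Prod.ext ?_ ?_
  · simp [mul_def, dil, vecH]
  · simp only [mul_def, dil, vecH, WithLp.ofLp_smul, Matrix.mulVec_smul, dotProduct_smul,
      Prod.snd_add, Prod.smul_snd, smul_eq_mul]
    ring

theorem vecH_eq_sum (u h : Heis n) : vecH u h = ∑ j, h.1 j • vecX j u := by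
  let L : EuclideanSpace ℝ (Fin n ⊕ Fin n) →ₗ[ℝ] Heis n :=
    { toFun := fun x => (x, dotProduct u.1.ofLp ((matJ n).mulVec x.ofLp))
      map_add' := fun x y => by
        refine Prod.ext rfl ?_
        simp [Matrix.mulVec_add, dotProduct_add]
      map_smul' := fun c x => by
        refine Prod.ext rfl ?_
        simp [Matrix.mulVec_smul, dotProduct_smul] }
  have h1 : h.1 = ∑ j, h.1 j • EuclideanSpace.single j (1 : ℝ) := by
    have := (EuclideanSpace.basisFun (Fin n ⊕ Fin n) ℝ).sum_repr h.1
    simpa using this.symm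
  change L h.1 = _
  conv_lhs => rw [h1, map_sum]
  refine Finset.sum_congr rfl fun j _ => ?_
  rw [map_smul]
  rfl

theorem fderiv_vecH (f : Heis n → ℝ) (u h : Heis n) :
    fderiv ℝ f u (vecH u h) = taylorOne f u h := by
  rw [vecH_eq_sum, map_sum, taylorOne]
  refine Finset.sum_congr rfl fun j _ => ?_
  rw [map_smul, fieldX_eq, smul_eq_mul]

/-- The sum of the `X_j X_k` differs from the Hessian by terms antisymmetric in `j, k`, which cancel
against the symmetric coefficients `h_j h_k`. The remaining `2 h_t ∂_t f` comes from the
acceleration of the curve. -/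
theorem fderiv_fderiv_vecH {f : Heis n → ℝ} {u : Heis n} (hf : ContDiffAt ℝ ∞ f u) (h : Heis n) :
    fderiv ℝ (fderiv ℝ f) u (vecH u h) (vecH u h)
      + fderiv ℝ f u ((2 : ℝ) • ((0 : EuclideanSpace ℝ (Fin n ⊕ Fin n)), h.2))
      = taylorTwo f u h := by
  have h1 : ∑ j, ∑ k, h.1 j * h.1 k * dotProduct (EuclideanSpace.single j (1 : ℝ)).ofLp
      ((matJ n).mulVec (EuclideanSpace.single k (1 : ℝ)).ofLp) = 0 := by
    set S := ∑ j, ∑ k, h.1 j * h.1 k * dotProduct (EuclideanSpace.single j (1 : ℝ)).ofLp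
      ((matJ n).mulVec (EuclideanSpace.single k (1 : ℝ)).ofLp)
    have : S = -S := by
      conv_lhs => rw [show S = ∑ j, ∑ k, h.1 j * h.1 k *
        dotProduct (EuclideanSpace.single j (1 : ℝ)).ofLp
        ((matJ n).mulVec (EuclideanSpace.single k (1 : ℝ)).ofLp) from rfl, Finset.sum_comm]
      rw [← Finset.sum_neg_distrib]
      refine Finset.sum_congr rfl fun j _ => ?_
      rw [← Finset.sum_neg_distrib]
      refine Finset.sum_congr rfl fun k _ => ?_
      rw [dot_matJ_swap (EuclideanSpace.single j (1 : ℝ)).ofLp]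
      ring
    linarith
  have h2 : (2 : ℝ) • ((0 : EuclideanSpace ℝ (Fin n ⊕ Fin n)), h.2)
      = (2 * h.2) • ((0 : EuclideanSpace ℝ (Fin n ⊕ Fin n)), (1 : ℝ)) := by
    refine Prod.ext ?_ ?_ <;> simp
  have h3 : ∑ j, ∑ k, h.1 j * h.1 k * fieldX j (fieldX k f) u =
      fderiv ℝ (fderiv ℝ f) u (vecH u h) (vecH u h)
        + (∑ j, ∑ k, h.1 j * h.1 k * dotProduct (EuclideanSpace.single j (1 : ℝ)).ofLp
      ((matJ n).mulVec (EuclideanSpace.single k (1 : ℝ)).ofLp)) * fieldT f u := by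
    have h4 : fderiv ℝ (fderiv ℝ f) u (vecH u h) (vecH u h) = ∑ j, ∑ k, h.1 j * h.1 k *
        fderiv ℝ (fderiv ℝ f) u (vecX j u) (vecX k u) := by
      simp only [vecH_eq_sum, map_sum, sum_apply, map_smul, smul_apply, smul_eq_mul,
        Finset.mul_sum]
      rw [Finset.sum_comm]
      refine Finset.sum_congr rfl fun j _ => Finset.sum_congr rfl fun k _ => ?_
      ring
    rw [h4, Finset.sum_mul, ← Finset.sum_add_distrib]
    refine Finset.sum_congr rfl fun j _ => ?_
    rw [Finset.sum_mul, ← Finset.sum_add_distrib]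
    refine Finset.sum_congr rfl fun k _ => ?_
    rw [fieldX_fieldX_eq hf]
    ring
  rw [taylorTwo, h3, h1, h2, map_smul, smul_eq_mul, fieldT]
  ring

theorem hasDerivAt_mul_dil (u h : Heis n) (t : ℝ) : HasDerivAt (fun t => u * dil t h)
    (vecH u h + (2 * t) • ((0 : EuclideanSpace ℝ (Fin n ⊕ Fin n)), h.2)) t := by
  rw [funext (mul_dil_eq u h)]
  have h1 := ((hasDerivAt_id t).smul_const (vecH u h)).const_add u
  have h2 := ((hasDerivAt_id t).pow 2).smul_const ((0 : EuclideanSpace ℝ (Fin n ⊕ Fin n)), h.2)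
  refine (h1.add h2).congr_deriv ?_
  simp

theorem hasDerivAt_taylorOne {f : Heis n → ℝ} {u : Heis n} (hf : DifferentiableAt ℝ f u)
    (h : Heis n) : HasDerivAt (fun t => f (u * dil t h)) (taylorOne f u h) 0 := by
  have h0 : u * dil 0 h = u := by rw [dil_zero, ← one_eq_zero, mul_one]
  have hf' : HasFDerivAt f (fderiv ℝ f u) (u * dil 0 h) := by rw [h0]; exact hf.hasFDerivAt
  have := hf'.comp_hasDerivAt (f := fun t => u * dil t h) 0 (hasDerivAt_mul_dil u h 0)
  refine this.congr_deriv ?_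
  simp [fderiv_vecH]

/-- Here `φ` is any function known to be the first derivative, which makes the result applicable to
iterated partial derivatives by uniqueness. -/
theorem hasDerivAt_taylorTwo {f : Heis n → ℝ} (hf : ContDiff ℝ ∞ f) (u h : Heis n) {φ : ℝ → ℝ}
    (hφ : ∀ t, HasDerivAt (fun t => f (u * dil t h)) (φ t) t) :
    HasDerivAt φ (taylorTwo f u h) 0 := by
  have h0 : u * dil 0 h = u := by rw [dil_zero, ← one_eq_zero, mul_one]
  have e : φ = fun t => fderiv ℝ f (u * dil t h)
      (vecH u h + (2 * t) • ((0 : EuclideanSpace ℝ (Fin n ⊕ Fin n)), h.2)) := by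
    funext t
    exact (hφ t).unique (((hf.differentiable (by simp)) _).hasFDerivAt.comp_hasDerivAt
      (f := fun t => u * dil t h) t (hasDerivAt_mul_dil u h t))
  have h1 : HasFDerivAt (fderiv ℝ f) (fderiv ℝ (fderiv ℝ f) u) (u * dil 0 h) := by
    rw [h0]
    exact (((hf.fderiv_right (m := ∞) (by simp)).differentiable (by simp)) u).hasFDerivAt
  have h2 := h1.comp_hasDerivAt (f := fun t => u * dil t h) 0 (hasDerivAt_mul_dil u h 0)
  have h3 : HasDerivAt (fun t : ℝ => vecH u h
      + (2 * t) • ((0 : EuclideanSpace ℝ (Fin n ⊕ Fin n)), h.2))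
      ((2 : ℝ) • ((0 : EuclideanSpace ℝ (Fin n ⊕ Fin n)), h.2)) 0 := by
    have := (((hasDerivAt_id (0 : ℝ)).const_mul 2).smul_const
      ((0 : EuclideanSpace ℝ (Fin n ⊕ Fin n)), h.2)).const_add (vecH u h)
    simpa only [mul_one, id] using this
  rw [e]
  refine (h2.clm_apply h3).congr_deriv ?_
  rw [← fderiv_fderiv_vecH hf.contDiffAt]
  simp [h0]

/-- Only the horizontal part of `w` enters, since the vertical part of `δ_s w` is of order `s²`.
This is why moments of homogeneous degree one suffice for an error of order two. -/
theorem hasDerivAt_comp_dil {G : Heis n → ℝ} (hG : DifferentiableAt ℝ G 0) (w : Heis n) :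
    HasDerivAt (fun s => G (dil s w)) (fderiv ℝ G 0 (w.1, 0)) 0 := by
  have h := hasDerivAt_mul_dil (0 : Heis n) w 0
  have e : (fun t => (0 : Heis n) * dil t w) = fun t => dil t w := by
    funext t
    rw [← one_eq_zero, one_mul]
  rw [e] at h
  have hG' : HasFDerivAt G (fderiv ℝ G 0) (dil 0 w) := by rw [dil_zero]; exact hG.hasFDerivAt
  refine (hG'.comp_hasDerivAt (f := fun s => dil s w) 0 h).congr_deriv ?_
  simp [vecH]

end Heis

end

noncomputable section

namespace Heis

open scoped ContDiff

variable {n : ℕ}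

/-! ### Taylor estimates for homogeneous functions -/

/-- Cutting off the singularity gives a globally smooth function, so that the Taylor lemmas need no
domain conditions. -/
theorem IsHomog.exists_contDiff_eq {d : ℕ} {f : Heis n → ℝ} (hf : IsHomog d f) :
    ∃ g : Heis n → ℝ, ContDiff ℝ ∞ g ∧ ∀ z, 1 / 4 ≤ rho z → g z = f z := by
  -- At `ρ = 1/4` the argument is `512/256 - 1 = 1`, where the transition function has reached the
  -- value one; near the origin the argument is negative and the cutoff vanishes.
  refine ⟨fun z => Real.smoothTransition (512 * rho z ^ 4 - 1) * f z, ?_, ?_⟩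
  · have hs : ContDiff ℝ ∞ fun z : Heis n => Real.smoothTransition (512 * rho z ^ 4 - 1) := by
      refine Real.smoothTransition.contDiff.comp ?_
      have e : (fun z : Heis n => 512 * rho z ^ 4 - 1) =
          fun z : Heis n => 512 * ((‖z.1‖ ^ 2) ^ 2 + z.2 ^ 2) - 1 := by
        funext z
        rw [rho_pow_four, ← pow_mul]
      rw [e]
      exact (contDiff_const.mul (((contDiff_fst.norm_sq ℝ).pow 2).add (contDiff_snd.pow 2))).sub
        contDiff_const
    rw [contDiff_iff_contDiffAt]
    intro z
    by_cases hz : z = 0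
    · have h0 : ∀ᶠ y in nhds z, 512 * rho y ^ 4 - 1 < 0 := by
        refine ((continuous_const.mul (continuous_rho.pow 4)).sub continuous_const).continuousAt.eventually_lt
          continuousAt_const ?_
        rw [hz]
        simp [(rho_eq_zero_iff (0 : Heis n)).2 rfl]
      refine (contDiffAt_const (c := (0 : ℝ))).congr_of_eventuallyEq ?_
      filter_upwards [h0] with y hy
      rw [Real.smoothTransition.zero_of_nonpos hy.le, zero_mul]
    · exact hs.contDiffAt.mul (hf.contDiffAt hz)
  · intro z hz
    have h1 : (1 / 4 : ℝ) ^ 4 ≤ rho z ^ 4 := pow_le_pow_left₀ (by norm_num) hz 4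
    beta_reduce
    rw [Real.smoothTransition.one_of_one_le (by norm_num at h1; linarith), one_mul]

theorem eventuallyEq_of_lt_rho {f g : Heis n → ℝ} (h : ∀ z, 1 / 4 ≤ rho z → g z = f z) {u : Heis n}
    (hu : 1 / 4 < rho u) : g =ᶠ[nhds u] f := by
  filter_upwards [continuous_rho.continuousAt.eventually_const_lt hu] with z hz
  exact h z hz.le

theorem fieldX_congr {f g : Heis n → ℝ} {u : Heis n} (h : g =ᶠ[nhds u] f) (j : Fin n ⊕ Fin n) :
    fieldX j g =ᶠ[nhds u] fieldX j f := by
  filter_upwards [h.fderiv (𝕜 := ℝ)] with z hz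
  rw [fieldX_eq, fieldX_eq, hz]

theorem taylorOne_congr {f g : Heis n → ℝ} {u : Heis n} (h : g =ᶠ[nhds u] f) (v : Heis n) :
    taylorOne g u v = taylorOne f u v := by
  rw [taylorOne, taylorOne]
  exact Finset.sum_congr rfl fun j _ => by rw [(fieldX_congr h j).self_of_nhds]

theorem taylorTwo_congr {f g : Heis n → ℝ} {u : Heis n} (h : g =ᶠ[nhds u] f) (v : Heis n) :
    taylorTwo g u v = taylorTwo f u v := by
  rw [taylorTwo, taylorTwo, fieldT, fieldT, (h.fderiv (𝕜 := ℝ)).self_of_nhds]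
  congr 1
  refine Finset.sum_congr rfl fun j _ => Finset.sum_congr rfl fun k _ => ?_
  rw [(fieldX_congr (fieldX_congr h k) j).self_of_nhds]

/-- Together with `IsHomog.taylorTwo_dil`, this reduces a Taylor expansion at `u` with increment `h`
to the unit sphere with the parameter `ρ(h)/ρ(u)`. -/
theorem IsHomog.taylorOne_dil {d : ℕ} {f : Heis n → ℝ} (hf : IsHomog d f) {l : ℝ} (hl : 0 < l)
    {u : Heis n} (hu : u ≠ 0) (m : ℝ) (h : Heis n) :
    taylorOne f (dil l u) (dil m h) = (l ^ d)⁻¹ * (m / l * taylorOne f u h) := by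
  simp only [taylorOne, Finset.mul_sum]
  refine Finset.sum_congr rfl fun j _ => ?_
  rw [(hf.fieldX j).map_dil l hl u hu, dil]
  simp only [PiLp.smul_apply, smul_eq_mul]
  field_simp
  ring

theorem IsHomog.taylorTwo_dil {d : ℕ} {f : Heis n → ℝ} (hf : IsHomog d f) {l : ℝ} (hl : 0 < l)
    {u : Heis n} (hu : u ≠ 0) (m : ℝ) (h : Heis n) :
    taylorTwo f (dil l u) (dil m h) = (l ^ d)⁻¹ * ((m / l) ^ 2 * taylorTwo f u h) := by
  simp only [taylorTwo, mul_add, Finset.mul_sum]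
  congr 1
  · refine Finset.sum_congr rfl fun j _ => Finset.sum_congr rfl fun k _ => ?_
    rw [((hf.fieldX k).fieldX j).map_dil l hl u hu, dil]
    simp only [PiLp.smul_apply, smul_eq_mul]
    field_simp
    ring
  · rw [hf.fieldT.map_dil l hl u hu, dil]
    field_simp
    ring

/-- The function `(w, u, h, s, t) ↦ g((δ_s w)⁻¹ · u · δ_t h)`. -/
def bidil (g : Heis n → ℝ) (p : (Heis n × Heis n × Heis n) × ℝ × ℝ) : ℝ :=
  g ((dil p.2.1 p.1.1)⁻¹ * p.1.2.1 * dil p.2.2 p.1.2.2)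

theorem contDiff_dil : ContDiff ℝ ∞ fun p : ℝ × Heis n => dil p.1 p.2 := by
  unfold dil
  fun_prop

theorem contDiff_bidil {g : Heis n → ℝ} (hg : ContDiff ℝ ∞ g) : ContDiff ℝ ∞ (bidil g) := by
  have hm : ContDiff ℝ ∞ (fun p : Heis n × Heis n => p.1 * p.2) := contDiff_mul.of_le le_top
  have hi : ContDiff ℝ ∞ (fun p : Heis n => p⁻¹) := contDiff_inv.of_le le_top
  have h1 : ContDiff ℝ ∞ fun p : (Heis n × Heis n × Heis n) × ℝ × ℝ => (dil p.2.1 p.1.1)⁻¹ :=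
    hi.comp (contDiff_dil.comp (f := fun p : (Heis n × Heis n × Heis n) × ℝ × ℝ =>
      (p.2.1, p.1.1)) (by fun_prop))
  have h2 : ContDiff ℝ ∞ fun p : (Heis n × Heis n × Heis n) × ℝ × ℝ => dil p.2.2 p.1.2.2 :=
    contDiff_dil.comp (f := fun p : (Heis n × Heis n × Heis n) × ℝ × ℝ =>
      (p.2.2, p.1.2.2)) (by fun_prop)
  have h3 : ContDiff ℝ ∞ fun p : (Heis n × Heis n × Heis n) × ℝ × ℝ =>
      (dil p.2.1 p.1.1)⁻¹ * p.1.2.1 := hm.comp (h1.prodMk (by fun_prop))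
  exact hg.comp (hm.comp (h3.prodMk h2))

theorem contDiff_fieldX {g : Heis n → ℝ} (hg : ContDiff ℝ ∞ g) (j : Fin n ⊕ Fin n) :
    ContDiff ℝ ∞ (fieldX j g) := by
  rw [show fieldX j g = fun z => fderiv ℝ g z (vecX j z) from funext (fieldX_eq j g)]
  exact (hg.fderiv_right (by simp)).clm_apply (contDiff_vecX j)

/-- Partial derivatives in the dilation parameter are the left Taylor terms on the group; this links
real calculus to the fields `X_j`. -/
theorem pdSnd_bidil {g : Heis n → ℝ} (hg : ContDiff ℝ ∞ g) (w u h : Heis n) (s : ℝ) :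
    pdSnd (bidil g) ((w, u, h), s, 0) = taylorOne g ((dil s w)⁻¹ * u) h :=
  (hasDerivAt_pdSnd (contDiff_bidil hg) (w, u, h) s 0).unique
    (hasDerivAt_taylorOne (u := (dil s w)⁻¹ * u) (hg.differentiable (by simp) _) h)

theorem pdSnd_pdSnd_bidil {g : Heis n → ℝ} (hg : ContDiff ℝ ∞ g) (u h : Heis n) :
    pdSnd (pdSnd (bidil g)) ((0, u, h), 0, 0) = taylorTwo g u h := by
  have h1 := contDiff_dirDeriv (contDiff_bidil hg) ((0, 0, 1) : (Heis n × Heis n × Heis n) × ℝ × ℝ)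
  refine (hasDerivAt_pdSnd h1 (0, u, h) 0 0).unique ?_
  refine hasDerivAt_taylorTwo hg u h fun t => ?_
  have h2 := hasDerivAt_pdSnd (contDiff_bidil hg) (0, u, h) 0 t
  simp only [bidil, dil_zero, ← one_eq_zero, inv_one, one_mul] at h2
  exact h2

/-- The parameters over which the normalized Taylor estimates are uniform. -/
def normParams (n : ℕ) : Set (Heis n × Heis n × Heis n) :=
  {w | rho w ≤ 1} ×ˢ {u | rho u = 1} ×ˢ {h | rho h ≤ 1}

theorem isCompact_normParams : IsCompact (normParams n) :=
  (isCompact_rho_le 1).prod ((isCompact_rho_eq 1).prod (isCompact_rho_le 1))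

/-- Each dilated perturbation costs at most `1/4` of the unit norm of `u`, so the point stays where
the cutoff function agrees with `f`. -/
theorem half_le_rho {w u h : Heis n} (hw : rho w ≤ 1) (hu : rho u = 1) (hh : rho h ≤ 1) {s t : ℝ}
    (hs : s ∈ Set.Icc (0 : ℝ) (1 / 4)) (ht : t ∈ Set.Icc (0 : ℝ) (1 / 4)) :
    1 / 2 ≤ rho ((dil s w)⁻¹ * u * dil t h) := by
  have h1 := le_rho_mul ((dil s w)⁻¹ * u) (dil t h)
  have h2 := le_rho_mul' (dil s w)⁻¹ u
  rw [rho_inv, rho_dil hs.1] at h2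
  rw [rho_dil ht.1] at h1
  have h3 := mul_le_mul hs.2 hw (rho_nonneg w) (by norm_num)
  have h4 := mul_le_mul ht.2 hh (rho_nonneg h) (by norm_num)
  linarith

theorem ne_zero_of_rho_pos {z : Heis n} (h : 0 < rho z) : z ≠ 0 := by
  rintro rfl
  exact h.ne' ((rho_eq_zero_iff _).2 rfl)

theorem unit_of_quarter {s : ℝ} (hs : s ∈ Set.Icc (0 : ℝ) (1 / 4)) : s ∈ Set.Icc (0 : ℝ) 1 :=
  ⟨hs.1, hs.2.trans (by norm_num)⟩

theorem div_mem_quarter {a l : ℝ} (ha : 0 ≤ a) (hl : 0 < l) (h : a ≤ l / 4) :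
    a / l ∈ Set.Icc (0 : ℝ) (1 / 4) := by
  refine ⟨by positivity, ?_⟩
  rw [div_le_iff₀ hl]
  linarith

theorem zero_mem_quarter : (0 : ℝ) ∈ Set.Icc (0 : ℝ) (1 / 4) := by constructor <;> norm_num

theorem rho_zero_le : rho (0 : Heis n) ≤ 1 := by
  rw [(rho_eq_zero_iff _).2 rfl]
  exact zero_le_one

/-- The left Taylor expansion of second order of a homogeneous function. -/
theorem IsHomog.exists_taylorTwo {d : ℕ} {f : Heis n → ℝ} (hf : IsHomog d f) :
    ∃ C, 0 ≤ C ∧ ∀ u : Heis n, u ≠ 0 → ∀ h : Heis n, rho h ≤ rho u / 4 →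
      |f (u * h) - f u - taylorOne f u h - taylorTwo f u h / 2|
        ≤ C * rho h ^ 3 * (rho u ^ (d + 3))⁻¹ := by
  obtain ⟨g, hg, hgf⟩ := hf.exists_contDiff_eq
  obtain ⟨M, hM0, hM⟩ := exists_taylor_pdSnd (contDiff_bidil hg) (isCompact_normParams (n := n))
  refine ⟨M, hM0, fun u hu h hh => ?_⟩
  have hl := rho_pos hu
  obtain ⟨u', hu'1, hu'⟩ := exists_eq_dil_rho hu
  obtain ⟨h', hh'1, hh'⟩ := exists_eq_dil (le_refl (rho h))
  set l := rho u with hldef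
  set t := rho h / l with ht
  have htq : t ∈ Set.Icc (0 : ℝ) (1 / 4) := div_mem_quarter (rho_nonneg h) hl hh
  have key := hM (0, u', h') ⟨rho_zero_le, hu'1, hh'1⟩ t (unit_of_quarter htq)
  have hu'0 : u' ≠ 0 := ne_zero_of_rho_pos (by rw [hu'1]; norm_num)
  have hr := half_le_rho (w := 0) rho_zero_le hu'1 hh'1 zero_mem_quarter htq
  have heq : g =ᶠ[nhds u'] f := eventuallyEq_of_lt_rho hgf (by rw [hu'1]; norm_num)
  rw [pdSnd_bidil hg, pdSnd_pdSnd_bidil hg] at key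
  simp only [bidil, dil_zero, ← one_eq_zero, inv_one, one_mul, mul_one] at key hr
  rw [hgf _ (by linarith), heq.self_of_nhds, taylorOne_congr heq, taylorTwo_congr heq] at key
  have e1 : u * h = dil l (u' * dil t h') := by
    rw [dil_mul, dil_dil, hu', ht, mul_div_cancel₀ _ hl.ne', hh']
  have e2 : taylorOne f u h = (l ^ d)⁻¹ * (t * taylorOne f u' h') := by
    rw [← hf.taylorOne_dil hl hu'0, hu', hh']
  have e3 : taylorTwo f u h = (l ^ d)⁻¹ * (t ^ 2 * taylorTwo f u' h') := by
    rw [← hf.taylorTwo_dil hl hu'0, hu', hh']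
  have e4 : f u = (l ^ d)⁻¹ * f u' := by
    rw [← hf.map_dil l hl u' hu'0, hu']
  rw [e1, hf.map_dil l hl _ (ne_zero_of_rho_pos (by linarith)), e2, e3, e4]
  calc |(l ^ d)⁻¹ * f (u' * dil t h') - (l ^ d)⁻¹ * f u' - (l ^ d)⁻¹ * (t * taylorOne f u' h')
        - (l ^ d)⁻¹ * (t ^ 2 * taylorTwo f u' h') / 2|
      = |(l ^ d)⁻¹| * |f (u' * dil t h') - f u' - t * taylorOne f u' h'
        - t ^ 2 / 2 * taylorTwo f u' h'| := by
        rw [← abs_mul]; congr 1; ring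
    _ ≤ |(l ^ d)⁻¹| * (M * t ^ 3) := by gcongr
    _ = M * rho h ^ 3 * (l ^ (d + 3))⁻¹ := by
        rw [abs_of_pos (by positivity), ht]
        field_simp
        ring

/-! ### Expansion in the source variable, alone and jointly with the increment -/

/-- Near the origin `G` agrees, up to `m ρ²`, with an affine function of the horizontal variables. -/
def AffineApprox (G : Heis n → ℝ) (r m : ℝ) : Prop :=
  ∃ (c : ℝ) (L : EuclideanSpace ℝ (Fin n ⊕ Fin n) →L[ℝ] ℝ), ∀ w : Heis n, rho w ≤ r →
    |G w - (c + L w.1)| ≤ m * rho w ^ 2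

/-- Passage from normalized estimates to `AffineApprox`. -/
theorem affineApprox_of_scaled {G Γ : Heis n → ℝ} {l κ m : ℝ} (hl : 0 < l)
    (hG : ∀ w s, rho w ≤ 1 → s ∈ Set.Icc (0 : ℝ) (1 / 4) → G (dil (l * s) w) = κ * Γ (dil s w))
    (hΓ : ∀ w s, rho w ≤ 1 → s ∈ Set.Icc (0 : ℝ) (1 / 4) →
      |Γ (dil s w) - Γ 0 - s * fderiv ℝ Γ 0 (w.1, 0)| ≤ m * s ^ 2) :
    AffineApprox G (l / 4) (|κ| * m * (l ^ 2)⁻¹) := by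
  refine ⟨κ * Γ 0, (κ * l⁻¹) • (fderiv ℝ Γ 0).comp (ContinuousLinearMap.inl ℝ _ _),
    fun w hw => ?_⟩
  obtain ⟨w', hw'1, hw'⟩ := exists_eq_dil (le_refl (rho w))
  set s := rho w / l with hs
  have hsq : s ∈ Set.Icc (0 : ℝ) (1 / 4) := div_mem_quarter (rho_nonneg w) hl hw
  have hls : l * s = rho w := mul_div_cancel₀ _ hl.ne'
  have e1 : G w = κ * Γ (dil s w') := by
    rw [← hG w' s hw'1 hsq, hls, hw']
  have e2 : w.1 = (l * s) • w'.1 := by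
    rw [hls]; exact congrArg Prod.fst hw'.symm
  have e3 : ((κ * l⁻¹) • (fderiv ℝ Γ 0).comp (ContinuousLinearMap.inl ℝ _ _)) w.1
      = κ * (s * fderiv ℝ Γ 0 (w'.1, 0)) := by
    rw [e2, map_smul]
    simp only [smul_apply, ContinuousLinearMap.comp_apply, ContinuousLinearMap.inl_apply,
      smul_eq_mul]
    field_simp
  rw [e1, e3]
  calc |κ * Γ (dil s w') - (κ * Γ 0 + κ * (s * fderiv ℝ Γ 0 (w'.1, 0)))|
      = |κ| * |Γ (dil s w') - Γ 0 - s * fderiv ℝ Γ 0 (w'.1, 0)| := by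
        rw [← abs_mul]; congr 1; ring
    _ ≤ |κ| * (m * s ^ 2) := by gcongr; exact hΓ w' s hw'1 hsq
    _ = |κ| * m * (l ^ 2)⁻¹ * rho w ^ 2 := by
        rw [hs]; field_simp

/-- First-order expansion in the source point `w`. Against a function with vanishing moments of
degree at most one, it gains the factor `(ρ(w)/ρ(u))²`. -/
theorem IsHomog.exists_affineApprox {d : ℕ} {f : Heis n → ℝ} (hf : IsHomog d f) :
    ∃ C, 0 ≤ C ∧ ∀ u : Heis n, u ≠ 0 →
      AffineApprox (fun w => f (w⁻¹ * u)) (rho u / 4) (C * (rho u ^ (d + 2))⁻¹) := by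
  obtain ⟨g, hg, hgf⟩ := hf.exists_contDiff_eq
  obtain ⟨M, hM0, hM⟩ := exists_taylor_pdFst (contDiff_bidil hg) (isCompact_normParams (n := n))
  refine ⟨M, hM0, fun u hu => ?_⟩
  have hl := rho_pos hu
  obtain ⟨u', hu'1, hu'⟩ := exists_eq_dil_rho hu
  set l := rho u with hldef
  have e : M * (l ^ (d + 2))⁻¹ = |(l ^ d)⁻¹| * M * (l ^ 2)⁻¹ := by
    rw [abs_of_pos (by positivity), pow_add, mul_inv]; ring
  rw [e]
  have hΓd : ContDiff ℝ ∞ fun w : Heis n => g (w⁻¹ * u') :=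
    hg.comp ((contDiff_mul.of_le le_top).comp ((contDiff_inv.of_le le_top).prodMk contDiff_const))
  refine affineApprox_of_scaled (Γ := fun w => g (w⁻¹ * u')) hl ?_ ?_
  · intro w s hw hs
    have hr := half_le_rho hw hu'1 rho_zero_le hs zero_mem_quarter
    rw [dil_zero, ← one_eq_zero, mul_one] at hr
    rw [hgf _ (by linarith), ← hf.map_dil l hl _ (ne_zero_of_rho_pos (by linarith)), dil_mul,
      dil_inv, dil_dil, hu']
  · intro w s hw hs
    have key := hM (w, u', 0) ⟨hw, hu'1, rho_zero_le⟩ s (unit_of_quarter hs)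
    have h1 : pdFst (bidil g) ((w, u', 0), 0, 0) =
        fderiv ℝ (fun w => g (w⁻¹ * u')) 0 (w.1, 0) := by
      have h2 := hasDerivAt_pdFst (contDiff_bidil hg) (w, u', 0) 0 0
      simp only [bidil, dil_zero, ← one_eq_zero, mul_one] at h2
      exact h2.unique (hasDerivAt_comp_dil ((hΓd.differentiable (by simp)) 0) w)
    rw [h1] at key
    simp only [bidil, dil_zero, ← one_eq_zero, mul_one] at key
    exact key

/-- The first-order Taylor remainder in `h` is in turn expanded in `w`, so the gains `(ρ(h)/ρ(u))²`
and `(ρ(w)/ρ(u))²` multiply. -/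
theorem IsHomog.exists_affineApprox_mixed {d : ℕ} {f : Heis n → ℝ} (hf : IsHomog d f) :
    ∃ C, 0 ≤ C ∧ ∀ u : Heis n, u ≠ 0 → ∀ h : Heis n, rho h ≤ rho u / 4 →
      AffineApprox (fun w => f (w⁻¹ * u * h) - f (w⁻¹ * u) - taylorOne f (w⁻¹ * u) h) (rho u / 4)
        (C * rho h ^ 2 * (rho u ^ (d + 4))⁻¹) := by
  obtain ⟨g, hg, hgf⟩ := hf.exists_contDiff_eq
  obtain ⟨M, hM0, hM⟩ := exists_taylor_mixed (contDiff_bidil hg) (isCompact_normParams (n := n))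
  refine ⟨M, hM0, fun u hu h hh => ?_⟩
  have hl := rho_pos hu
  obtain ⟨u', hu'1, hu'⟩ := exists_eq_dil_rho hu
  obtain ⟨h', hh'1, hh'⟩ := exists_eq_dil (le_refl (rho h))
  set l := rho u with hldef
  set t := rho h / l with ht
  have htq : t ∈ Set.Icc (0 : ℝ) (1 / 4) := div_mem_quarter (rho_nonneg h) hl hh
  have e : M * rho h ^ 2 * (l ^ (d + 4))⁻¹ = |(l ^ d)⁻¹| * (M * t ^ 2) * (l ^ 2)⁻¹ := by
    rw [abs_of_pos (by positivity), ht]; field_simp; ring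
  rw [e]
  have hm : ContDiff ℝ ∞ (fun p : Heis n × Heis n => p.1 * p.2) := contDiff_mul.of_le le_top
  have hΓ1 : ContDiff ℝ ∞ fun w : Heis n => w⁻¹ * u' :=
    hm.comp ((contDiff_inv.of_le le_top).prodMk contDiff_const)
  have hΓd : ContDiff ℝ ∞ fun w : Heis n => g (w⁻¹ * u' * dil t h') - g (w⁻¹ * u')
      - t * taylorOne g (w⁻¹ * u') h' := by
    refine ((hg.comp (hm.comp (hΓ1.prodMk contDiff_const))).sub (hg.comp hΓ1)).sub
      (contDiff_const.mul ?_)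
    unfold taylorOne
    exact ContDiff.sum fun j _ => contDiff_const.mul ((contDiff_fieldX hg j).comp hΓ1)
  refine affineApprox_of_scaled (Γ := fun w => g (w⁻¹ * u' * dil t h') - g (w⁻¹ * u')
      - t * taylorOne g (w⁻¹ * u') h') hl ?_ ?_
  · intro w s hw hs
    have hr := half_le_rho hw hu'1 hh'1 hs htq
    have hr0 := half_le_rho hw hu'1 hh'1 hs zero_mem_quarter
    rw [dil_zero, ← one_eq_zero, mul_one] at hr0
    have heq : g =ᶠ[nhds ((dil s w)⁻¹ * u')] f := eventuallyEq_of_lt_rho hgf (by linarith)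
    have e0 : (dil (l * s) w)⁻¹ * u = dil l ((dil s w)⁻¹ * u') := by
      rw [dil_mul, dil_inv, dil_dil, hu']
    have e1 : (dil (l * s) w)⁻¹ * u * h = dil l ((dil s w)⁻¹ * u' * dil t h') := by
      rw [dil_mul, ← e0, dil_dil, ht, mul_div_cancel₀ _ hl.ne', hh']
    have e2 : taylorOne f ((dil (l * s) w)⁻¹ * u) h =
        (l ^ d)⁻¹ * (t * taylorOne f ((dil s w)⁻¹ * u') h') := by
      rw [← hf.taylorOne_dil hl (ne_zero_of_rho_pos (by linarith)), ← e0, hh']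
    rw [e1, e2, e0, hf.map_dil l hl _ (ne_zero_of_rho_pos (by linarith)),
      hf.map_dil l hl _ (ne_zero_of_rho_pos (by linarith)), hgf _ (by linarith),
      heq.self_of_nhds, taylorOne_congr heq]
    ring
  · intro w s hw hs
    have key := hM (w, u', h') ⟨hw, hu'1, hh'1⟩ s (unit_of_quarter hs) t (unit_of_quarter htq)
      (fun s => g ((dil s w)⁻¹ * u' * dil t h') - g ((dil s w)⁻¹ * u')
        - t * taylorOne g ((dil s w)⁻¹ * u') h') _ (fun s => by
          rw [pdSnd_bidil hg]
          simp only [bidil, dil_zero, ← one_eq_zero, mul_one])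
      (hasDerivAt_comp_dil ((hΓd.differentiable (by simp)) 0) w)
    rw [dil_zero] at key
    exact key.trans_eq (by ring)

end Heis

end

noncomputable section

namespace Heis

variable {n : ℕ}

/-! ### Integrals against homogeneous kernels -/

theorem rpow_homDim {r : ℝ} (_ : 0 < r) : r ^ homDim n = r ^ (2 * n + 2) := by
  rw [homDim, ← Real.rpow_natCast]
  push_cast
  rfl

theorem homDim_pos : 0 < homDim n := by unfold homDim; positivity

theorem volume_rball_rpow (z : Heis n) {r : ℝ} (hr : 0 < r) :
    volume (rball z r) = ENNReal.ofReal (r ^ homDim n) * volume (rball (1 : Heis n) 1) := by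
  rw [volume_rball z hr, rpow_homDim hr]

theorem volume_rball_pos (z : Heis n) {r : ℝ} (hr : 0 < r) : 0 < volume (rball z r) := by
  rw [volume_rball z hr]
  exact ENNReal.mul_pos (by simp; positivity) volume_rball_one_pos.ne'

theorem volume_rball_ne_top (z : Heis n) {r : ℝ} (hr : 0 < r) : volume (rball z r) ≠ ∞ := by
  rw [volume_rball z hr]
  exact ENNReal.mul_ne_top ENNReal.ofReal_ne_top volume_rball_one_lt_top.ne

theorem mem_rball_self (z : Heis n) {r : ℝ} (hr : 0 < r) : z ∈ rball z r := by
  rw [mem_rball, inv_mul_cancel, one_eq_zero, (rho_eq_zero_iff _).2 rfl]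
  exact hr

theorem lintegral_rball_le_maximalFn (a : Heis n → ℂ) (z : Heis n) {c : Heis n} {r : ℝ}
    (hr : 0 < r) (hz : z ∈ rball c r) :
    ∫⁻ w in rball c r, ‖a w‖ₑ ≤ volume (rball c r) * maximalFn a z := by
  have h : (volume (rball c r))⁻¹ * ∫⁻ w in rball c r, ‖a w‖ₑ ≤ maximalFn a z :=
    le_iSup_of_le c (le_iSup_of_le r (le_iSup_of_le hr (le_iSup_of_le hz le_rfl)))
  calc ∫⁻ w in rball c r, ‖a w‖ₑ
      = volume (rball c r) * ((volume (rball c r))⁻¹ * ∫⁻ w in rball c r, ‖a w‖ₑ) := by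
        rw [← mul_assoc, ENNReal.mul_inv_cancel (volume_rball_pos c hr).ne'
          (volume_rball_ne_top c hr), one_mul]
    _ ≤ _ := by gcongr

theorem measurable_rho_inv_mul (z : Heis n) : Measurable fun w : Heis n => rho (w⁻¹ * z) :=
  measurable_rho.comp (by fun_prop)

theorem rball_eq_setOf (z : Heis n) (r : ℝ) : rball z r = {w | rho (w⁻¹ * z) < r} := by
  ext w
  rw [mem_rball, rho_inv_mul_comm]
  rfl

/-- The measure `|a| dw` has growth exponent `Q` around `z` with constant proportional to `Ma(z)`.
This turns the shell estimates into bounds by the maximal function. -/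
theorem withDensity_growth {a : Heis n → ℂ} (z : Heis n) {r : ℝ} (hr : 0 < r) :
    (volume.withDensity fun w => ‖a w‖ₑ) {w | rho (w⁻¹ * z) < r} ≤
      (volume (rball (1 : Heis n) 1) * maximalFn a z) * ENNReal.ofReal (r ^ homDim n) := by
  rw [← rball_eq_setOf, withDensity_apply _ (measurableSet_rball z r)]
  refine (lintegral_rball_le_maximalFn a z hr (mem_rball_self z hr)).trans_eq ?_
  rw [volume_rball_rpow z hr]
  ring

theorem exists_lintegral_near_le {s : ℝ} (hs : 0 < s) (hsQ : s < homDim n) : ∃ C : ℝ≥0,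
    ∀ (a : Heis n → ℂ), AEStronglyMeasurable a volume → ∀ (z : Heis n) (R : ℝ), 0 < R →
      ∫⁻ w in {w | rho (w⁻¹ * z) < R}, ‖a w‖ₑ * ENNReal.ofReal (rho (w⁻¹ * z) ^ (-s)) ≤
        C * ENNReal.ofReal (R ^ (homDim n - s)) * maximalFn a z := by
  obtain ⟨C, hC⟩ := exists_lintegral_rpow_near_le hsQ hs
  refine ⟨C * (volume (rball (1 : Heis n) 1)).toNNReal, fun a ha z R hR => ?_⟩
  have h := hC (fun w : Heis n => rho (w⁻¹ * z)) (measurable_rho_inv_mul z)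
    (fun w => rho_nonneg _) (volume.withDensity fun w => ‖a w‖ₑ) _
    (fun r hr => withDensity_growth z hr) R hR
  have hS : MeasurableSet {w : Heis n | rho (w⁻¹ * z) < R} :=
    measurableSet_lt (measurable_rho_inv_mul z) measurable_const
  rw [restrict_withDensity hS, lintegral_withDensity_eq_lintegral_mul₀ ha.enorm.restrict
    ((measurable_rho_inv_mul z).pow_const _).ennreal_ofReal.aemeasurable] at h
  refine h.trans_eq ?_
  rw [ENNReal.coe_mul, ENNReal.coe_toNNReal volume_rball_one_lt_top.ne]
  ring

theorem exists_lintegral_far_le {s : ℝ} (hs : 0 < s) (hsQ : homDim n < s) : ∃ C : ℝ≥0,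
    ∀ (a : Heis n → ℂ), AEStronglyMeasurable a volume → ∀ (z : Heis n) (R : ℝ), 0 < R →
      ∫⁻ w in {w | R ≤ rho (w⁻¹ * z)}, ‖a w‖ₑ * ENNReal.ofReal (rho (w⁻¹ * z) ^ (-s)) ≤
        C * ENNReal.ofReal (R ^ (homDim n - s)) * maximalFn a z := by
  obtain ⟨C, hC⟩ := exists_lintegral_rpow_far_le hsQ hs
  refine ⟨C * (volume (rball (1 : Heis n) 1)).toNNReal, fun a ha z R hR => ?_⟩
  have h := hC (fun w : Heis n => rho (w⁻¹ * z)) (measurable_rho_inv_mul z)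
    (volume.withDensity fun w => ‖a w‖ₑ) _
    (fun r hr => withDensity_growth z hr) R hR
  have hS : MeasurableSet {w : Heis n | R ≤ rho (w⁻¹ * z)} :=
    measurableSet_le measurable_const (measurable_rho_inv_mul z)
  rw [restrict_withDensity hS, lintegral_withDensity_eq_lintegral_mul₀ ha.enorm.restrict
    ((measurable_rho_inv_mul z).pow_const _).ennreal_ofReal.aemeasurable] at h
  refine h.trans_eq ?_
  rw [ENNReal.coe_mul, ENNReal.coe_toNNReal volume_rball_one_lt_top.ne]
  ring

theorem volume_setOf_rho_lt {r : ℝ} (hr : 0 < r) : volume {u : Heis n | rho u < r} ≤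
    volume (rball (1 : Heis n) 1) * ENNReal.ofReal (r ^ homDim n) := by
  have h : {u : Heis n | rho u < r} = rball 1 r := by
    ext u
    rw [mem_rball, inv_one, one_mul]
    rfl
  rw [h, volume_rball_rpow _ hr, mul_comm]

theorem exists_lintegral_rho_near_le {s : ℝ} (hs : 0 < s) (hsQ : s < homDim n) : ∃ C : ℝ≥0,
    ∀ R : ℝ, 0 < R → ∫⁻ u in {u : Heis n | rho u < R}, ENNReal.ofReal (rho u ^ (-s)) ≤
        C * ENNReal.ofReal (R ^ (homDim n - s)) := by
  obtain ⟨C, hC⟩ := exists_lintegral_rpow_near_le hsQ hs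
  refine ⟨C * (volume (rball (1 : Heis n) 1)).toNNReal, fun R hR => ?_⟩
  refine (hC (rho : Heis n → ℝ) measurable_rho rho_nonneg volume _
    (fun r hr => volume_setOf_rho_lt hr) R hR).trans_eq ?_
  rw [ENNReal.coe_mul, ENNReal.coe_toNNReal volume_rball_one_lt_top.ne]
  ring

theorem exists_lintegral_rho_far_le {s : ℝ} (hs : 0 < s) (hsQ : homDim n < s) : ∃ C : ℝ≥0,
    ∀ R : ℝ, 0 < R → ∫⁻ u in {u : Heis n | R ≤ rho u}, ENNReal.ofReal (rho u ^ (-s)) ≤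
        C * ENNReal.ofReal (R ^ (homDim n - s)) := by
  obtain ⟨C, hC⟩ := exists_lintegral_rpow_far_le hsQ hs
  refine ⟨C * (volume (rball (1 : Heis n) 1)).toNNReal, fun R hR => ?_⟩
  refine (hC (rho : Heis n → ℝ) measurable_rho volume _
    (fun r hr => volume_setOf_rho_lt hr) R hR).trans_eq ?_
  rw [ENNReal.coe_mul, ENNReal.coe_toNNReal volume_rball_one_lt_top.ne]
  ring

theorem ae_inv_mul_ne_zero (z : Heis n) : ∀ᵐ w : Heis n, w⁻¹ * z ≠ 0 := by
  have h : ∀ᵐ w : Heis n, w ≠ z := by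
    rw [ae_iff]
    simp only [ne_eq, not_not, Set.ofPred_eq_eq_singleton]
    rw [Measure.volume_eq_prod]
    exact measure_singleton z
  filter_upwards [h] with w hw h0
  rw [← one_eq_zero, inv_mul_eq_one] at h0
  exact hw h0

theorem inv_pow_eq_rpow (d : ℕ) (z : Heis n) : (rho z ^ d)⁻¹ = rho z ^ (-(d : ℝ)) := by
  rw [Real.rpow_neg (rho_nonneg z), Real.rpow_natCast]

theorem kernel_nonneg (z : Heis n) : 0 ≤ kernel z := inv_nonneg.2 (pow_nonneg (rho_nonneg z) _)

theorem kernel_eq_rpow (z : Heis n) : kernel z = rho z ^ (-(2 * n : ℝ)) := by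
  rw [kernel, inv_pow_eq_rpow]
  push_cast
  rfl

theorem IsHomog.exists_enorm_le {d : ℕ} {f : Heis n → ℝ} (hf : IsHomog d f) :
    ∃ C : ℝ≥0, ∀ z : Heis n, z ≠ 0 → ‖((f z : ℝ) : ℂ)‖ₑ ≤ C * ENNReal.ofReal (rho z ^ (-(d : ℝ))) := by
  obtain ⟨C, hC0, hC⟩ := hf.exists_bound
  refine ⟨C.toNNReal, fun z hz => ?_⟩
  have h1 : ((C.toNNReal : ℝ≥0) : ℝ≥0∞) = ENNReal.ofReal C := rfl
  rw [h1, ← ENNReal.ofReal_mul hC0, ← inv_pow_eq_rpow, ← ofReal_norm, Complex.norm_real]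
  exact ENNReal.ofReal_le_ofReal (hC z hz)

theorem IsHomog.measurable_comp {d : ℕ} {f : Heis n → ℝ} (hf : IsHomog d f) (z : Heis n) :
    Measurable fun w : Heis n => ((f (w⁻¹ * z) : ℝ) : ℂ) :=
  Complex.measurable_ofReal.comp (hf.measurable.comp (by fun_prop))

theorem IsHomog.aestronglyMeasurable_mul {d : ℕ} {f : Heis n → ℝ} (hf : IsHomog d f)
    {a : Heis n → ℂ} (ha : AEStronglyMeasurable a volume) (z : Heis n) :
    AEStronglyMeasurable (fun w => a w * ((f (w⁻¹ * z) : ℝ) : ℂ)) volume :=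
  ha.mul (hf.measurable_comp z).aestronglyMeasurable

theorem lintegral_enorm_mul_le {d : ℕ} {f : Heis n → ℝ} {C : ℝ≥0}
    (hC : ∀ z : Heis n, z ≠ 0 → ‖((f z : ℝ) : ℂ)‖ₑ ≤ C * ENNReal.ofReal (rho z ^ (-(d : ℝ))))
    (a : Heis n → ℂ) (z : Heis n) (S : Set (Heis n)) :
    ∫⁻ w in S, ‖a w * ((f (w⁻¹ * z) : ℝ) : ℂ)‖ₑ ≤
      C * ∫⁻ w in S, ‖a w‖ₑ * ENNReal.ofReal (rho (w⁻¹ * z) ^ (-(d : ℝ))) := by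
  rw [← lintegral_const_mul' _ _ ENNReal.coe_ne_top]
  refine lintegral_mono_ae ?_
  filter_upwards [ae_restrict_of_ae (ae_inv_mul_ne_zero z)] with w hw
  rw [enorm_mul, mul_left_comm]
  gcongr
  exact hC _ hw

theorem IsHomog.integrableOn_far {d : ℕ} {f : Heis n → ℝ} (hf : IsHomog d f)
    {a : Heis n → ℂ} (ha : Integrable a volume) (z : Heis n) {ε : ℝ} (hε : 0 < ε) :
    IntegrableOn (fun w => a w * ((f (w⁻¹ * z) : ℝ) : ℂ)) {w | ε ≤ rho (w⁻¹ * z)} := by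
  obtain ⟨C, hC⟩ := hf.exists_enorm_le
  refine ⟨(hf.aestronglyMeasurable_mul ha.1 z).restrict, ?_⟩
  refine (lintegral_enorm_mul_le hC a z _).trans_lt (ENNReal.mul_lt_top ENNReal.coe_lt_top ?_)
  calc ∫⁻ w in {w | ε ≤ rho (w⁻¹ * z)}, ‖a w‖ₑ * ENNReal.ofReal (rho (w⁻¹ * z) ^ (-(d : ℝ)))
      ≤ ∫⁻ w in {w | ε ≤ rho (w⁻¹ * z)}, ‖a w‖ₑ * ENNReal.ofReal (ε ^ (-(d : ℝ))) := by
        refine setLIntegral_mono' (measurableSet_le measurable_const (measurable_rho_inv_mul z)) ?_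
        intro w hw
        refine mul_le_mul_right (ENNReal.ofReal_le_ofReal ?_) _
        exact Real.rpow_le_rpow_of_nonpos hε hw (neg_nonpos.2 d.cast_nonneg)
    _ = (∫⁻ w in {w | ε ≤ rho (w⁻¹ * z)}, ‖a w‖ₑ) * ENNReal.ofReal (ε ^ (-(d : ℝ))) :=
        lintegral_mul_const' _ _ ENNReal.ofReal_ne_top
    _ < ∞ := ENNReal.mul_lt_top ((setLIntegral_le_lintegral _ _).trans_lt ha.2)
        ENNReal.ofReal_lt_top

/-- Below the critical degree `Q` the singularity is controlled by the finite value `Ma(z)`; at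
distance at least one the kernel is bounded and `a ∈ L¹` is enough. -/
theorem IsHomog.integrable_of_maximalFn {d : ℕ} {f : Heis n → ℝ} (hf : IsHomog d f)
    (hd : 0 < d) (hdQ : d < 2 * n + 2) {a : Heis n → ℂ} (ha : Integrable a volume) {z : Heis n}
    (hz : maximalFn a z ≠ ∞) : Integrable (fun w => a w * ((f (w⁻¹ * z) : ℝ) : ℂ)) volume := by
  obtain ⟨C, hC⟩ := hf.exists_enorm_le
  have hdQ' : (d : ℝ) < homDim n := by
    rw [homDim]; exact_mod_cast hdQ
  obtain ⟨C', hC'⟩ := exists_lintegral_near_le (n := n) (s := d) (by exact_mod_cast hd) hdQ'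
  have h1 : IntegrableOn (fun w => a w * ((f (w⁻¹ * z) : ℝ) : ℂ)) {w | rho (w⁻¹ * z) < 1} := by
    refine ⟨(hf.aestronglyMeasurable_mul ha.1 z).restrict, ?_⟩
    refine (lintegral_enorm_mul_le hC a z _).trans_lt (ENNReal.mul_lt_top ENNReal.coe_lt_top ?_)
    refine (hC' a ha.1 z 1 one_pos).trans_lt ?_
    exact ENNReal.mul_lt_top (ENNReal.mul_lt_top ENNReal.coe_lt_top ENNReal.ofReal_lt_top)
      hz.lt_top
  have h2 := h1.union (hf.integrableOn_far ha z one_pos)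
  have h3 : {w : Heis n | rho (w⁻¹ * z) < 1} ∪ {w | 1 ≤ rho (w⁻¹ * z)} = Set.univ := by
    ext w
    simpa using lt_or_ge (rho (w⁻¹ * z)) 1
  rwa [h3, integrableOn_univ] at h2

/-! ### Local integrability of potentials -/

/-- The upper bound on `q` is the condition for `ρ^{-2nq}` to be locally integrable. -/
theorem two_mul_lt_homDim (hn : 1 ≤ n) {q : ℝ} (hq : q < ((n : ℝ) + 1) / (n : ℝ)) :
    2 * n * q < homDim n := by
  have hn' : (0 : ℝ) < n := by exact_mod_cast hn
  rw [lt_div_iff₀ hn'] at hq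
  rw [homDim]
  linarith

theorem ofReal_kernel_rpow {q : ℝ} (hq : 0 < q) (u : Heis n) :
    ENNReal.ofReal (kernel u) ^ q = ENNReal.ofReal (rho u ^ (-(2 * n * q : ℝ))) := by
  rw [ENNReal.ofReal_rpow_of_nonneg (kernel_nonneg u) hq.le, kernel_eq_rpow,
    ← Real.rpow_mul (rho_nonneg u), neg_mul]

theorem measurable_kernel : Measurable (kernel : Heis n → ℝ) := isHomog_kernel.measurable

/-- Convolution with `ρ^{-2n}` maps `L¹` to `L^q` locally. -/
theorem exists_lintegral_kernel_conv_le (hn : 1 ≤ n) {q : ℝ} (hq1 : 1 < q)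
    (hq : q < ((n : ℝ) + 1) / (n : ℝ)) : ∃ C : ℝ≥0, ∀ (f : Heis n → ℝ≥0∞), AEMeasurable f volume →
      ∀ (S : Set (Heis n)) (R : ℝ), MeasurableSet S → 0 < R →
        (∀ w, f w ≠ 0 → ∀ v ∈ S, rho (w⁻¹ * v) < R) →
        ∫⁻ v in S, (∫⁻ w, f w * ENNReal.ofReal (kernel (w⁻¹ * v))) ^ q ≤
          C * ENNReal.ofReal (R ^ (homDim n - 2 * n * q)) * (∫⁻ w, f w) ^ q := by
  have hn' : (0 : ℝ) < n := by exact_mod_cast hn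
  obtain ⟨C, hC⟩ := exists_lintegral_rho_near_le (n := n) (s := 2 * n * q) (by positivity)
    (two_mul_lt_homDim hn hq)
  refine ⟨C, fun f hf S R hS hR h => ?_⟩
  refine (lintegral_conv_rpow_le hf measurable_kernel.ennreal_ofReal hq1 hS h).trans ?_
  simp only [ofReal_kernel_rpow (zero_lt_one.trans hq1)]
  rw [mul_comm]
  gcongr
  exact hC R hR

end Heis

end

noncomputable section

namespace Heis

variable {n : ℕ}

/-! ### Averages -/

theorem qavg_eq {q : ℝ} (hq : 0 < q) (B : Set (Heis n)) (g : Heis n → ℂ) :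
    qavg q B g = (volume B)⁻¹ ^ (1 / q) * (∫⁻ w in B, ‖g w‖ₑ ^ q) ^ (1 / q) :=
  ENNReal.mul_rpow_of_nonneg _ _ (by positivity)

/-- Minkowski's inequality; a constant is its own normalized average. Remainders are treated as a
function to be integrated plus a uniform bound. -/
theorem qavg_le_add {q : ℝ} (hq : 1 < q) {z : Heis n} {r : ℝ} (hr : 0 < r) {g : Heis n → ℂ}
    {N : Heis n → ℝ≥0∞} (hN : AEMeasurable N volume) {c : ℝ≥0∞}
    (h : ∀ᵐ v, v ∈ rball z r → ‖g v‖ₑ ≤ N v + c) :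
    qavg q (rball z r) g ≤ (volume (rball z r))⁻¹ ^ (1 / q)
      * (∫⁻ v in rball z r, N v ^ q) ^ (1 / q) + c := by
  have hq0 : 0 < q := by linarith
  set B := rball z r
  have hB0 : volume B ≠ 0 := (volume_rball_pos z hr).ne'
  have hBt : volume B ≠ ∞ := volume_rball_ne_top z hr
  have h1 : (∫⁻ v in B, ‖g v‖ₑ ^ q) ^ (1 / q) ≤
      (∫⁻ v in B, N v ^ q) ^ (1 / q) + volume B ^ (1 / q) * c := by
    calc (∫⁻ v in B, ‖g v‖ₑ ^ q) ^ (1 / q)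
        ≤ (∫⁻ v in B, (N + fun _ => c : Heis n → ℝ≥0∞) v ^ q) ^ (1 / q) := by
          refine ENNReal.rpow_le_rpow (lintegral_mono_ae ?_) (by positivity)
          filter_upwards [(ae_restrict_iff' (measurableSet_rball z r)).2 h] with v hv
          exact ENNReal.rpow_le_rpow hv hq0.le
      _ ≤ (∫⁻ v in B, N v ^ q) ^ (1 / q) + (∫⁻ _ in B, c ^ q) ^ (1 / q) :=
          ENNReal.lintegral_Lp_add_le hN.restrict aemeasurable_const hq.le
      _ = _ := by
          rw [setLIntegral_const, mul_comm (c ^ q), ENNReal.mul_rpow_of_nonneg _ _ (by positivity),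
            ← ENNReal.rpow_mul, mul_one_div_cancel hq0.ne', ENNReal.rpow_one]
  rw [qavg_eq hq0]
  refine (mul_le_mul_right h1 _).trans_eq ?_
  rw [mul_add, ← mul_assoc _ _ c,
    ← ENNReal.mul_rpow_of_nonneg (volume B)⁻¹ (volume B) (z := 1 / q) (by positivity),
    ENNReal.inv_mul_cancel hB0 hBt, ENNReal.one_rpow, one_mul]

theorem exists_volume_inv_rpow_le {q : ℝ} (hq : 0 < q) : ∃ C : ℝ≥0, ∀ (z : Heis n) (r : ℝ),
    0 < r → (volume (rball z r))⁻¹ ^ (1 / q) ≤ C * ENNReal.ofReal (r ^ (-(homDim n / q))) := by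
  have hV0 := (volume_rball_one_pos (n := n)).ne'
  have hVt := (volume_rball_one_lt_top (n := n)).ne
  refine ⟨((volume (rball (1 : Heis n) 1))⁻¹ ^ (1 / q)).toNNReal, fun z r hr => ?_⟩
  rw [ENNReal.coe_toNNReal (ENNReal.rpow_ne_top_of_nonneg (by positivity)
    (ENNReal.inv_ne_top.2 hV0)), volume_rball_rpow z hr, ENNReal.mul_inv (Or.inr hVt) (Or.inr hV0),
    ENNReal.mul_rpow_of_nonneg _ _ (by positivity), mul_comm]
  refine le_of_eq ?_
  congr 1
  rw [← ENNReal.ofReal_inv_of_pos (by positivity), ENNReal.ofReal_rpow_of_pos (by positivity),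
    ← Real.rpow_neg hr.le, ← Real.rpow_mul hr.le]
  congr 2
  ring

theorem aemeasurable_kernel_conv {f : Heis n → ℝ≥0∞} (hf : AEMeasurable f volume) :
    AEMeasurable (fun v : Heis n => ∫⁻ w, f w * ENNReal.ofReal (kernel (w⁻¹ * v))) volume := by
  have hm2 : Measurable fun p : Heis n × Heis n => ENNReal.ofReal (kernel (p.2⁻¹ * p.1)) :=
    measurable_kernel.ennreal_ofReal.comp (by fun_prop)
  have h1 : AEMeasurable (fun p : Heis n × Heis n => f p.2 * ENNReal.ofReal (kernel (p.2⁻¹ * p.1)))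
      ((volume : Measure (Heis n)).prod volume) :=
    hf.comp_snd.mul hm2.aemeasurable
  exact h1.lintegral_prod_right'

theorem exists_Lq_kernel_conv_le (hn : 1 ≤ n) {q : ℝ} (hq1 : 1 < q)
    (hq : q < ((n : ℝ) + 1) / (n : ℝ)) : ∃ C : ℝ≥0, ∀ (f : Heis n → ℝ≥0∞), AEMeasurable f volume →
      ∀ (S : Set (Heis n)) (R : ℝ), MeasurableSet S → 0 < R →
        (∀ w, f w ≠ 0 → ∀ v ∈ S, rho (w⁻¹ * v) < R) →
        (∫⁻ v in S, (∫⁻ w, f w * ENNReal.ofReal (kernel (w⁻¹ * v))) ^ q) ^ (1 / q) ≤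
          C * ENNReal.ofReal (R ^ (homDim n / q - 2 * n)) * (∫⁻ w, f w) := by
  have hq0 : 0 < q := by linarith
  obtain ⟨C, hC⟩ := exists_lintegral_kernel_conv_le hn hq1 hq
  refine ⟨C ^ (1 / q), fun f hf S R hS hR h => ?_⟩
  refine (ENNReal.rpow_le_rpow (hC f hf S R hS hR h) (by positivity)).trans_eq ?_
  rw [ENNReal.mul_rpow_of_nonneg _ _ (by positivity), ENNReal.mul_rpow_of_nonneg _ _ (by positivity),
    ← ENNReal.rpow_mul, mul_one_div_cancel hq0.ne', ENNReal.rpow_one,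
    ENNReal.ofReal_rpow_of_pos (by positivity), ← Real.rpow_mul hR.le,
    ENNReal.coe_rpow_of_nonneg _ (by positivity)]
  congr 4
  field_simp

/-! ### The first order Taylor polynomial of a potential -/

/-- The potential `a * ρ^{-2n}`, without the normalizing constant. -/
def pot (a : Heis n → ℂ) (v : Heis n) : ℂ := ∫ w, a w * ((kernel (w⁻¹ * v) : ℝ) : ℂ)

/-- The coefficient `∫ a(w) X_jρ^{-2n}(w⁻¹z) dw`. -/
def potX (a : Heis n → ℂ) (j : Fin n ⊕ Fin n) (z : Heis n) : ℂ :=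
  ∫ w, a w * ((fieldX j kernel (w⁻¹ * z) : ℝ) : ℂ)

/-- `a * ρ^{-2n}` minus its Taylor polynomial of degree one at `z`. -/
def potRem (a : Heis n → ℂ) (z v : Heis n) : ℂ :=
  pot a v - (pot a z + ∑ j, potX a j z * ((v.1 j - z.1 j : ℝ) : ℂ))

/-- The horizontal group law is addition, so the first-order left Taylor polynomial in `z⁻¹v` is an
affine polynomial in the coordinates of `v`. -/
theorem inv_mul_fst (z v : Heis n) (j : Fin n ⊕ Fin n) : (z⁻¹ * v).1 j = v.1 j - z.1 j := by
  simp [mul_def, inv_def, neg_add_eq_sub]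

theorem mul_taylorOne_eq (f : Heis n → ℝ) (c : ℂ) (u h : Heis n) :
    c * ((taylorOne f u h : ℝ) : ℂ) = ∑ j, (c * ((fieldX j f u : ℝ) : ℂ)) * ((h.1 j : ℝ) : ℂ) := by
  rw [taylorOne, Complex.ofReal_sum, Finset.mul_sum]
  refine Finset.sum_congr rfl fun j _ => ?_
  push_cast
  ring

theorem integrable_taylorOne {a : Heis n → ℂ} {z : Heis n}
    (hX : ∀ j, Integrable fun w => a w * ((fieldX j kernel (w⁻¹ * z) : ℝ) : ℂ)) (h : Heis n) :
    Integrable fun w => a w * ((taylorOne kernel (w⁻¹ * z) h : ℝ) : ℂ) := by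
  simp only [mul_taylorOne_eq]
  exact integrable_finsetSum _ fun j _ => (hX j).mul_const _

theorem integral_taylorOne {a : Heis n → ℂ} {z : Heis n}
    (hX : ∀ j, Integrable fun w => a w * ((fieldX j kernel (w⁻¹ * z) : ℝ) : ℂ)) (h : Heis n) :
    ∫ w, a w * ((taylorOne kernel (w⁻¹ * z) h : ℝ) : ℂ) = ∑ j, potX a j z * ((h.1 j : ℝ) : ℂ) := by
  simp only [mul_taylorOne_eq]
  rw [integral_finsetSum _ fun j _ => (hX j).mul_const _]
  exact Finset.sum_congr rfl fun j _ => integral_mul_const _ _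

/-- The integrand of `potRem`. -/
def remKernel (z v w : Heis n) : ℝ :=
  kernel (w⁻¹ * v) - kernel (w⁻¹ * z) - taylorOne kernel (w⁻¹ * z) (z⁻¹ * v)

theorem mul_remKernel (c : ℂ) (z v w : Heis n) : c * ((remKernel z v w : ℝ) : ℂ) =
    c * ((kernel (w⁻¹ * v) : ℝ) : ℂ) - c * ((kernel (w⁻¹ * z) : ℝ) : ℂ)
      - c * ((taylorOne kernel (w⁻¹ * z) (z⁻¹ * v) : ℝ) : ℂ) := by
  rw [remKernel]
  push_cast
  ring

theorem integrable_remKernel {a : Heis n → ℂ} {z v : Heis n}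
    (hv : Integrable fun w => a w * ((kernel (w⁻¹ * v) : ℝ) : ℂ))
    (hz : Integrable fun w => a w * ((kernel (w⁻¹ * z) : ℝ) : ℂ))
    (hX : ∀ j, Integrable fun w => a w * ((fieldX j kernel (w⁻¹ * z) : ℝ) : ℂ)) :
    Integrable fun w => a w * ((remKernel z v w : ℝ) : ℂ) := by
  simp only [mul_remKernel]
  exact (hv.sub hz).sub (integrable_taylorOne hX _)

theorem potRem_eq_integral {a : Heis n → ℂ} {z v : Heis n}
    (hv : Integrable fun w => a w * ((kernel (w⁻¹ * v) : ℝ) : ℂ))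
    (hz : Integrable fun w => a w * ((kernel (w⁻¹ * z) : ℝ) : ℂ))
    (hX : ∀ j, Integrable fun w => a w * ((fieldX j kernel (w⁻¹ * z) : ℝ) : ℂ)) :
    potRem a z v = ∫ w, a w * ((remKernel z v w : ℝ) : ℂ) := by
  simp only [mul_remKernel]
  rw [integral_sub (f := fun w => a w * ((kernel (w⁻¹ * v) : ℝ) : ℂ)
    - a w * ((kernel (w⁻¹ * z) : ℝ) : ℂ)) (hv.sub hz) (integrable_taylorOne hX _), integral_sub hv hz,
    integral_taylorOne hX, potRem, pot, pot]
  simp only [inv_mul_fst]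
  ring

theorem abs_fst_le_rho (h : Heis n) (j : Fin n ⊕ Fin n) : |h.1 j| ≤ rho h :=
  (PiLp.norm_apply_le h.1 j).trans (norm_fst_le_rho h)

theorem IsHomog.exists_taylorOne_le {d : ℕ} {f : Heis n → ℝ} (hf : IsHomog d f) :
    ∃ C, 0 ≤ C ∧ ∀ u : Heis n, u ≠ 0 → ∀ h : Heis n,
      |taylorOne f u h| ≤ C * rho h * (rho u ^ (d + 1))⁻¹ := by
  choose C hC0 hC using fun j => (hf.fieldX j).exists_bound
  refine ⟨∑ j, C j, Finset.sum_nonneg fun j _ => hC0 j, fun u hu h => ?_⟩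
  rw [taylorOne, Finset.sum_mul, Finset.sum_mul]
  refine (Finset.abs_sum_le_sum_abs _ _).trans (Finset.sum_le_sum fun j _ => ?_)
  rw [abs_mul]
  calc |h.1 j| * |Heis.fieldX j f u| ≤ rho h * (C j * (rho u ^ (d + 1))⁻¹) :=
        mul_le_mul (abs_fst_le_rho h j) (hC j u hu) (abs_nonneg _) (rho_nonneg h)
    _ = _ := by ring

/-! ### Second order terms and the maximal truncated integrals -/

/-- The sum of the maximal truncated integrals over the multi-indices of degree two. -/
def truncSum (a : Heis n → ℂ) (z : Heis n) : ℝ≥0∞ :=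
  ∑' I : {I : MultiIndex n // hdeg I = 2}, truncMax I.1 a z

theorem enorm_integral_far_le_truncSum (a : Heis n → ℂ) (z : Heis n) {I : MultiIndex n}
    (hI : hdeg I = 2) {ε : ℝ} (hε : 0 < ε) :
    ‖∫ w in {w | ε < rho (w⁻¹ * z)}, a w * ((fieldPow I kernel (w⁻¹ * z) : ℝ) : ℂ)‖ₑ
      ≤ truncSum a z := by
  refine le_trans ?_ (ENNReal.le_tsum (⟨I, hI⟩ : {I : MultiIndex n // hdeg I = 2}))
  refine le_iSup_of_le ε (le_iSup_of_le hε (le_of_eq ?_))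
  simp only [mul_comm (a _)]

theorem measurableSet_far (z : Heis n) (ε : ℝ) : MeasurableSet {w : Heis n | ε < rho (w⁻¹ * z)} :=
  measurableSet_lt measurable_const (measurable_rho_inv_mul z)

theorem IsHomog.integrableOn_far' {d : ℕ} {f : Heis n → ℝ} (hf : IsHomog d f)
    {a : Heis n → ℂ} (ha : Integrable a volume) (z : Heis n) {ε : ℝ} (hε : 0 < ε) :
    IntegrableOn (fun w => a w * ((f (w⁻¹ * z) : ℝ) : ℂ)) {w | ε < rho (w⁻¹ * z)} :=
  (hf.integrableOn_far ha z hε).mono_set fun w hw => show ε ≤ rho (w⁻¹ * z) from le_of_lt hw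

theorem enorm_integral_fieldT_le (a : Heis n → ℂ) (z : Heis n) {ε : ℝ} (hε : 0 < ε) :
    ‖∫ w in {w | ε < rho (w⁻¹ * z)}, a w * ((fieldT kernel (w⁻¹ * z) : ℝ) : ℂ)‖ₑ
      ≤ truncSum a z := by
  obtain ⟨I, hI, h⟩ := exists_fieldPow_eq_fieldT (n := n)
  rw [← h]
  exact enorm_integral_far_le_truncSum a z hI hε

theorem abs_dot_single_le (j k : Fin n ⊕ Fin n) :
    |dotProduct (EuclideanSpace.single j (1 : ℝ)).ofLp
      ((matJ n).mulVec (EuclideanSpace.single k (1 : ℝ)).ofLp)| ≤ 2 := by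
  rw [dot_matJ_eq_inner, abs_mul, abs_two]
  have h := abs_real_inner_le_norm (rotJ (EuclideanSpace.single j (1 : ℝ)))
    (EuclideanSpace.single k (1 : ℝ))
  rw [norm_rotJ] at h
  simp only [PiLp.norm_single, norm_one, mul_one] at h
  linarith

/-- If `X_j X_k` is not in the order of `X^I`, exchanging the factors adds a multiple of `∂_t` with
coefficient at most `4`. As `∂_t` is also some `X^I` of degree two, the total constant is `1 + 4`.
-/
theorem enorm_integral_fieldX_fieldX_le {a : Heis n → ℂ} (ha : Integrable a volume) (z : Heis n)
    (j k : Fin n ⊕ Fin n) {ε : ℝ} (hε : 0 < ε) :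
    ‖∫ w in {w | ε < rho (w⁻¹ * z)}, a w * ((fieldX j (fieldX k kernel) (w⁻¹ * z) : ℝ) : ℂ)‖ₑ
      ≤ 5 * truncSum a z := by
  obtain ⟨I, hI, h | h⟩ := exists_fieldPow_eq j k
  · rw [← h]
    refine (enorm_integral_far_le_truncSum a z hI hε).trans ?_
    exact le_mul_of_one_le_left zero_le (by norm_num)
  · set c := 2 * dotProduct (EuclideanSpace.single j (1 : ℝ)).ofLp
      ((matJ n).mulVec (EuclideanSpace.single k (1 : ℝ)).ofLp) with hc
    have e : ∫ w in {w | ε < rho (w⁻¹ * z)},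
          a w * ((fieldX j (fieldX k kernel) (w⁻¹ * z) : ℝ) : ℂ) =
        ∫ w in {w | ε < rho (w⁻¹ * z)},
          (a w * ((fieldPow I kernel (w⁻¹ * z) : ℝ) : ℂ)
            + (c : ℂ) * (a w * ((fieldT kernel (w⁻¹ * z) : ℝ) : ℂ))) := by
      refine setIntegral_congr_fun (measurableSet_far z ε) fun w hw => ?_
      have hw' : w⁻¹ * z ≠ 0 := ne_zero_of_rho_pos (hε.trans hw)
      have h1 := fieldX_fieldX_comm (isHomog_kernel.contDiffAt hw') j k
      rw [h1, ← hc, h]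
      push_cast
      ring
    have i1 : IntegrableOn (fun w => a w * ((fieldPow I kernel (w⁻¹ * z) : ℝ) : ℂ))
        {w | ε < rho (w⁻¹ * z)} := by
      rw [h]
      exact ((isHomog_kernel.fieldX j).fieldX k).integrableOn_far' ha z hε
    have i2 := isHomog_kernel.fieldT.integrableOn_far' ha z hε
    rw [e, integral_add i1 (i2.const_mul _), integral_const_mul]
    refine (enorm_add_le _ _).trans ?_
    rw [enorm_mul]
    have h4 : ‖(c : ℂ)‖ₑ ≤ 4 := by
      rw [← ofReal_norm, Complex.norm_real, Real.norm_eq_abs, hc, abs_mul, abs_two]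
      have := abs_dot_single_le j k
      calc _ ≤ ENNReal.ofReal 4 := ENNReal.ofReal_le_ofReal (by linarith)
        _ = 4 := by norm_num
    calc _ ≤ truncSum a z + 4 * truncSum a z := by
          gcongr
          · exact enorm_integral_far_le_truncSum a z hI hε
          · exact enorm_integral_fieldT_le a z hε
      _ = 5 * truncSum a z := by
          rw [← one_add_mul]; norm_num

theorem mul_taylorTwo_eq (f : Heis n → ℝ) (c : ℂ) (u h : Heis n) :
    c * ((taylorTwo f u h : ℝ) : ℂ) =
      ∑ j, ∑ k, ((h.1 j * h.1 k : ℝ) : ℂ) * (c * ((fieldX j (fieldX k f) u : ℝ) : ℂ))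
        + ((2 * h.2 : ℝ) : ℂ) * (c * ((fieldT f u : ℝ) : ℂ)) := by
  rw [taylorTwo, Complex.ofReal_add, mul_add, Complex.ofReal_sum, Finset.mul_sum]
  congr 1
  · refine Finset.sum_congr rfl fun j _ => ?_
    rw [Complex.ofReal_sum, Finset.mul_sum]
    refine Finset.sum_congr rfl fun k _ => ?_
    push_cast
    ring
  · push_cast
    ring

theorem integrableOn_taylorTwo {a : Heis n → ℂ} (ha : Integrable a volume) (z h : Heis n)
    {ε : ℝ} (hε : 0 < ε) :
    IntegrableOn (fun w => a w * ((taylorTwo kernel (w⁻¹ * z) h : ℝ) : ℂ))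
      {w | ε < rho (w⁻¹ * z)} := by
  simp only [mul_taylorTwo_eq]
  refine Integrable.add (integrable_finsetSum _ fun j _ => integrable_finsetSum _ fun k _ => ?_) ?_
  · exact (((isHomog_kernel.fieldX k).fieldX j).integrableOn_far' ha z hε).const_mul _
  · exact (isHomog_kernel.fieldT.integrableOn_far' ha z hε).const_mul _

/-- There are `(2n)²` products, each costing `5`, and the vertical term costs `2`; every coefficient
is at most a multiple of `ρ(h)²`. -/
theorem enorm_integral_taylorTwo_le {a : Heis n → ℂ} (ha : Integrable a volume) (z h : Heis n)
    {ε : ℝ} (hε : 0 < ε) :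
    ‖∫ w in {w | ε < rho (w⁻¹ * z)}, a w * ((taylorTwo kernel (w⁻¹ * z) h : ℝ) : ℂ)‖ₑ
      ≤ ENNReal.ofReal (rho h ^ 2) * (((5 * (2 * n) ^ 2 + 2 : ℕ) : ℝ≥0∞) * truncSum a z) := by
  have i1 : ∀ j k, IntegrableOn (fun w => ((h.1 j * h.1 k : ℝ) : ℂ) *
      (a w * ((fieldX j (fieldX k kernel) (w⁻¹ * z) : ℝ) : ℂ))) {w | ε < rho (w⁻¹ * z)} :=
    fun j k => (((isHomog_kernel.fieldX k).fieldX j).integrableOn_far' ha z hε).const_mul _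
  have i2 : IntegrableOn (fun w => ((2 * h.2 : ℝ) : ℂ) *
      (a w * ((fieldT kernel (w⁻¹ * z) : ℝ) : ℂ))) {w | ε < rho (w⁻¹ * z)} :=
    (isHomog_kernel.fieldT.integrableOn_far' ha z hε).const_mul _
  have b1 : ∀ j k, ‖((h.1 j * h.1 k : ℝ) : ℂ)‖ₑ ≤ ENNReal.ofReal (rho h ^ 2) := fun j k => by
    rw [← ofReal_norm, Complex.norm_real, Real.norm_eq_abs, abs_mul, sq]
    exact ENNReal.ofReal_le_ofReal
      (mul_le_mul (abs_fst_le_rho h j) (abs_fst_le_rho h k) (abs_nonneg _) (rho_nonneg h))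
  have b2 : ‖((2 * h.2 : ℝ) : ℂ)‖ₑ ≤ ENNReal.ofReal (rho h ^ 2) * 2 := by
    rw [← ofReal_norm, Complex.norm_real, Real.norm_eq_abs, abs_mul, abs_two,
      show (2 : ℝ≥0∞) = ENNReal.ofReal 2 by norm_num, ← ENNReal.ofReal_mul (sq_nonneg _)]
    exact ENNReal.ofReal_le_ofReal (by linarith [abs_snd_le_rho_sq h])
  simp only [mul_taylorTwo_eq]
  rw [integral_add (integrable_finsetSum _ fun j _ => integrable_finsetSum _ fun k _ => i1 j k) i2,
    integral_finsetSum _ fun j _ => integrable_finsetSum _ fun k _ => i1 j k]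
  simp only [integral_finsetSum _ fun k _ => i1 _ k, integral_const_mul]
  refine (enorm_add_le _ _).trans ?_
  calc _ ≤ (∑ j : Fin n ⊕ Fin n, ∑ k : Fin n ⊕ Fin n,
          ENNReal.ofReal (rho h ^ 2) * (5 * truncSum a z))
        + ENNReal.ofReal (rho h ^ 2) * 2 * truncSum a z := by
        refine add_le_add ?_ ?_
        · refine (enorm_sum_le _ _).trans (Finset.sum_le_sum fun j _ => ?_)
          refine (enorm_sum_le _ _).trans (Finset.sum_le_sum fun k _ => ?_)
          rw [enorm_mul]
          exact mul_le_mul' (b1 j k) (enorm_integral_fieldX_fieldX_le ha z j k hε)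
        · rw [enorm_mul]
          exact mul_le_mul' b2 (enorm_integral_fieldT_le a z hε)
    _ = _ := by
        simp only [Finset.sum_const, Finset.card_univ, Fintype.card_sum, Fintype.card_fin,
          nsmul_eq_mul]
        push_cast
        ring

end Heis

end

noncomputable section

namespace Heis

variable {n : ℕ}

/-! ### The estimate by maximal functions at an arbitrary point -/

theorem ofReal_abs_eq_enorm (x : ℝ) : ENNReal.ofReal |x| = ‖((x : ℝ) : ℂ)‖ₑ := by
  rw [← ofReal_norm, Complex.norm_real, Real.norm_eq_abs]

/-- Near `z` the three terms of the remainder are bounded separately. Those centred at `z` have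
degrees `-2n` and `-2n-1`, above `-Q`, and each yields `r² Ma(z)`. The one centred at `v` is kept as
a convolution, because it is controlled only on average over `v`. -/
theorem exists_lintegral_near_remKernel_le (hn : 1 ≤ n) : ∃ C : ℝ≥0, ∀ a : Heis n → ℂ,
    Integrable a volume → ∀ (z v : Heis n) (r : ℝ), 0 < r → rho (z⁻¹ * v) ≤ r →
      ∫⁻ w in {w | rho (w⁻¹ * z) ≤ 4 * r}, ‖a w * ((remKernel z v w : ℝ) : ℂ)‖ₑ ≤
        (∫⁻ w, ({w | rho (w⁻¹ * z) ≤ 4 * r}).indicator (fun w => ‖a w‖ₑ) w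
            * ENNReal.ofReal (kernel (w⁻¹ * v)))
          + ENNReal.ofReal (r ^ 2) * (C * maximalFn a z) := by
  have hn' : (0 : ℝ) < n := by exact_mod_cast hn
  obtain ⟨C₁, hC₁0, hC₁⟩ := (isHomog_kernel (n := n)).exists_taylorOne_le
  obtain ⟨D₀, hD₀⟩ := exists_lintegral_near_le (n := n) (s := 2 * n) (by positivity)
    (by rw [homDim]; linarith)
  obtain ⟨D₁, hD₁⟩ := exists_lintegral_near_le (n := n) (s := 2 * n + 1) (by positivity)
    (by rw [homDim]; linarith)
  refine ⟨D₀ * Real.toNNReal 25 + Real.toNNReal (C₁ * 5) * D₁, fun a ha z v r hr hv => ?_⟩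
  set S : Set (Heis n) := {w | rho (w⁻¹ * z) ≤ 4 * r} with hS
  have hSm : MeasurableSet S := measurableSet_le (measurable_rho_inv_mul z) measurable_const
  -- The shell estimate is for strict sublevel sets, hence the enlargement from `4r` to `5r`.
  have hSs : S ⊆ {w | rho (w⁻¹ * z) < 5 * r} := fun w hw =>
    show rho (w⁻¹ * z) < 5 * r from lt_of_le_of_lt (show rho (w⁻¹ * z) ≤ 4 * r from hw)
      (by linarith)
  have hpt : ∀ᵐ w, ‖a w * ((remKernel z v w : ℝ) : ℂ)‖ₑ ≤
      ‖a w‖ₑ * ENNReal.ofReal (kernel (w⁻¹ * v))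
        + (‖a w‖ₑ * ENNReal.ofReal (rho (w⁻¹ * z) ^ (-(2 * n : ℝ)))
          + ENNReal.ofReal (C₁ * r) *
            (‖a w‖ₑ * ENNReal.ofReal (rho (w⁻¹ * z) ^ (-(2 * n + 1 : ℝ))))) := by
    filter_upwards [ae_inv_mul_ne_zero z] with w hw
    have h0 : 0 ≤ rho (w⁻¹ * z) := rho_nonneg _
    have h1 : |remKernel z v w| ≤ kernel (w⁻¹ * v) + (rho (w⁻¹ * z) ^ (-(2 * n : ℝ))
        + C₁ * r * rho (w⁻¹ * z) ^ (-(2 * n + 1 : ℝ))) := by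
      have h2 := hC₁ _ hw (z⁻¹ * v)
      rw [inv_pow_eq_rpow] at h2
      push_cast at h2
      have h3 : C₁ * rho (z⁻¹ * v) * rho (w⁻¹ * z) ^ (-(2 * n + 1 : ℝ)) ≤
          C₁ * r * rho (w⁻¹ * z) ^ (-(2 * n + 1 : ℝ)) := by gcongr
      rw [← kernel_eq_rpow, remKernel]
      have h4 := abs_sub (kernel (w⁻¹ * v) - kernel (w⁻¹ * z))
        (taylorOne kernel (w⁻¹ * z) (z⁻¹ * v))
      have h5 := abs_sub (kernel (w⁻¹ * v)) (kernel (w⁻¹ * z))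
      rw [abs_of_nonneg (kernel_nonneg _), abs_of_nonneg (kernel_nonneg _)] at h5
      linarith
    rw [enorm_mul, ← ofReal_abs_eq_enorm]
    calc ‖a w‖ₑ * ENNReal.ofReal |remKernel z v w|
        ≤ ‖a w‖ₑ * ENNReal.ofReal (kernel (w⁻¹ * v) + (rho (w⁻¹ * z) ^ (-(2 * n : ℝ))
        + C₁ * r * rho (w⁻¹ * z) ^ (-(2 * n + 1 : ℝ)))) :=
          mul_le_mul_right (ENNReal.ofReal_le_ofReal h1) _
      _ = _ := by
          rw [ENNReal.ofReal_add (kernel_nonneg _) (by positivity),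
            ENNReal.ofReal_add (by positivity) (by positivity),
            ENNReal.ofReal_mul (by positivity : 0 ≤ C₁ * r)]
          ring
  have m0 : AEMeasurable (fun w => ‖a w‖ₑ * ENNReal.ofReal (kernel (w⁻¹ * v))) volume :=
    ha.1.enorm.mul (measurable_kernel.comp (by fun_prop)).ennreal_ofReal.aemeasurable
  have m1 : AEMeasurable (fun w => ‖a w‖ₑ * ENNReal.ofReal (rho (w⁻¹ * z) ^ (-(2 * n : ℝ))))
      volume :=
    ha.1.enorm.mul ((measurable_rho_inv_mul z).pow_const _).ennreal_ofReal.aemeasurable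
  have e0 : ∫⁻ w in S, ‖a w‖ₑ * ENNReal.ofReal (kernel (w⁻¹ * v)) =
      ∫⁻ w, S.indicator (fun w => ‖a w‖ₑ) w * ENNReal.ofReal (kernel (w⁻¹ * v)) := by
    rw [← lintegral_indicator hSm]
    refine lintegral_congr fun w => ?_
    by_cases hw : w ∈ S <;> simp [hw]
  calc ∫⁻ w in S, ‖a w * ((remKernel z v w : ℝ) : ℂ)‖ₑ
      ≤ ∫⁻ w in S, (‖a w‖ₑ * ENNReal.ofReal (kernel (w⁻¹ * v))
        + (‖a w‖ₑ * ENNReal.ofReal (rho (w⁻¹ * z) ^ (-(2 * n : ℝ)))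
          + ENNReal.ofReal (C₁ * r) *
            (‖a w‖ₑ * ENNReal.ofReal (rho (w⁻¹ * z) ^ (-(2 * n + 1 : ℝ)))))) :=
        lintegral_mono_ae (ae_restrict_of_ae hpt)
    _ = (∫⁻ w in S, ‖a w‖ₑ * ENNReal.ofReal (kernel (w⁻¹ * v)))
        + ((∫⁻ w in S, ‖a w‖ₑ * ENNReal.ofReal (rho (w⁻¹ * z) ^ (-(2 * n : ℝ))))
          + ENNReal.ofReal (C₁ * r) *
            ∫⁻ w in S, ‖a w‖ₑ * ENNReal.ofReal (rho (w⁻¹ * z) ^ (-(2 * n + 1 : ℝ)))) := by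
        rw [lintegral_add_left' m0.restrict, lintegral_add_left' m1.restrict,
          lintegral_const_mul' _ _ ENNReal.ofReal_ne_top]
    _ ≤ (∫⁻ w in S, ‖a w‖ₑ * ENNReal.ofReal (kernel (w⁻¹ * v)))
        + (D₀ * ENNReal.ofReal ((5 * r) ^ (homDim n - 2 * n)) * maximalFn a z
          + ENNReal.ofReal (C₁ * r) *
            (D₁ * ENNReal.ofReal ((5 * r) ^ (homDim n - (2 * n + 1))) * maximalFn a z)) := by
        gcongr
        · exact (lintegral_mono_set hSs).trans (hD₀ a ha.1 z (5 * r) (by positivity))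
        · exact (lintegral_mono_set hSs).trans (hD₁ a ha.1 z (5 * r) (by positivity))
    _ = _ := by
        rw [e0]
        congr 1
        have x0 : (5 * r) ^ (homDim n - 2 * n) = r ^ 2 * 25 := by
          rw [show homDim n - 2 * n = ((2 : ℕ) : ℝ) by rw [homDim]; push_cast; ring,
            Real.rpow_natCast]
          ring
        have x1 : (5 * r) ^ (homDim n - (2 * n + 1)) = 5 * r := by
          rw [show homDim n - (2 * n + 1) = 1 by rw [homDim]; ring, Real.rpow_one]
        have x2 : ENNReal.ofReal (C₁ * r) * ENNReal.ofReal (5 * r)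
            = ENNReal.ofReal (r ^ 2) * ENNReal.ofReal (C₁ * 5) := by
          rw [← ENNReal.ofReal_mul (by positivity), ← ENNReal.ofReal_mul (by positivity)]
          congr 1
          ring
        rw [x0, x1, ENNReal.ofReal_mul (by positivity)]
        calc _ = D₀ * (ENNReal.ofReal (r ^ 2) * ENNReal.ofReal 25) * maximalFn a z +
              ENNReal.ofReal (C₁ * r) * ENNReal.ofReal (5 * r) * (D₁ * maximalFn a z) := by ring
          _ = _ := by
              rw [x2]
              push_cast
              simp only [ENNReal.ofReal]
              ring

/-- For `ρ(w⁻¹z) > 4r` the increment `z⁻¹v` is small enough for the second-order expansion. Its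
error `r³ ρ^{-(2n+3)}` integrates to `r³ · r^{-1} Ma(z)`. The second-order term is not absolutely
controlled; it is a truncated integral with `ε = 4r`. -/
theorem exists_enorm_integral_far_remKernel_le : ∃ C : ℝ≥0, ∀ a : Heis n → ℂ,
    Integrable a volume → ∀ (z v : Heis n) (r : ℝ), 0 < r → rho (z⁻¹ * v) ≤ r →
      Integrable (fun w => a w * ((remKernel z v w : ℝ) : ℂ)) →
      ‖∫ w in {w | 4 * r < rho (w⁻¹ * z)}, a w * ((remKernel z v w : ℝ) : ℂ)‖ₑ ≤
        ENNReal.ofReal (r ^ 2) * (C * (maximalFn a z + truncSum a z)) := by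
  obtain ⟨C₂, hC₂0, hC₂⟩ := (isHomog_kernel (n := n)).exists_taylorTwo
  obtain ⟨D, hD⟩ := exists_lintegral_far_le (n := n) (s := 2 * n + 3) (by positivity)
    (by rw [homDim]; linarith)
  set k : ℕ := 5 * (2 * n) ^ 2 + 2 with hk
  refine ⟨Real.toNNReal (C₂ / 4) * D + k, fun a ha z v r hr hv hi => ?_⟩
  set S : Set (Heis n) := {w | 4 * r < rho (w⁻¹ * z)} with hS
  have hSm : MeasurableSet S := measurableSet_far z _
  set h := z⁻¹ * v with hh
  have i2 : IntegrableOn (fun w => a w * ((taylorTwo kernel (w⁻¹ * z) h : ℝ) : ℂ)) S :=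
    integrableOn_taylorTwo ha z h (by positivity)
  set E : Heis n → ℝ := fun w => remKernel z v w - taylorTwo kernel (w⁻¹ * z) h / 2 with hE
  have e1 : ∀ w, a w * ((remKernel z v w : ℝ) : ℂ) = a w * ((E w : ℝ) : ℂ)
      + (1 / 2 : ℂ) * (a w * ((taylorTwo kernel (w⁻¹ * z) h : ℝ) : ℂ)) := fun w => by
    rw [hE]
    push_cast
    ring
  have i1 : IntegrableOn (fun w => a w * ((E w : ℝ) : ℂ)) S := by
    have : (fun w => a w * ((E w : ℝ) : ℂ)) = fun w => a w * ((remKernel z v w : ℝ) : ℂ)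
        - (1 / 2 : ℂ) * (a w * ((taylorTwo kernel (w⁻¹ * z) h : ℝ) : ℂ)) := by
      funext w
      rw [e1]
      ring
    rw [this]
    exact hi.integrableOn.sub (i2.const_mul _)
  have b1 : ‖∫ w in S, a w * ((E w : ℝ) : ℂ)‖ₑ ≤
      ENNReal.ofReal (r ^ 2) * ((Real.toNNReal (C₂ / 4) * D : ℝ≥0) * maximalFn a z) := by
    calc ‖∫ w in S, a w * ((E w : ℝ) : ℂ)‖ₑ
        ≤ ∫⁻ w in S, ‖a w * ((E w : ℝ) : ℂ)‖ₑ := enorm_integral_le_lintegral_enorm _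
      _ ≤ ∫⁻ w in S, ENNReal.ofReal (C₂ * r ^ 3) *
            (‖a w‖ₑ * ENNReal.ofReal (rho (w⁻¹ * z) ^ (-(2 * n + 3 : ℝ)))) := by
          refine setLIntegral_mono' hSm fun w hw => ?_
          have hw' : 4 * r < rho (w⁻¹ * z) := hw
          have hpos : 0 < rho (w⁻¹ * z) := by linarith
          have h1 := hC₂ _ (ne_zero_of_rho_pos hpos) h (by linarith)
          rw [inv_pow_eq_rpow] at h1
          push_cast at h1
          have h2 : |E w| ≤ C₂ * r ^ 3 * rho (w⁻¹ * z) ^ (-(2 * n + 3 : ℝ)) := by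
            change |kernel (w⁻¹ * v) - kernel (w⁻¹ * z) - taylorOne kernel (w⁻¹ * z) h
              - taylorTwo kernel (w⁻¹ * z) h / 2| ≤ _
            rw [hh, mul_assoc, mul_inv_cancel_left, ← hh] at h1
            refine h1.trans ?_
            have := rho_nonneg h
            gcongr
          rw [enorm_mul, ← ofReal_abs_eq_enorm, mul_left_comm,
            ← ENNReal.ofReal_mul (by positivity)]
          exact mul_le_mul_right (ENNReal.ofReal_le_ofReal h2) _
      _ = ENNReal.ofReal (C₂ * r ^ 3) *
            ∫⁻ w in S, ‖a w‖ₑ * ENNReal.ofReal (rho (w⁻¹ * z) ^ (-(2 * n + 3 : ℝ))) :=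
          lintegral_const_mul' _ _ ENNReal.ofReal_ne_top
      _ ≤ ENNReal.ofReal (C₂ * r ^ 3) *
            (D * ENNReal.ofReal ((4 * r) ^ (homDim n - (2 * n + 3))) * maximalFn a z) := by
          refine mul_le_mul_right ?_ _
          refine (lintegral_mono_set fun w hw => ?_).trans (hD a ha.1 z (4 * r) (by positivity))
          exact le_of_lt (show 4 * r < rho (w⁻¹ * z) from hw)
      _ = _ := by
          have x1 : (4 * r) ^ (homDim n - (2 * n + 3)) = (4 * r)⁻¹ := by
            rw [show homDim n - (2 * n + 3) = -1 by rw [homDim]; ring,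
              Real.rpow_neg_one]
          have x2 : ENNReal.ofReal (C₂ * r ^ 3) * ENNReal.ofReal (4 * r)⁻¹
              = ENNReal.ofReal (r ^ 2) * ENNReal.ofReal (C₂ / 4) := by
            rw [← ENNReal.ofReal_mul (by positivity), ← ENNReal.ofReal_mul (by positivity)]
            congr 1
            field_simp
          rw [x1]
          calc _ = ENNReal.ofReal (C₂ * r ^ 3) * ENNReal.ofReal (4 * r)⁻¹
                * (D * maximalFn a z) := by ring
            _ = _ := by
                rw [x2]
                push_cast
                simp only [ENNReal.ofReal]
                ring
  have b2 : ‖(1 / 2 : ℂ) * ∫ w in S, a w * ((taylorTwo kernel (w⁻¹ * z) h : ℝ) : ℂ)‖ₑ ≤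
      ENNReal.ofReal (r ^ 2) * (k * truncSum a z) := by
    rw [enorm_mul]
    have h1 : ‖(1 / 2 : ℂ)‖ₑ ≤ 1 := by
      rw [← ofReal_norm]
      refine ENNReal.ofReal_le_one.2 ?_
      norm_num
    refine (mul_le_of_le_one_left zero_le h1).trans ?_
    refine (enorm_integral_taylorTwo_le ha z h (by positivity)).trans ?_
    have := rho_nonneg h
    gcongr
  simp only [e1]
  rw [integral_add i1 (i2.const_mul _), integral_const_mul]
  refine (enorm_add_le _ _).trans ((add_le_add b1 b2).trans ?_)
  rw [← mul_add]
  refine mul_le_mul_right ?_ _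
  rw [mul_add]
  gcongr
  · exact le_self_add
  · rw [ENNReal.coe_add]
    exact le_add_self

/-- The averages of `potRem` are controlled by the maximal functions of `a`. -/
theorem exists_qavg_potRem_le (hn : 1 ≤ n) {q : ℝ} (hq1 : 1 < q)
    (hq : q < ((n : ℝ) + 1) / (n : ℝ)) : ∃ C : ℝ≥0, ∀ a : Heis n → ℂ, Integrable a volume →
      (∀ᵐ v : Heis n, Integrable fun w => a w * ((kernel (w⁻¹ * v) : ℝ) : ℂ)) →
      ∀ z : Heis n, maximalFn a z ≠ ∞ → ∀ r : ℝ, 0 < r →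
        qavg q (rball z r) (potRem a z) ≤
          ENNReal.ofReal (r ^ 2) * (C * (maximalFn a z + truncSum a z)) := by
  have hq0 : 0 < q := by linarith
  obtain ⟨C₁, hC₁⟩ := exists_lintegral_near_remKernel_le hn
  obtain ⟨C₂, hC₂⟩ := exists_enorm_integral_far_remKernel_le (n := n)
  obtain ⟨C₃, hC₃⟩ := exists_Lq_kernel_conv_le hn hq1 hq
  obtain ⟨C₄, hC₄⟩ := exists_volume_inv_rpow_le (n := n) hq0
  set V := volume (rball (1 : Heis n) 1) with hV
  refine ⟨C₄ * C₃ * Real.toNNReal (5 ^ (homDim n / q - 2 * n) * 5 ^ homDim n) * V.toNNReal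
    + (C₁ + C₂), fun a ha hae z hz r hr => ?_⟩
  set A := maximalFn a z
  set T := truncSum a z
  set S : Set (Heis n) := {w | rho (w⁻¹ * z) ≤ 4 * r} with hS
  have hSm : MeasurableSet S := measurableSet_le (measurable_rho_inv_mul z) measurable_const
  have hSc : Sᶜ = {w | 4 * r < rho (w⁻¹ * z)} := by
    ext w
    simp [hS]
  set f : Heis n → ℝ≥0∞ := S.indicator fun w => ‖a w‖ₑ with hf
  have hfm : AEMeasurable f volume := ha.1.enorm.indicator hSm
  have iz : Integrable fun w => a w * ((kernel (w⁻¹ * z) : ℝ) : ℂ) :=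
    isHomog_kernel.integrable_of_maximalFn (by omega) (by omega) ha hz
  have iX : ∀ j, Integrable fun w => a w * ((fieldX j kernel (w⁻¹ * z) : ℝ) : ℂ) := fun j =>
    (isHomog_kernel.fieldX j).integrable_of_maximalFn (by omega) (by omega) ha hz
  have hpt : ∀ᵐ v, v ∈ rball z r → ‖potRem a z v‖ₑ ≤
      (∫⁻ w, f w * ENNReal.ofReal (kernel (w⁻¹ * v)))
        + ENNReal.ofReal (r ^ 2) * ((C₁ + C₂ : ℝ≥0) * (A + T)) := by
    filter_upwards [hae] with v hv hvr
    have hvr' : rho (z⁻¹ * v) ≤ r := le_of_lt (mem_rball.1 hvr)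
    have ir := integrable_remKernel hv iz iX
    rw [potRem_eq_integral hv iz iX, ← integral_add_compl hSm ir, hSc]
    refine (enorm_add_le _ _).trans ?_
    have h1 := (enorm_integral_le_lintegral_enorm _).trans (hC₁ a ha z v r hr hvr')
    have h2 := hC₂ a ha z v r hr hvr' ir
    refine (add_le_add h1 h2).trans ?_
    rw [add_assoc, ← mul_add]
    refine add_le_add_right (mul_le_mul_right ?_ _) _
    rw [ENNReal.coe_add, add_mul]
    gcongr
    exact le_self_add
  refine (qavg_le_add hq1 hr (aemeasurable_kernel_conv hfm) hpt).trans ?_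
  have hfi : ∫⁻ w, f w ≤ ENNReal.ofReal ((5 * r) ^ homDim n) * V * A := by
    rw [hf, lintegral_indicator hSm]
    have hsub : S ⊆ rball z (5 * r) := by
      rw [rball_eq_setOf]
      intro w hw
      have hw' : rho (w⁻¹ * z) ≤ 4 * r := hw
      exact (show rho (w⁻¹ * z) < 5 * r by linarith)
    refine (lintegral_mono_set hsub).trans ?_
    refine (lintegral_rball_le_maximalFn a z (by positivity)
      (mem_rball_self z (by positivity))).trans_eq ?_
    rw [volume_rball_rpow z (by positivity)]
  -- The radius is `4r` for the cut-off source plus `r` for the distance from `z` to `v`.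
  have hL := hC₃ f hfm (rball z r) (5 * r) (measurableSet_rball z r) (by positivity) (by
    intro w hw v hv
    have hwS : w ∈ S := by
      by_contra hn
      exact hw (Set.indicator_of_notMem hn _)
    have h1 : rho (w⁻¹ * z) ≤ 4 * r := hwS
    have h2 := mem_rball.1 hv
    have h3 := rho_mul_le (w⁻¹ * z) (z⁻¹ * v)
    rw [mul_assoc, mul_inv_cancel_left] at h3
    linarith)
  -- The powers of `r` add up to `-Q/q + (Q/q - 2n) + Q = 2`.
  have hX : r ^ (-(homDim n / q)) * (5 * r) ^ (homDim n / q - 2 * n) * (5 * r) ^ homDim n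
      = r ^ 2 * (5 ^ (homDim n / q - 2 * n) * 5 ^ homDim n) := by
    rw [Real.mul_rpow (by norm_num) hr.le, Real.mul_rpow (by norm_num) hr.le]
    have : r ^ 2 = r ^ (-(homDim n / q)) * r ^ (homDim n / q - 2 * n) * r ^ homDim n := by
      rw [← Real.rpow_add hr, ← Real.rpow_add hr, ← Real.rpow_natCast]
      congr 1
      rw [homDim]
      push_cast
      ring
    rw [this]
    ring
  have hmain : (volume (rball z r))⁻¹ ^ (1 / q) *
      (∫⁻ v in rball z r, (∫⁻ w, f w * ENNReal.ofReal (kernel (w⁻¹ * v))) ^ q) ^ (1 / q) ≤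
      ENNReal.ofReal (r ^ 2) * ((C₄ * C₃ * Real.toNNReal (5 ^ (homDim n / q - 2 * n) *
        5 ^ homDim n) * V.toNNReal : ℝ≥0) * A) := by
    calc _ ≤ (C₄ * ENNReal.ofReal (r ^ (-(homDim n / q)))) *
          (C₃ * ENNReal.ofReal ((5 * r) ^ (homDim n / q - 2 * n)) *
            (ENNReal.ofReal ((5 * r) ^ homDim n) * V * A)) := by
          refine mul_le_mul' (hC₄ z r hr) (hL.trans ?_)
          exact mul_le_mul_right hfi _
      _ = C₄ * C₃ * (ENNReal.ofReal (r ^ (-(homDim n / q))) *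
            ENNReal.ofReal ((5 * r) ^ (homDim n / q - 2 * n)) *
              ENNReal.ofReal ((5 * r) ^ homDim n)) * V * A := by ring
      _ = _ := by
          rw [← ENNReal.ofReal_mul (by positivity), ← ENNReal.ofReal_mul (by positivity), hX,
            ENNReal.ofReal_mul (by positivity)]
          simp only [ENNReal.coe_mul]
          rw [ENNReal.coe_toNNReal volume_rball_one_lt_top.ne]
          simp only [ENNReal.ofReal]
          ring
  refine (add_le_add_left hmain _).trans ?_
  rw [← mul_add]
  refine mul_le_mul_right ?_ _
  rw [ENNReal.coe_add (_ * _), add_mul]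
  gcongr
  exact le_self_add

end Heis

end

noncomputable section

namespace Heis

variable {n : ℕ}

/-! ### Potentials of functions with vanishing moments -/

/-- Integrable functions supported in `B(z₀, δ)`. -/
structure IsLocal (z₀ : Heis n) (δ : ℝ) (a : Heis n → ℂ) : Prop where
  pos : 0 < δ
  integrable : Integrable a volume
  support_subset : Function.support a ⊆ rball z₀ δ

/-- Integrable functions supported in `B(z₀, δ)` and orthogonal to the affine functions of the
horizontal variables. -/
structure IsCancelling (z₀ : Heis n) (δ : ℝ) (a : Heis n → ℂ) : Prop extends IsLocal z₀ δ a where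
  moment : ∀ (c : ℝ) (L : EuclideanSpace ℝ (Fin n ⊕ Fin n) →L[ℝ] ℝ),
    ∫ w, a w * ((c + L (z₀⁻¹ * w).1 : ℝ) : ℂ) = 0

theorem IsLocal.lintegral_le {z₀ : Heis n} {δ : ℝ} {a : Heis n → ℂ} (ha : IsLocal z₀ δ a)
    {g : Heis n → ℝ} {m : ℝ} (h : ∀ w ∈ rball z₀ δ, |g w| ≤ m) :
    ∫⁻ w, ‖a w * ((g w : ℝ) : ℂ)‖ₑ ≤ ENNReal.ofReal m * ∫⁻ w, ‖a w‖ₑ := by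
  rw [← lintegral_const_mul' _ _ ENNReal.ofReal_ne_top]
  refine lintegral_mono fun w => ?_
  rw [enorm_mul, mul_comm]
  by_cases hw : a w = 0
  · simp [hw]
  · refine mul_le_mul_left ?_ _
    rw [← ofReal_abs_eq_enorm]
    exact ENNReal.ofReal_le_ofReal (h w (ha.support_subset hw))

theorem IsLocal.integrable_mul {z₀ : Heis n} {δ : ℝ} {a : Heis n → ℂ} (ha : IsLocal z₀ δ a)
    {g : Heis n → ℝ} (hg : Measurable g) {m : ℝ} (h : ∀ w ∈ rball z₀ δ, |g w| ≤ m) :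
    Integrable fun w => a w * ((g w : ℝ) : ℂ) :=
  ⟨ha.integrable.1.mul (Complex.measurable_ofReal.comp hg).aestronglyMeasurable,
    (ha.lintegral_le h).trans_lt (ENNReal.mul_lt_top ENNReal.ofReal_lt_top ha.integrable.2)⟩

theorem IsLocal.integrable_affine {z₀ : Heis n} {δ : ℝ} {a : Heis n → ℂ} (ha : IsLocal z₀ δ a)
    (c : ℝ) (L : EuclideanSpace ℝ (Fin n ⊕ Fin n) →L[ℝ] ℝ) :
    Integrable fun w => a w * ((c + L (z₀⁻¹ * w).1 : ℝ) : ℂ) := by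
  refine ha.integrable_mul (m := |c| + ‖L‖ * δ) ?_ fun w hw => ?_
  · exact (continuous_const.add (L.continuous.comp (continuous_fst.comp
      (continuous_const_mul z₀⁻¹)))).measurable
  · refine (abs_add_le _ _).trans (add_le_add_right ?_ _)
    refine (L.le_opNorm _).trans ?_
    gcongr
    exact (norm_fst_le_rho _).trans (le_of_lt (mem_rball.1 hw))

/-- Cancellation against functions that are nearly affine in the horizontal variables. -/
theorem IsCancelling.enorm_integral_le {z₀ : Heis n} {δ : ℝ} {a : Heis n → ℂ}
    (ha : IsCancelling z₀ δ a) {G : Heis n → ℝ} (hG : Measurable G) {r m : ℝ} (hm : 0 ≤ m)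
    (h : AffineApprox G r m) (hr : δ ≤ r) :
    Integrable (fun w => a w * ((G (z₀⁻¹ * w) : ℝ) : ℂ)) ∧
    ‖∫ w, a w * ((G (z₀⁻¹ * w) : ℝ) : ℂ)‖ₑ ≤ ENNReal.ofReal (m * δ ^ 2) * ∫⁻ w, ‖a w‖ₑ := by
  obtain ⟨c, L, hL⟩ := h
  have hb : ∀ w ∈ rball z₀ δ, |G (z₀⁻¹ * w) - (c + L (z₀⁻¹ * w).1)| ≤ m * δ ^ 2 := by
    intro w hw
    have hw' := le_of_lt (mem_rball.1 hw)
    have := rho_nonneg (z₀⁻¹ * w)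
    refine (hL _ (hw'.trans hr)).trans ?_
    gcongr
  have hmeas : Measurable fun w : Heis n => G (z₀⁻¹ * w) - (c + L (z₀⁻¹ * w).1) :=
    (hG.comp (measurable_const_mul z₀⁻¹)).sub (continuous_const.add (L.continuous.comp
      (continuous_fst.comp (continuous_const_mul z₀⁻¹)))).measurable
  have i1 := ha.toIsLocal.integrable_mul hmeas hb
  have i2 := ha.toIsLocal.integrable_affine c L
  have e : (fun w => a w * ((G (z₀⁻¹ * w) : ℝ) : ℂ)) = fun w =>
      a w * ((G (z₀⁻¹ * w) - (c + L (z₀⁻¹ * w).1) : ℝ) : ℂ)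
        + a w * ((c + L (z₀⁻¹ * w).1 : ℝ) : ℂ) := by
    funext w
    push_cast
    ring
  rw [e]
  refine ⟨i1.add i2, ?_⟩
  rw [integral_add i1 i2, ha.moment, add_zero]
  exact (enorm_integral_le_lintegral_enorm _).trans (ha.toIsLocal.lintegral_le hb)

theorem measurable_taylorOne (h : Heis n) :
    Measurable fun u : Heis n => taylorOne kernel u h := by
  unfold taylorOne
  exact Finset.measurable_fun_sum _ fun j _ =>
    measurable_const.mul (isHomog_kernel.fieldX j).measurable

/-- After translating the ball to the identity, the moments remove the affine part of the kernel and
leave the factor `(δ/ρ(z₀⁻¹z))²`. It is applied to `ρ^{-2n}` and to the `X_j ρ^{-2n}`. -/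
theorem IsHomog.exists_enorm_integral_le {d : ℕ} {f : Heis n → ℝ} (hf : IsHomog d f) :
    ∃ C : ℝ, 0 ≤ C ∧ ∀ (z₀ : Heis n) (δ : ℝ) (a : Heis n → ℂ), IsCancelling z₀ δ a →
      ∀ z : Heis n, 4 * δ ≤ rho (z₀⁻¹ * z) →
        Integrable (fun w => a w * ((f (w⁻¹ * z) : ℝ) : ℂ)) ∧
        ‖∫ w, a w * ((f (w⁻¹ * z) : ℝ) : ℂ)‖ₑ ≤
          ENNReal.ofReal (C * (rho (z₀⁻¹ * z) ^ (d + 2))⁻¹ * δ ^ 2) * ∫⁻ w, ‖a w‖ₑ := by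
  obtain ⟨C, hC0, hC⟩ := hf.exists_affineApprox
  refine ⟨C, hC0, fun z₀ δ a ha z hz => ?_⟩
  have hδ := ha.pos
  have hu : z₀⁻¹ * z ≠ 0 := ne_zero_of_rho_pos (by linarith)
  have h0 := rho_nonneg (z₀⁻¹ * z)
  have := ha.enorm_integral_le (G := fun w => f (w⁻¹ * (z₀⁻¹ * z))) (hf.measurable.comp
    (by fun_prop)) (by positivity) (hC _ hu) (by linarith)
  have e : ∀ w : Heis n, (z₀⁻¹ * w)⁻¹ * (z₀⁻¹ * z) = w⁻¹ * z := fun w => by group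
  simp only [e] at this
  exact this

/-- The mixed expansion with `u = z₀⁻¹z` and `h = z⁻¹v`: here `a` is tested against the whole Taylor
remainder at once, so the smallness in both variables is retained. -/
theorem exists_enorm_potRem_le : ∃ C : ℝ, 0 ≤ C ∧ ∀ (z₀ : Heis n) (δ : ℝ) (a : Heis n → ℂ),
    IsCancelling z₀ δ a → ∀ z : Heis n, 4 * δ ≤ rho (z₀⁻¹ * z) → ∀ v : Heis n,
      rho (z⁻¹ * v) ≤ rho (z₀⁻¹ * z) / 4 →
      (Integrable fun w => a w * ((kernel (w⁻¹ * v) : ℝ) : ℂ)) →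
        ‖potRem a z v‖ₑ ≤ ENNReal.ofReal (C * rho (z⁻¹ * v) ^ 2 *
          (rho (z₀⁻¹ * z) ^ (2 * n + 4))⁻¹ * δ ^ 2) * ∫⁻ w, ‖a w‖ₑ := by
  obtain ⟨C, hC0, hC⟩ := (isHomog_kernel (n := n)).exists_affineApprox_mixed
  obtain ⟨_, _, hK⟩ := (isHomog_kernel (n := n)).exists_enorm_integral_le
  choose _ _ hX using fun j => ((isHomog_kernel (n := n)).fieldX j).exists_enorm_integral_le
  refine ⟨C, hC0, fun z₀ δ a ha z hz v hv hvi => ?_⟩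
  have hδ := ha.pos
  have hu : z₀⁻¹ * z ≠ 0 := ne_zero_of_rho_pos (by linarith)
  have h0 := rho_nonneg (z₀⁻¹ * z)
  rw [potRem_eq_integral hvi (hK z₀ δ a ha z hz).1 fun j => (hX j z₀ δ a ha z hz).1]
  have := (ha.enorm_integral_le (G := fun w => kernel (w⁻¹ * (z₀⁻¹ * z) * (z⁻¹ * v))
    - kernel (w⁻¹ * (z₀⁻¹ * z)) - taylorOne kernel (w⁻¹ * (z₀⁻¹ * z)) (z⁻¹ * v)) ?_ ?_
    (hC _ hu _ hv) (by linarith)).2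
  · have e : ∀ w : Heis n, (z₀⁻¹ * w)⁻¹ * (z₀⁻¹ * z) = w⁻¹ * z := fun w => by group
    have e' : ∀ w : Heis n, w⁻¹ * z * (z⁻¹ * v) = w⁻¹ * v := fun w => by group
    simp only [e, e'] at this
    exact this
  · refine Measurable.sub (Measurable.sub (measurable_kernel.comp (by fun_prop))
      (measurable_kernel.comp (by fun_prop))) ?_
    exact (measurable_taylorOne _).comp (by fun_prop)
  · positivity

/-! ### Integrability of the potential -/

theorem aestronglyMeasurable_pot_integrand {a : Heis n → ℂ} (ha : AEStronglyMeasurable a volume) :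
    AEStronglyMeasurable (fun p : Heis n × Heis n => a p.2 * ((kernel (p.2⁻¹ * p.1) : ℝ) : ℂ))
      ((volume : Measure (Heis n)).prod volume) :=
  ha.comp_snd.mul (Complex.measurable_ofReal.comp
    (measurable_kernel.comp (by fun_prop))).aestronglyMeasurable

theorem aestronglyMeasurable_pot {a : Heis n → ℂ} (ha : AEStronglyMeasurable a volume) :
    AEStronglyMeasurable (pot a) volume :=
  (aestronglyMeasurable_pot_integrand ha).integral_prod_right'

theorem enorm_mul_kernel (c : ℂ) (u : Heis n) :
    ‖c * ((kernel u : ℝ) : ℂ)‖ₑ = ‖c‖ₑ * ENNReal.ofReal (kernel u) := by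
  rw [enorm_mul, ← ofReal_abs_eq_enorm, abs_of_nonneg (kernel_nonneg u)]

theorem enorm_pot_le (a : Heis n → ℂ) (v : Heis n) :
    ‖pot a v‖ₑ ≤ ∫⁻ w, ‖a w‖ₑ * ENNReal.ofReal (kernel (w⁻¹ * v)) := by
  refine (enorm_integral_le_lintegral_enorm _).trans_eq ?_
  simp only [enorm_mul_kernel]

theorem IsLocal.rho_lt {z₀ : Heis n} {δ : ℝ} {a : Heis n → ℂ} (ha : IsLocal z₀ δ a) {r : ℝ}
    {w : Heis n} (hw : ‖a w‖ₑ ≠ 0) {v : Heis n} (hv : v ∈ rball z₀ r) :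
    rho (w⁻¹ * v) < δ + r := by
  have h1 : w ∈ rball z₀ δ := ha.support_subset (by simpa using hw)
  have h2 := rho_mul_le (w⁻¹ * z₀) (z₀⁻¹ * v)
  rw [mul_assoc, mul_inv_cancel_left] at h2
  rw [mem_rball, rho_inv_mul_comm] at h1
  have h3 := mem_rball.1 hv
  linarith

theorem IsLocal.lintegral_kernel_conv_lt_top (hn : 1 ≤ n) {q : ℝ} (hq1 : 1 < q)
    (hq : q < ((n : ℝ) + 1) / (n : ℝ)) {z₀ : Heis n} {δ : ℝ} {a : Heis n → ℂ}
    (ha : IsLocal z₀ δ a) {r : ℝ} (hr : 0 < r) :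
    ∫⁻ v in rball z₀ r, (∫⁻ w, ‖a w‖ₑ * ENNReal.ofReal (kernel (w⁻¹ * v))) ^ q < ∞ := by
  obtain ⟨C, hC⟩ := exists_lintegral_kernel_conv_le hn hq1 hq
  refine (hC (fun w => ‖a w‖ₑ) ha.integrable.1.enorm (rball z₀ r) (δ + r) (measurableSet_rball _ _)
    (add_pos ha.pos hr) fun w hw v hv => ha.rho_lt hw hv).trans_lt ?_
  exact ENNReal.mul_lt_top (ENNReal.mul_lt_top ENNReal.coe_lt_top ENNReal.ofReal_lt_top)
    (ENNReal.rpow_lt_top_of_nonneg (by linarith) ha.integrable.2.ne)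

theorem exists_mem_rball (z₀ v : Heis n) : ∃ k : ℕ, v ∈ rball z₀ (k + 1) := by
  obtain ⟨k, hk⟩ := exists_nat_gt (rho (z₀⁻¹ * v))
  exact ⟨k, mem_rball.2 (by linarith)⟩

theorem exists_rball_of_isCompact (z₀ : Heis n) {K : Set (Heis n)} (hK : IsCompact K) :
    ∃ r : ℝ, 0 < r ∧ K ⊆ rball z₀ r := by
  obtain ⟨C, hC⟩ := hK.exists_bound_of_continuousOn
    (f := fun v : Heis n => rho (z₀⁻¹ * v)) (continuous_rho.comp
      (continuous_const_mul z₀⁻¹)).continuousOn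
  refine ⟨max C 0 + 1, by positivity, fun v hv => mem_rball.2 ?_⟩
  have := (le_abs_self _).trans (hC v hv)
  have := le_max_left C 0
  linarith

/-- The convolution of `|a|` with the kernel is in `L^q` of every ball around `z₀`, hence finite
almost everywhere there, and countably many balls cover the group. -/
theorem IsLocal.ae_integrable (hn : 1 ≤ n) {z₀ : Heis n} {δ : ℝ} {a : Heis n → ℂ}
    (ha : IsLocal z₀ δ a) :
    ∀ᵐ v : Heis n, Integrable fun w => a w * ((kernel (w⁻¹ * v) : ℝ) : ℂ) := by
  have hn' : (0 : ℝ) < n := by exact_mod_cast hn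
  -- Any auxiliary exponent in `(1, (n+1)/n)` will do.
  obtain ⟨q, hq1, hq⟩ : ∃ q : ℝ, 1 < q ∧ q < ((n : ℝ) + 1) / n :=
    exists_between (by rw [one_lt_div hn']; linarith)
  have h1 : ∀ k : ℕ, ∀ᵐ v : Heis n, v ∈ rball z₀ (k + 1) →
      (∫⁻ w, ‖a w‖ₑ * ENNReal.ofReal (kernel (w⁻¹ * v))) ^ q < ∞ := fun k => by
    rw [← ae_restrict_iff' (measurableSet_rball _ _)]
    refine ae_lt_top' ?_ (ha.lintegral_kernel_conv_lt_top hn hq1 hq (by positivity)).ne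
    exact ((aemeasurable_kernel_conv ha.integrable.1.enorm).pow_const q).restrict
  filter_upwards [ae_all_iff.2 h1] with v hv
  obtain ⟨k, hk⟩ := exists_mem_rball z₀ v
  refine ⟨isHomog_kernel.aestronglyMeasurable_mul ha.integrable.1 v, ?_⟩
  have := hv k hk
  rw [ENNReal.rpow_lt_top_iff_of_pos (by linarith)] at this
  simpa only [HasFiniteIntegral, enorm_mul_kernel] using this

theorem IsLocal.memLqLoc_pot (hn : 1 ≤ n) {q : ℝ} (hq1 : 1 < q)
    (hq : q < ((n : ℝ) + 1) / (n : ℝ)) {z₀ : Heis n} {δ : ℝ} {a : Heis n → ℂ}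
    (ha : IsLocal z₀ δ a) : MemLqLoc q (pot a) := by
  have hq0 : 0 < q := by linarith
  refine ⟨aestronglyMeasurable_pot ha.integrable.1, fun K hK => ?_⟩
  obtain ⟨r, hr, hKr⟩ := exists_rball_of_isCompact z₀ hK
  refine ⟨(aestronglyMeasurable_pot ha.integrable.1).restrict, ?_⟩
  rw [eLpNorm_lt_top_iff_lintegral_rpow_enorm_lt_top (by simpa using hq0) ENNReal.ofReal_ne_top,
    ENNReal.toReal_ofReal hq0.le]
  refine lt_of_le_of_lt ?_ (ha.lintegral_kernel_conv_lt_top hn hq1 hq hr)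
  refine (lintegral_mono_set hKr).trans (lintegral_mono fun v => ?_)
  exact ENNReal.rpow_le_rpow (enorm_pot_le a v) hq0.le

/-! ### The estimate away from the support -/

/-- On `B(z₀, 4δ)` the Young-type bound applies. Outside, cancellation improves the decay from
`ρ^{-2n}` to `ρ^{-Q}`, whose `q`-th power is integrable at infinity because `q > 1`. -/
theorem exists_Lq_pot_le (hn : 1 ≤ n) {q : ℝ} (hq1 : 1 < q)
    (hq : q < ((n : ℝ) + 1) / (n : ℝ)) : ∃ C : ℝ≥0, ∀ (z₀ : Heis n) (δ : ℝ) (a : Heis n → ℂ),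
      IsCancelling z₀ δ a → (∫⁻ v, ‖pot a v‖ₑ ^ q) ^ (1 / q) ≤
        C * ENNReal.ofReal (δ ^ (homDim n / q - 2 * n)) * ∫⁻ w, ‖a w‖ₑ := by
  have hq0 : 0 < q := by linarith
  have hQ := homDim_pos (n := n)
  obtain ⟨C₁, hC₁⟩ := exists_Lq_kernel_conv_le hn hq1 hq
  obtain ⟨C₂, hC₂0, hC₂⟩ := (isHomog_kernel (n := n)).exists_enorm_integral_le
  obtain ⟨C₃, hC₃⟩ := exists_lintegral_rho_far_le (n := n) (s := homDim n * q) (by positivity)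
    (lt_mul_of_one_lt_right hQ hq1)
  refine ⟨C₁ * Real.toNNReal (5 ^ (homDim n / q - 2 * n)) + Real.toNNReal C₂ * C₃ ^ (1 / q) *
    Real.toNNReal (4 ^ (homDim n / q - homDim n)), fun z₀ δ a ha => ?_⟩
  have hδ := ha.pos
  set α := ∫⁻ w, ‖a w‖ₑ
  set S := rball z₀ (4 * δ)
  have hS : MeasurableSet S := measurableSet_rball _ _
  rw [← lintegral_add_compl _ hS]
  refine (ENNReal.rpow_add_le_add_rpow _ _ (by positivity) (by
    rw [div_le_one hq0]; exact hq1.le)).trans ?_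
  have b1 : (∫⁻ v in S, ‖pot a v‖ₑ ^ q) ^ (1 / q) ≤ (C₁ * Real.toNNReal (5 ^ (homDim n / q - 2 * n)) :
      ℝ≥0) * ENNReal.ofReal (δ ^ (homDim n / q - 2 * n)) * α := by
    have h1 := hC₁ (fun w => ‖a w‖ₑ) ha.integrable.1.enorm S (5 * δ) hS (by positivity)
      fun w hw v hv => (ha.toIsLocal.rho_lt hw hv).trans_eq (by ring)
    refine le_trans (ENNReal.rpow_le_rpow (lintegral_mono fun v => ENNReal.rpow_le_rpow
      (enorm_pot_le a v) hq0.le) (by positivity)) (h1.trans_eq ?_)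
    rw [Real.mul_rpow (by norm_num) hδ.le, ENNReal.ofReal_mul (by positivity), ENNReal.coe_mul]
    simp only [ENNReal.ofReal]
    ring
  have b2 : (∫⁻ v in Sᶜ, ‖pot a v‖ₑ ^ q) ^ (1 / q) ≤ (Real.toNNReal C₂ * C₃ ^ (1 / q) *
      Real.toNNReal (4 ^ (homDim n / q - homDim n)) : ℝ≥0)
        * ENNReal.ofReal (δ ^ (homDim n / q - 2 * n)) * α := by
    have h1 : ∀ v ∈ Sᶜ, ‖pot a v‖ₑ ^ q ≤ (ENNReal.ofReal (C₂ * δ ^ 2) * α) ^ q *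
        ENNReal.ofReal (rho (z₀⁻¹ * v) ^ (-(homDim n * q))) := by
      intro v hv
      have hv' : 4 * δ ≤ rho (z₀⁻¹ * v) := not_lt.1 fun h => hv (mem_rball.2 h)
      have h0 := rho_nonneg (z₀⁻¹ * v)
      have h2 := (hC₂ z₀ δ a ha v hv').2
      have h3 : C₂ * (rho (z₀⁻¹ * v) ^ (2 * n + 2))⁻¹ * δ ^ 2
          = C₂ * δ ^ 2 * rho (z₀⁻¹ * v) ^ (-homDim n) := by
        rw [inv_pow_eq_rpow, homDim]
        push_cast
        ring
      rw [h3, ENNReal.ofReal_mul (by positivity)] at h2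
      refine (ENNReal.rpow_le_rpow h2 hq0.le).trans_eq ?_
      rw [mul_right_comm, ENNReal.mul_rpow_of_nonneg _ _ hq0.le,
        ENNReal.ofReal_rpow_of_nonneg (by positivity) hq0.le, ← Real.rpow_mul h0, neg_mul]
    have h2 : ∫⁻ v in Sᶜ, ENNReal.ofReal (rho (z₀⁻¹ * v) ^ (-(homDim n * q))) ≤
        C₃ * ENNReal.ofReal ((4 * δ) ^ (homDim n - homDim n * q)) := by
      refine le_trans (le_of_eq ?_) (hC₃ (4 * δ) (by positivity))
      rw [← lintegral_indicator hS.compl,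
        ← lintegral_indicator (measurableSet_le measurable_const measurable_rho),
        ← lintegral_mul_left_eq_self (Set.indicator {u : Heis n | 4 * δ ≤ rho u} _) z₀⁻¹]
      refine lintegral_congr fun v => ?_
      by_cases hv : 4 * δ ≤ rho (z₀⁻¹ * v)
      · have hv1 : v ∈ Sᶜ := fun h => absurd (mem_rball.1 h) (not_lt.2 hv)
        have hv2 : z₀⁻¹ * v ∈ {u : Heis n | 4 * δ ≤ rho u} := hv
        rw [Set.indicator_of_mem hv1, Set.indicator_of_mem hv2]
      · have hv1 : v ∉ Sᶜ := fun h => h (mem_rball.2 (not_le.1 hv))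
        have hv2 : z₀⁻¹ * v ∉ {u : Heis n | 4 * δ ≤ rho u} := hv
        rw [Set.indicator_of_notMem hv1, Set.indicator_of_notMem hv2]
    have h3 : ∫⁻ v in Sᶜ, ‖pot a v‖ₑ ^ q ≤ (ENNReal.ofReal (C₂ * δ ^ 2) * α) ^ q *
        (C₃ * ENNReal.ofReal ((4 * δ) ^ (homDim n - homDim n * q))) := by
      refine (setLIntegral_mono' hS.compl h1).trans ?_
      rw [lintegral_const_mul' _ _ (ENNReal.rpow_ne_top_of_nonneg hq0.le
        (ENNReal.mul_ne_top ENNReal.ofReal_ne_top ha.integrable.2.ne))]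
      exact mul_le_mul_right h2 _
    refine (ENNReal.rpow_le_rpow h3 (by positivity)).trans_eq ?_
    -- The exponents of `δ` match because `Q/q - Q + 2 = Q/q - 2n`.
    have hexp : (4 * δ) ^ ((homDim n - homDim n * q) * (1 / q)) * δ ^ 2 =
        4 ^ (homDim n / q - homDim n) * δ ^ (homDim n / q - 2 * n) := by
      have e1 : (homDim n - homDim n * q) * (1 / q) = homDim n / q - homDim n := by field_simp
      rw [e1, Real.mul_rpow (by norm_num) hδ.le, mul_assoc]
      congr 1
      rw [← Real.rpow_natCast, ← Real.rpow_add hδ]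
      congr 1
      rw [homDim]
      push_cast
      ring
    rw [ENNReal.mul_rpow_of_nonneg _ _ (by positivity), ← ENNReal.rpow_mul,
      mul_one_div_cancel hq0.ne', ENNReal.rpow_one, ENNReal.mul_rpow_of_nonneg _ _ (by positivity),
      ENNReal.ofReal_rpow_of_pos (by positivity), ← Real.rpow_mul (by positivity),
      ENNReal.ofReal_mul hC₂0]
    calc _ = ENNReal.ofReal C₂ * (C₃ : ℝ≥0∞) ^ (1 / q) * (ENNReal.ofReal ((4 * δ) ^
          ((homDim n - homDim n * q) * (1 / q))) * ENNReal.ofReal (δ ^ 2)) * α := by ring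
      _ = _ := by
          rw [← ENNReal.ofReal_mul (by positivity), hexp, ENNReal.ofReal_mul (by positivity),
            ENNReal.coe_mul, ENNReal.coe_mul, ENNReal.coe_rpow_of_nonneg _ (by positivity)]
          simp only [ENNReal.ofReal]
          ring
  refine (add_le_add b1 b2).trans_eq ?_
  rw [ENNReal.coe_add]
  ring

theorem enorm_potRem_le (a : Heis n → ℂ) (z v : Heis n) : ‖potRem a z v‖ₑ ≤ ‖pot a v‖ₑ +
    (‖pot a z‖ₑ + ∑ j, ‖potX a j z‖ₑ * ENNReal.ofReal (rho (z⁻¹ * v))) := by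
  rw [potRem]
  refine enorm_sub_le.trans (add_le_add_right ?_ _)
  refine (enorm_add_le _ _).trans (add_le_add_right ?_ _)
  refine (enorm_sum_le _ _).trans (Finset.sum_le_sum fun j _ => ?_)
  rw [enorm_mul, ← ofReal_abs_eq_enorm, ← inv_mul_fst]
  exact mul_le_mul_right (ENNReal.ofReal_le_ofReal (abs_fst_le_rho _ j)) _

/-- The coefficients decay like `l^{-(2n+2)}` and `l^{-(2n+3)}`. As `l ≤ 4r`, the missing powers of
`l` are traded for powers of `r`, which gives the same form as the bound for `potRem`; this produces
the factors `16` and `4`. -/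
theorem exists_enorm_affine_le : ∃ C : ℝ, 0 ≤ C ∧ ∀ (z₀ : Heis n) (δ : ℝ) (a : Heis n → ℂ),
    IsCancelling z₀ δ a → ∀ z : Heis n, 4 * δ ≤ rho (z₀⁻¹ * z) → ∀ r : ℝ,
      rho (z₀⁻¹ * z) ≤ 4 * r →
        ‖pot a z‖ₑ + ∑ j, ‖potX a j z‖ₑ * ENNReal.ofReal r ≤
          ENNReal.ofReal (C * r ^ 2 * (rho (z₀⁻¹ * z) ^ (2 * n + 4))⁻¹ * δ ^ 2)
            * ∫⁻ w, ‖a w‖ₑ := by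
  obtain ⟨C, hC0, hC⟩ := (isHomog_kernel (n := n)).exists_enorm_integral_le
  choose D hD0 hD using fun j => ((isHomog_kernel (n := n)).fieldX j).exists_enorm_integral_le
  have hDs : 0 ≤ ∑ j, D j := Finset.sum_nonneg fun j _ => hD0 j
  refine ⟨C * 16 + (∑ j, D j) * 4, by positivity, fun z₀ δ a ha z hz r hr => ?_⟩
  have hδ := ha.pos
  set l := rho (z₀⁻¹ * z)
  have hl : 0 < l := by linarith
  have hr0 : 0 < r := by linarith
  have b1 : ‖pot a z‖ₑ ≤ ENNReal.ofReal (C * 16 * (r ^ 2 * (l ^ (2 * n + 4))⁻¹ * δ ^ 2))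
      * ∫⁻ w, ‖a w‖ₑ := by
    refine ((hC z₀ δ a ha z hz).2).trans (mul_le_mul_left (ENNReal.ofReal_le_ofReal ?_) _)
    have e : (l ^ (2 * n + 2))⁻¹ = l ^ 2 * (l ^ (2 * n + 4))⁻¹ := by
      rw [show 2 * n + 4 = 2 * n + 2 + 2 by ring, pow_add _ (2 * n + 2)]
      field_simp
    rw [e]
    have : l ^ 2 ≤ (4 * r) ^ 2 := pow_le_pow_left₀ hl.le hr 2
    calc C * (l ^ 2 * (l ^ (2 * n + 4))⁻¹) * δ ^ 2
        ≤ C * ((4 * r) ^ 2 * (l ^ (2 * n + 4))⁻¹) * δ ^ 2 := by gcongr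
      _ = _ := by ring
  have b2 : ∀ j, ‖potX a j z‖ₑ * ENNReal.ofReal r ≤
      ENNReal.ofReal (D j * 4 * (r ^ 2 * (l ^ (2 * n + 4))⁻¹ * δ ^ 2)) * ∫⁻ w, ‖a w‖ₑ := fun j => by
    refine (mul_le_mul_left (hD j z₀ δ a ha z hz).2 _).trans ?_
    rw [mul_right_comm, ← ENNReal.ofReal_mul (by have := hD0 j; positivity)]
    refine mul_le_mul_left (ENNReal.ofReal_le_ofReal ?_) _
    have e : (l ^ (2 * n + 1 + 2))⁻¹ = l * (l ^ (2 * n + 4))⁻¹ := by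
      rw [show 2 * n + 4 = 2 * n + 1 + 2 + 1 by ring, pow_succ _ (2 * n + 1 + 2)]
      field_simp
    rw [e]
    have := hD0 j
    calc D j * (l * (l ^ (2 * n + 4))⁻¹) * δ ^ 2 * r
        ≤ D j * ((4 * r) * (l ^ (2 * n + 4))⁻¹) * δ ^ 2 * r := by gcongr
      _ = _ := by ring
  refine (add_le_add b1 (Finset.sum_le_sum fun j _ => b2 j)).trans_eq ?_
  rw [← Finset.sum_mul, ← ENNReal.ofReal_sum_of_nonneg fun j _ => by have := hD0 j; positivity,
    ← add_mul, ← ENNReal.ofReal_add (by positivity) (Finset.sum_nonneg fun j _ => by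
      have := hD0 j; positivity)]
  congr 2
  rw [← Finset.sum_mul, ← Finset.sum_mul]
  ring

/-- The averages of `potRem` at points away from the support of a cancelling function. -/
theorem exists_qavg_potRem_le_of_isCancelling (hn : 1 ≤ n) {q : ℝ} (hq1 : 1 < q)
    (hq : q < ((n : ℝ) + 1) / (n : ℝ)) : ∃ C : ℝ≥0, ∀ (z₀ : Heis n) (δ : ℝ) (a : Heis n → ℂ),
      IsCancelling z₀ δ a → ∀ z : Heis n, 4 * δ ≤ rho (z₀⁻¹ * z) → ∀ r : ℝ, 0 < r →
        qavg q (rball z r) (potRem a z) ≤ ENNReal.ofReal (r ^ 2) *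
          (C * ENNReal.ofReal (δ ^ (-homDim n) *
            (δ / rho (z₀⁻¹ * z)) ^ (2 + homDim n / q)) * ∫⁻ w, ‖a w‖ₑ) := by
  have hq0 : 0 < q := by linarith
  have hQ := homDim_pos (n := n)
  obtain ⟨C₁, hC₁0, hC₁⟩ := exists_enorm_potRem_le (n := n)
  obtain ⟨C₂, hC₂0, hC₂⟩ := exists_enorm_affine_le (n := n)
  obtain ⟨C₃, hC₃⟩ := exists_Lq_pot_le hn hq1 hq
  obtain ⟨C₄, hC₄⟩ := exists_volume_inv_rpow_le (n := n) hq0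
  refine ⟨C₄ * C₃ * Real.toNNReal (4 ^ (2 + homDim n / q)) + Real.toNNReal (C₁ + C₂),
    fun z₀ δ a ha z hz r hr => ?_⟩
  have hδ := ha.pos
  set l := rho (z₀⁻¹ * z)
  have hl : 0 < l := by linarith
  set α := ∫⁻ w, ‖a w‖ₑ
  set X := δ ^ (-homDim n) * (δ / l) ^ (2 + homDim n / q) with hX
  have hX0 : 0 ≤ X := by positivity
  -- The left side is `δ^{-Q} (δ/l)^{2+Q}`. As `δ/l ≤ 1`, lowering the exponent to `2 + Q/q` only
  -- increases it.
  have hXle : (l ^ (2 * n + 4))⁻¹ * δ ^ 2 ≤ X := by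
    have e : (l ^ (2 * n + 4))⁻¹ * δ ^ 2 = δ ^ (-homDim n) * (δ / l) ^ (2 + homDim n) := by
      rw [inv_eq_one_div, ← Real.rpow_natCast, ← Real.rpow_natCast, Real.div_rpow hδ.le hl.le,
        mul_div_assoc', ← Real.rpow_add hδ, one_div, inv_mul_eq_div]
      congr 2
      · push_cast; ring
      · rw [homDim]; push_cast; ring
    rw [e, hX]
    refine mul_le_mul_of_nonneg_left ?_ (by positivity)
    refine Real.rpow_le_rpow_of_exponent_ge (by positivity) ?_ ?_
    · rw [div_le_one hl]; linarith
    · have : homDim n / q ≤ homDim n := div_le_self hQ.le hq1.le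
      linarith
  have hc : ∀ C : ℝ, 0 ≤ C → ENNReal.ofReal (C * r ^ 2 * (l ^ (2 * n + 4))⁻¹ * δ ^ 2) * α ≤
      ENNReal.ofReal (r ^ 2) * (Real.toNNReal C * ENNReal.ofReal X * α) := by
    intro C hC
    calc _ ≤ ENNReal.ofReal (r ^ 2 * (C * X)) * α := by
          refine mul_le_mul_left (ENNReal.ofReal_le_ofReal ?_) _
          calc _ = r ^ 2 * (C * ((l ^ (2 * n + 4))⁻¹ * δ ^ 2)) := by ring
            _ ≤ _ := by gcongr
      _ = _ := by
          rw [ENNReal.ofReal_mul (by positivity), ENNReal.ofReal_mul hC, mul_assoc]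
          rfl
  have hmono : ∀ {c : ℝ≥0}, c ≤ C₄ * C₃ * Real.toNNReal (4 ^ (2 + homDim n / q)) +
      Real.toNNReal (C₁ + C₂) → ENNReal.ofReal (r ^ 2) * (c * ENNReal.ofReal X * α) ≤
      ENNReal.ofReal (r ^ 2) * ((C₄ * C₃ * Real.toNNReal (4 ^ (2 + homDim n / q)) +
        Real.toNNReal (C₁ + C₂) : ℝ≥0) * ENNReal.ofReal X * α) := by
    intro c hc
    gcongr
  -- Small balls stay away from the support and the mixed expansion is uniform on them. Large balls
  -- may meet the support, so there the potential and its affine part are bounded separately.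
  rcases le_or_gt r (l / 4) with hrl | hrl
  · refine (qavg_le_add hq1 hr (N := fun _ => 0) aemeasurable_const
      (c := ENNReal.ofReal (C₁ * r ^ 2 * (l ^ (2 * n + 4))⁻¹ * δ ^ 2) * α) ?_).trans ?_
    · filter_upwards [ha.toIsLocal.ae_integrable hn] with v hv hvr
      have hvr' := le_of_lt (mem_rball.1 hvr)
      rw [zero_add]
      refine (hC₁ z₀ δ a ha z hz v (hvr'.trans hrl) hv).trans ?_
      refine mul_le_mul_left (ENNReal.ofReal_le_ofReal ?_) _
      have := rho_nonneg (z⁻¹ * v)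
      gcongr
    · rw [ENNReal.zero_rpow_of_pos hq0, lintegral_zero, ENNReal.zero_rpow_of_pos (by positivity),
        mul_zero, zero_add]
      refine (hc C₁ hC₁0).trans (hmono ?_)
      exact le_trans (Real.toNNReal_mono (by linarith)) le_add_self
  · refine (qavg_le_add hq1 hr (N := fun v => ‖pot a v‖ₑ)
      (aestronglyMeasurable_pot ha.integrable.1).enorm
      (c := ENNReal.ofReal (C₂ * r ^ 2 * (l ^ (2 * n + 4))⁻¹ * δ ^ 2) * α) ?_).trans ?_
    · refine Filter.Eventually.of_forall fun v hvr => ?_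
      have hvr' := le_of_lt (mem_rball.1 hvr)
      refine (enorm_potRem_le a z v).trans (add_le_add_right ?_ _)
      refine le_trans ?_ (hC₂ z₀ δ a ha z hz r (by linarith))
      gcongr
    · have b1 : (volume (rball z r))⁻¹ ^ (1 / q) *
          (∫⁻ v in rball z r, ‖pot a v‖ₑ ^ q) ^ (1 / q) ≤
          ENNReal.ofReal (r ^ 2) * ((C₄ * C₃ * Real.toNNReal (4 ^ (2 + homDim n / q)) : ℝ≥0) *
            ENNReal.ofReal X * α) := by
        have h1 : (∫⁻ v in rball z r, ‖pot a v‖ₑ ^ q) ^ (1 / q) ≤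
            C₃ * ENNReal.ofReal (δ ^ (homDim n / q - 2 * n)) * α :=
          (ENNReal.rpow_le_rpow (setLIntegral_le_lintegral _ _) (by positivity)).trans
            (hC₃ z₀ δ a ha)
        -- After splitting off `r²`, the remaining negative power of `r` is at most the same power
        -- of `l/4`; this is where `r > l/4` is used.
        have h2 : r ^ (-(homDim n / q)) * δ ^ (homDim n / q - 2 * n) ≤
            r ^ 2 * (4 ^ (2 + homDim n / q) * X) := by
          have e1 : r ^ (-(homDim n / q)) = r ^ 2 * r ^ (-(2 + homDim n / q)) := by
            rw [← Real.rpow_natCast, ← Real.rpow_add hr]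
            congr 1
            push_cast
            ring
          have e2 : 4 ^ (2 + homDim n / q) * X =
              (l / 4) ^ (-(2 + homDim n / q)) * δ ^ (homDim n / q - 2 * n) := by
            rw [hX, Real.div_rpow hδ.le hl.le, Real.rpow_neg (x := l / 4) (by positivity),
              Real.div_rpow hl.le (by norm_num), inv_div]
            have e3 : δ ^ (homDim n / q - 2 * n) = δ ^ (-homDim n) * δ ^ (2 + homDim n / q) := by
              rw [← Real.rpow_add hδ]
              congr 1
              rw [homDim]
              ring
            rw [e3]
            ring
          rw [e1, e2, mul_assoc]
          refine mul_le_mul_of_nonneg_left (mul_le_mul_of_nonneg_right ?_ (by positivity))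
            (by positivity)
          exact Real.rpow_le_rpow_of_nonpos (by positivity) hrl.le
            (neg_nonpos.2 (by positivity))
        calc _ ≤ (C₄ * ENNReal.ofReal (r ^ (-(homDim n / q)))) *
              (C₃ * ENNReal.ofReal (δ ^ (homDim n / q - 2 * n)) * α) :=
              mul_le_mul' (hC₄ z r hr) h1
          _ = C₄ * C₃ * ENNReal.ofReal (r ^ (-(homDim n / q)) * δ ^ (homDim n / q - 2 * n)) * α := by
              rw [ENNReal.ofReal_mul (by positivity)]
              ring
          _ ≤ C₄ * C₃ * ENNReal.ofReal (r ^ 2 * (4 ^ (2 + homDim n / q) * X)) * α := by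
              gcongr
          _ = _ := by
              rw [ENNReal.ofReal_mul (by positivity), ENNReal.ofReal_mul (by positivity),
                ENNReal.coe_mul, ENNReal.coe_mul]
              simp only [ENNReal.ofReal]
              ring
      refine (add_le_add b1 ((hc C₂ hC₂0).trans (mul_le_mul_right (mul_le_mul_left
        (mul_le_mul_left (ENNReal.coe_le_coe.2 (Real.toNNReal_mono (by linarith :
          C₂ ≤ C₁ + C₂))) _) _) _))).trans_eq ?_
      rw [ENNReal.coe_add]
      ring

end Heis

end

noncomputable section

namespace Heis

variable {n : ℕ}

/-! ### Atoms -/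

/-- Hölder's inequality on the ball: the exponents `1/p₀ - 1/p` and `1 - 1/p₀` add to `1 - 1/p`. For
`p₀ = ∞` both occurrences of `1/p₀` evaluate to zero. -/
theorem IsAtom.lintegral_le {p : ℝ} {p₀ : ℝ≥0∞} (hp₀ : 1 < p₀) {N : ℕ} {z₀ : Heis n} {δ : ℝ}
    (hδ : 0 < δ) {a : Heis n → ℂ} (ha : IsAtom p p₀ N z₀ δ a) :
    ∫⁻ w, ‖a w‖ₑ ≤ volume (rball z₀ δ) ^ (-(1 / p)) * volume (rball z₀ δ) := by
  have h1 := eLpNorm_le_eLpNorm_mul_rpow_measure_univ (μ := volume.restrict (rball z₀ δ))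
    hp₀.le ha.aestronglyMeasurable.restrict
  rw [eLpNorm_restrict_eq_of_support_subset ha.support_subset,
    eLpNorm_restrict_eq_of_support_subset ha.support_subset, eLpNorm_one_eq_lintegral_enorm,
    Measure.restrict_apply_univ] at h1
  refine h1.trans ((mul_le_mul_left ha.eLpNorm_le _).trans_eq ?_)
  have hB0 := (volume_rball_pos z₀ hδ).ne'
  have hBt := volume_rball_ne_top z₀ hδ
  conv_rhs => rw [← ENNReal.rpow_one (volume (rball z₀ δ)), ← ENNReal.rpow_mul, one_mul,
    ← ENNReal.rpow_add _ _ hB0 hBt]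
  rw [← ENNReal.rpow_add _ _ hB0 hBt, ENNReal.toReal_inv]
  congr 1
  simp
  ring

theorem IsAtom.isLocal {p : ℝ} {p₀ : ℝ≥0∞} (hp₀ : 1 < p₀) {N : ℕ} {z₀ : Heis n} {δ : ℝ}
    (hδ : 0 < δ) {a : Heis n → ℂ} (ha : IsAtom p p₀ N z₀ δ a) : IsLocal z₀ δ a where
  pos := hδ
  support_subset := ha.support_subset
  integrable := by
    refine ⟨ha.aestronglyMeasurable, (ha.lintegral_le hp₀ hδ).trans_lt (ENNReal.mul_lt_top ?_ ?_)⟩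
    · exact (ENNReal.rpow_ne_top_of_ne_zero (volume_rball_pos z₀ hδ).ne'
        (volume_rball_ne_top z₀ hδ)).lt_top
    · exact (volume_rball_ne_top z₀ hδ).lt_top

theorem monomial_zero (z : Heis n) : monomial (0, 0) z = 1 := by simp [monomial]

theorem monomial_single (j : Fin n ⊕ Fin n) (z : Heis n) :
    monomial (Pi.single j 1, 0) z = z.1 j := by
  rw [monomial, pow_zero, mul_one, Finset.prod_eq_single j]
  · simp
  · intro k _ hk
    simp [hk]
  · simp

theorem hdeg_single (j : Fin n ⊕ Fin n) : hdeg ((Pi.single j 1, 0) : MultiIndex n) = 1 := by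
  simp [hdeg]

/-- The horizontal part of `z₀⁻¹w` is a difference of coordinates, so affine functions of it are
combinations of monomials in `w` of degree zero and one. Hence `1 ≤ N` is enough. -/
theorem IsAtom.isCancelling {p : ℝ} {p₀ : ℝ≥0∞} (hp₀ : 1 < p₀) {N : ℕ} (hN : 1 ≤ N) {z₀ : Heis n}
    {δ : ℝ} (hδ : 0 < δ) {a : Heis n → ℂ} (ha : IsAtom p p₀ N z₀ δ a) :
    IsCancelling z₀ δ a where
  toIsLocal := ha.isLocal hp₀ hδ
  moment c L := by
    have hl := ha.isLocal hp₀ hδ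
    have h0 : ∫ w, a w = 0 := by
      have := ha.moment (0, 0) (by simp [hdeg])
      simpa [monomial_zero] using this
    have hj : ∀ j, ∫ w, a w * ((w.1 j : ℝ) : ℂ) = 0 := fun j => by
      have := ha.moment (Pi.single j 1, 0) (by rw [hdeg_single]; exact hN)
      simpa only [monomial_single] using this
    have ij : ∀ j, Integrable fun w => a w * ((w.1 j : ℝ) : ℂ) := fun j => by
      -- With this constant and the `j`-th projection the affine function is the coordinate `w_j`
      -- itself.
      have h1 := hl.integrable_affine (z₀.1 j) (EuclideanSpace.proj (𝕜 := ℝ) j)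
      refine h1.congr (Filter.Eventually.of_forall fun w => ?_)
      beta_reduce
      have e : (EuclideanSpace.proj (𝕜 := ℝ) j) (z₀⁻¹ * w).1 = (z₀⁻¹ * w).1 j := rfl
      rw [e, inv_mul_fst, add_sub_cancel]
    have hL : ∀ w : Heis n, a w * ((c + L (z₀⁻¹ * w).1 : ℝ) : ℂ) =
        ((c - L z₀.1 : ℝ) : ℂ) * a w
          + ∑ j, ((L (EuclideanSpace.single j 1) : ℝ) : ℂ) * (a w * ((w.1 j : ℝ) : ℂ)) := fun w => by
      have e1 : (z₀⁻¹ * w).1 = w.1 - z₀.1 := by simp [mul_def, inv_def, neg_add_eq_sub]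
      have e2 : L w.1 = ∑ j, w.1 j * L (EuclideanSpace.single j 1) := by
        have h2 : w.1 = ∑ j, w.1 j • EuclideanSpace.single j (1 : ℝ) := by
          have := (EuclideanSpace.basisFun (Fin n ⊕ Fin n) ℝ).sum_repr w.1
          simpa using this.symm
        conv_lhs => rw [h2, map_sum]
        simp only [map_smul, smul_eq_mul]
      have e3 : ∑ j, ((L (EuclideanSpace.single j 1) : ℝ) : ℂ) * (a w * ((w.1 j : ℝ) : ℂ))
          = a w * ((L w.1 : ℝ) : ℂ) := by
        rw [e2, Complex.ofReal_sum, Finset.mul_sum]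
        refine Finset.sum_congr rfl fun j _ => ?_
        push_cast
        ring
      rw [e3, e1, map_sub]
      push_cast
      ring
    simp only [hL]
    rw [integral_add (hl.integrable.const_mul _)
      (integrable_finsetSum _ fun j _ => (ij j).const_mul _), integral_const_mul, h0, mul_zero,
      zero_add, integral_finsetSum _ fun j _ => (ij j).const_mul _]
    refine Finset.sum_eq_zero fun j _ => ?_
    rw [integral_const_mul, hj, mul_zero]

/-! ### Polynomials of degree one and the maximal function on classes -/

/-- The affine function `b₀ + ∑ b_j (v_j - z_j)`. -/
def affineFn (b₀ : ℂ) (b : Fin n ⊕ Fin n → ℂ) (z v : Heis n) : ℂ :=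
  b₀ + ∑ j, b j * ((v.1 j - z.1 j : ℝ) : ℂ)

theorem continuous_affineFn (b₀ : ℂ) (b : Fin n ⊕ Fin n → ℂ) (z : Heis n) :
    Continuous (affineFn b₀ b z) := by
  unfold affineFn
  have h3 : ∀ j, Continuous (fun z : Heis n => z.1 j) := fun j =>
    (EuclideanSpace.proj (𝕜 := ℝ) j).continuous.comp continuous_fst
  refine continuous_const.add (continuous_finsetSum _ fun j _ => ?_)
  exact continuous_const.mul (Complex.continuous_ofReal.comp ((h3 j).sub continuous_const))

theorem mk_monomial_mem_polys {k : ℕ} {I : MultiIndex n} (hI : hdeg I ≤ k) :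
    AEEqFun.mk (fun z : Heis n => ((monomial I z : ℝ) : ℂ)) (aestronglyMeasurable_monomial I)
      ∈ polys n k :=
  Submodule.subset_span ⟨I, hI, rfl⟩

/-- The base-point terms are collected in the constant, and the coordinates are then added one at a
time by induction on a finite set. The variable `t` has degree two and does not occur. -/
theorem mk_affineFn_mem_polys (b₀ : ℂ) (b : Fin n ⊕ Fin n → ℂ) (z : Heis n)
    (h : AEStronglyMeasurable (affineFn b₀ b z) volume) : AEEqFun.mk _ h ∈ polys n 1 := by
  have key : ∀ s : Finset (Fin n ⊕ Fin n), ∃ hs : AEStronglyMeasurable (fun v : Heis n =>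
      (b₀ - ∑ j, b j * ((z.1 j : ℝ) : ℂ)) + ∑ j ∈ s, b j * ((v.1 j : ℝ) : ℂ)) volume,
      AEEqFun.mk _ hs ∈ polys n 1 := by
    intro s
    induction s using Finset.induction_on with
    | empty =>
      refine ⟨by simpa using aestronglyMeasurable_const, ?_⟩
      have h1 := (polys n 1).smul_mem (b₀ - ∑ j, b j * ((z.1 j : ℝ) : ℂ))
        (mk_monomial_mem_polys (I := (0, 0)) (by simp [hdeg]))
      rw [AEEqFun.smul_mk] at h1
      convert h1 using 2
      funext v
      simp [monomial_zero]
    | insert i s hi ih =>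
      obtain ⟨hs, hmem⟩ := ih
      have h1 := (polys n 1).smul_mem (b i) (mk_monomial_mem_polys (I := (Pi.single i 1, 0))
        (hdeg_single i).le)
      rw [AEEqFun.smul_mk] at h1
      have h2 := (polys n 1).add_mem hmem h1
      rw [AEEqFun.mk_add_mk] at h2
      have e : (fun v : Heis n => (b₀ - ∑ j, b j * ((z.1 j : ℝ) : ℂ))
          + ∑ j ∈ insert i s, b j * ((v.1 j : ℝ) : ℂ)) = (fun v : Heis n =>
          (b₀ - ∑ j, b j * ((z.1 j : ℝ) : ℂ)) + ∑ j ∈ s, b j * ((v.1 j : ℝ) : ℂ))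
          + b i • fun v : Heis n => ((monomial (Pi.single i 1, 0) v : ℝ) : ℂ) := by
        funext v
        simp only [Pi.add_apply, Pi.smul_apply, smul_eq_mul, monomial_single,
          Finset.sum_insert hi]
        ring
      refine ⟨e ▸ hs.add ((aestronglyMeasurable_monomial _).const_smul (b i)), ?_⟩
      convert h2 using 2
  obtain ⟨hs, hmem⟩ := key Finset.univ
  convert hmem using 2
  funext v
  simp only [affineFn, Complex.ofReal_sub, mul_sub, Finset.sum_sub_distrib]
  ring

theorem memLqLoc_of_continuous {q : ℝ} {g : Heis n → ℂ} (hg : Continuous g) : MemLqLoc q g := by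
  refine ⟨hg.aestronglyMeasurable, fun K hK => ?_⟩
  obtain ⟨C, hC⟩ := hK.exists_bound_of_continuousOn hg.continuousOn
  have : IsFiniteMeasure ((volume : Measure (Heis n)).restrict K) := ⟨by
    rw [Measure.restrict_apply_univ]; exact hK.measure_lt_top⟩
  refine MemLp.of_bound hg.aestronglyMeasurable.restrict C ?_
  exact (ae_restrict_iff' hK.measurableSet).2 (Filter.Eventually.of_forall hC)

theorem qavg_congr_ae {q : ℝ} {B : Set (Heis n)} {f g : Heis n → ℂ} (h : f =ᵐ[volume] g) :
    qavg q B f = qavg q B g := by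
  rw [qavg, qavg]
  congr 2
  refine lintegral_congr_ae (ae_restrict_of_ae ?_)
  filter_upwards [h] with v hv
  rw [hv]

/-- The infimum is tested on the single representative `f` minus the affine function. -/
theorem bigN_ofFun_le {q : ℝ} {f : Heis n → ℂ} (hf : MemLqLoc q f) {z : Heis n} {M : ℝ≥0∞}
    (b₀ : ℂ) (b : Fin n ⊕ Fin n → ℂ)
    (h : ∀ r : ℝ, 0 < r → qavg q (rball z r) (fun v => f v - affineFn b₀ b z v) ≤
      ENNReal.ofReal (r ^ 2) * M) :
    bigN 2 (Eqk.ofFun 1 f hf) z ≤ M := by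
  have hP : MemLqLoc q (affineFn b₀ b z) := memLqLoc_of_continuous (continuous_affineFn b₀ b z)
  set F : LqLoc n q := ⟨AEEqFun.mk f hf.1, hf.congr (AEEqFun.coeFn_mk f hf.1).symm⟩ with hF
  set P : LqLoc n q := ⟨AEEqFun.mk _ hP.1, hP.congr (AEEqFun.coeFn_mk _ hP.1).symm⟩ with hPdef
  have hmk : (Submodule.Quotient.mk (F - P) : Eqk n q 1) = Eqk.ofFun 1 f hf := by
    refine (Submodule.Quotient.eq _).2 ?_
    have e : F - P - F = -P := by abel
    change F - P - F ∈ _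
    rw [e]
    refine Submodule.neg_mem _ ?_
    exact mk_affineFn_mem_polys b₀ b z hP.1
  refine iInf_le_of_le (F - P) (iInf_le_of_le hmk ?_)
  refine iSup_le fun r => iSup_le fun hr => ?_
  have hae : (((F - P : LqLoc n q) : Heis n →ₘ[volume] ℂ) : Heis n → ℂ) =ᵐ[volume]
      fun v => f v - affineFn b₀ b z v := by
    have h1 := AEEqFun.coeFn_sub (AEEqFun.mk f hf.1) (AEEqFun.mk _ hP.1)
    filter_upwards [h1, AEEqFun.coeFn_mk f hf.1, AEEqFun.coeFn_mk _ hP.1] with v hv1 hv2 hv3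
    change ((AEEqFun.mk f hf.1 - AEEqFun.mk _ hP.1 : Heis n →ₘ[volume] ℂ) : Heis n → ℂ) v = _
    rw [hv1, Pi.sub_apply, hv2, hv3]
  rw [qavg_congr_ae hae]
  refine (mul_le_mul_right (h r hr) _).trans_eq ?_
  rw [← mul_assoc, ← ENNReal.ofReal_mul (by positivity), Real.rpow_neg hr.le,
    show (2 : ℝ) = ((2 : ℕ) : ℝ) by norm_num, Real.rpow_natCast, inv_mul_cancel₀ (by positivity),
    ENNReal.ofReal_one, one_mul]

theorem qavg_const_mul {q : ℝ} (hq : 0 < q) (B : Set (Heis n)) (c : ℂ) (g : Heis n → ℂ) :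
    qavg q B (fun v => c * g v) = ‖c‖ₑ * qavg q B g := by
  simp only [qavg, enorm_mul, ENNReal.mul_rpow_of_nonneg _ _ hq.le]
  rw [lintegral_const_mul' _ _ (ENNReal.rpow_ne_top_of_nonneg hq.le enorm_ne_top), mul_left_comm,
    ENNReal.mul_rpow_of_nonneg _ _ (by positivity), ← ENNReal.rpow_mul,
    mul_one_div_cancel hq.ne', ENNReal.rpow_one]

/-! ### The potential with its normalizing constant -/

theorem potentialIntegrand_eq (a : Heis n → ℂ) (z w : Heis n) :
    potentialIntegrand a z w = (fundConst n : ℂ) * (a w * ((kernel (w⁻¹ * z) : ℝ) : ℂ)) := by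
  rw [potentialIntegrand]
  push_cast
  ring

theorem potential_eq (a : Heis n → ℂ) (z : Heis n) :
    potential a z = (fundConst n : ℂ) * pot a z := by
  rw [potential, pot, ← integral_const_mul]
  simp only [potentialIntegrand_eq]

theorem MemLqLoc.const_mul {q : ℝ} {g : Heis n → ℂ} (hg : MemLqLoc q g) (c : ℂ) :
    MemLqLoc q fun v => c * g v :=
  ⟨hg.1.const_mul c, fun K hK => (hg.2 K hK).const_mul c⟩

theorem potential_sub_affineFn (a : Heis n → ℂ) (z v : Heis n) :
    potential a v - affineFn ((fundConst n : ℂ) * pot a z)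
      (fun j => (fundConst n : ℂ) * potX a j z) z v = (fundConst n : ℂ) * potRem a z v := by
  rw [potential_eq, affineFn, potRem, mul_sub, mul_add, Finset.mul_sum]
  simp only [mul_assoc]

theorem bigN_potential_le {q : ℝ} (hq : 0 < q) {a : Heis n → ℂ} (hb : MemLqLoc q (potential a))
    {z : Heis n} {M : ℝ≥0∞}
    (h : ∀ r : ℝ, 0 < r → qavg q (rball z r) (potRem a z) ≤ ENNReal.ofReal (r ^ 2) * M) :
    bigN 2 (Eqk.ofFun 1 (potential a) hb) z ≤ ‖(fundConst n : ℂ)‖ₑ * M := by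
  refine bigN_ofFun_le hb ((fundConst n : ℂ) * pot a z)
    (fun j => (fundConst n : ℂ) * potX a j z) fun r hr => ?_
  simp only [potential_sub_affineFn]
  rw [qavg_const_mul hq, mul_left_comm]
  exact mul_le_mul_right (h r hr) _

/-! ### The maximal function of a ball -/

/-- The test ball `B(z₀, 2l)` contains both `z` and all of `B(z₀, δ)`. -/
theorem le_maximalFn_indicator {z₀ z : Heis n} {δ : ℝ} (hδ : 0 < δ) (h : δ ≤ rho (z₀⁻¹ * z)) :
    ENNReal.ofReal ((δ / (2 * rho (z₀⁻¹ * z))) ^ homDim n) ≤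
      maximalFn ((rball z₀ δ).indicator fun _ => (1 : ℂ)) z := by
  set l := rho (z₀⁻¹ * z)
  have hl : 0 < l := by linarith
  have hV0 := (volume_rball_one_pos (n := n)).ne'
  have hVt := (volume_rball_one_lt_top (n := n)).ne
  have hz : z ∈ rball z₀ (2 * l) := mem_rball.2 (by linarith)
  refine le_trans ?_ (le_iSup_of_le z₀ (le_iSup_of_le (2 * l)
    (le_iSup_of_le (by positivity) (le_iSup_of_le hz le_rfl))))
  have h1 : ∫⁻ w in rball z₀ (2 * l), ‖(rball z₀ δ).indicator (fun _ => (1 : ℂ)) w‖ₑ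
      = volume (rball z₀ δ) := by
    have e : ∀ w, ‖(rball z₀ δ).indicator (fun _ => (1 : ℂ)) w‖ₑ
        = (rball z₀ δ).indicator (fun _ => (1 : ℝ≥0∞)) w := fun w => by
      by_cases hw : w ∈ rball z₀ δ <;> simp [hw]
    simp only [e]
    rw [lintegral_indicator_const (measurableSet_rball _ _), one_mul,
      Measure.restrict_apply (measurableSet_rball _ _), Set.inter_eq_left.2]
    exact fun w hw => mem_rball.2 ((mem_rball.1 hw).trans (by linarith))
  rw [h1, volume_rball_rpow _ hδ, volume_rball_rpow _ (by positivity : 0 < 2 * l),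
    ENNReal.mul_inv (Or.inr hVt) (Or.inr hV0), Real.div_rpow hδ.le (by positivity), div_eq_mul_inv,
    ENNReal.ofReal_mul (by positivity), ENNReal.ofReal_inv_of_pos (by positivity)]
  refine le_of_eq ?_
  set V := volume (rball (1 : Heis n) 1)
  calc _ = ENNReal.ofReal (δ ^ homDim n) * (ENNReal.ofReal ((2 * l) ^ homDim n))⁻¹ * (V⁻¹ * V) := by
        rw [ENNReal.inv_mul_cancel hV0 hVt, mul_one]
    _ = _ := by ring

theorem ofReal_div_rpow_le {q : ℝ} (hq : 0 < q) {z₀ z : Heis n} {δ : ℝ} (hδ : 0 < δ)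
    (h : δ ≤ rho (z₀⁻¹ * z)) :
    ENNReal.ofReal ((δ / rho (z₀⁻¹ * z)) ^ (2 + homDim n / q)) ≤
      Real.toNNReal (2 ^ (2 + homDim n / q)) *
        maximalFn ((rball z₀ δ).indicator fun _ => (1 : ℂ)) z ^
          ((2 + homDim n / q) / homDim n) := by
  have hQ := homDim_pos (n := n)
  have hl : 0 < rho (z₀⁻¹ * z) := by linarith
  have h1 := ENNReal.rpow_le_rpow (le_maximalFn_indicator hδ h)
    (by positivity : 0 ≤ (2 + homDim n / q) / homDim n)
  rw [ENNReal.ofReal_rpow_of_pos (by positivity), ← Real.rpow_mul (by positivity),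
    mul_div_cancel₀ _ hQ.ne'] at h1
  refine le_trans (le_of_eq ?_) (mul_le_mul_right h1 _)
  change _ = ENNReal.ofReal _ * _
  rw [← ENNReal.ofReal_mul (by positivity), ← Real.mul_rpow (by norm_num) (by positivity)]
  congr 2
  field_simp

theorem one_le_critOrder {p : ℝ} (hp1 : p ≤ 1) : 1 ≤ critOrder n p := by
  rw [critOrder, if_pos hp1]
  exact Nat.le_add_left 1 _

end Heis

/-! ### Assembly of the two cases -/

theorem mainTheorem3 (n : ℕ) (hn : 1 ≤ n)
    (p : ℝ) (hp : 0 < p) (hp1 : p ≤ 1) (p₀ : ℝ≥0∞) (hp₀ : 1 < p₀)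
    (N : ℕ) (hN : Heis.critOrder n p ≤ N)
    (q : ℝ) (hq1 : 1 < q) (hq : q < ((n : ℝ) + 1) / (n : ℝ))
    (β : ℝ) (hβ : 1 ≤ β) :
    ∃ C : ℝ≥0, ∀ (z₀ : Heis n) (δ : ℝ), 0 < δ → ∀ a : Heis n → ℂ,
      Heis.IsAtom p p₀ N z₀ δ a →
        (∀ᵐ z : Heis n, Integrable (Heis.potentialIntegrand a z) volume) ∧
        ∃ hb : Heis.MemLqLoc q (Heis.potential a), ∀ z : Heis n,
          Heis.bigN 2 (Heis.Eqk.ofFun 1 (Heis.potential a) hb) z ≤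
            C * (volume (Heis.rball z₀ δ) ^ (-(1 / p)) *
                  Heis.maximalFn ((Heis.rball z₀ δ).indicator (fun _ => (1 : ℂ))) z ^
                    ((2 + Heis.homDim n / q) / Heis.homDim n)
              + (Heis.rball z₀ (4 * β ^ 2 * δ)).indicator (Heis.maximalFn a) z
              + (Heis.rball z₀ (4 * β ^ 2 * δ)).indicator
                  (fun z => ∑' I : {I : Heis.MultiIndex n // Heis.hdeg I = 2},
                    Heis.truncMax I.1 a z) z) := by
  have hq0 : 0 < q := by linarith
  obtain ⟨C₁, hC₁⟩ := Heis.exists_qavg_potRem_le hn hq1 hq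
  obtain ⟨C₂, hC₂⟩ := Heis.exists_qavg_potRem_le_of_isCancelling hn hq1 hq
  set κ : ℝ≥0 := ‖(Heis.fundConst n : ℂ)‖₊ with hκ
  have hκe : ‖(Heis.fundConst n : ℂ)‖ₑ = κ := rfl
  set V := volume (Heis.rball (1 : Heis n) 1) with hV
  set D : ℝ≥0 := κ * (C₂ * V.toNNReal * Real.toNNReal (2 ^ (2 + Heis.homDim n / q))) with hD
  -- The summand `1` keeps the constant nonzero, so that the right-hand side is infinite when `Ma(z)
  -- = ∞`.
  refine ⟨κ * C₁ + D + 1, fun z₀ δ hδ a ha => ?_⟩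
  have hloc := ha.isLocal hp₀ hδ
  have hcan := ha.isCancelling hp₀ ((Heis.one_le_critOrder hp1).trans hN) hδ
  have hae := hloc.ae_integrable hn
  have hb : Heis.MemLqLoc q (Heis.potential a) := by
    rw [funext (Heis.potential_eq a)]
    exact (hloc.memLqLoc_pot hn hq1 hq).const_mul _
  refine ⟨?_, hb, fun z => ?_⟩
  · filter_upwards [hae] with z hz
    rw [funext (Heis.potentialIntegrand_eq a z)]
    exact hz.const_mul _
  by_cases hz : z ∈ Heis.rball z₀ (4 * β ^ 2 * δ)
  · rw [Set.indicator_of_mem hz, Set.indicator_of_mem hz]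
    by_cases hM : Heis.maximalFn a z = ∞
    · rw [hM, add_top, top_add, ENNReal.mul_top (by simp)]
      exact le_top
    · refine (Heis.bigN_potential_le hq0 hb (hC₁ a hloc.integrable hae z hM)).trans ?_
      rw [hκe, ← mul_assoc, ← ENNReal.coe_mul]
      refine mul_le_mul' (ENNReal.coe_le_coe.2 ?_) (add_le_add le_add_self le_rfl)
      rw [add_assoc]
      exact le_self_add
  · rw [Set.indicator_of_notMem hz, Set.indicator_of_notMem hz, add_zero, add_zero]
    -- Since `β ≥ 1`, leaving `4β²B` already gives the separation `4δ` required by the cancellation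
    -- estimates.
    have hl : 4 * δ ≤ Heis.rho (z₀⁻¹ * z) := by
      have h1 : 4 * β ^ 2 * δ ≤ Heis.rho (z₀⁻¹ * z) := not_lt.1 fun h => hz (Heis.mem_rball.2 h)
      have h2 : 1 ≤ β ^ 2 := one_le_pow₀ hβ
      nlinarith
    refine (Heis.bigN_potential_le hq0 hb (hC₂ z₀ δ a hcan z hl)).trans ?_
    have hlast := Heis.ofReal_div_rpow_le hq0 hδ (by linarith : δ ≤ Heis.rho (z₀⁻¹ * z))
    set B := volume (Heis.rball z₀ δ) with hB
    set X := (δ / Heis.rho (z₀⁻¹ * z)) ^ (2 + Heis.homDim n / q) with hX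
    set MB := Heis.maximalFn ((Heis.rball z₀ δ).indicator fun _ => (1 : ℂ)) z ^
      ((2 + Heis.homDim n / q) / Heis.homDim n)
    have hX0 : 0 ≤ X := Real.rpow_nonneg (div_nonneg hδ.le (Heis.rho_nonneg _)) _
    have hα := ha.lintegral_le hp₀ hδ
    have hBV : B = ENNReal.ofReal (δ ^ Heis.homDim n) * V := Heis.volume_rball_rpow z₀ hδ
    -- The factor `|B|` from the `L¹` bound of the atom is a constant times `δ^Q` and cancels
    -- `δ^{-Q}`, leaving `|B|^{-1/p}`.
    have hcancel : ENNReal.ofReal (δ ^ (-Heis.homDim n) * X) * ENNReal.ofReal (δ ^ Heis.homDim n)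
        = ENNReal.ofReal X := by
      rw [mul_comm (δ ^ (-Heis.homDim n)), ← ENNReal.ofReal_mul (mul_nonneg hX0 (Real.rpow_nonneg hδ.le _)), mul_assoc,
        ← Real.rpow_add hδ, neg_add_cancel, Real.rpow_zero, mul_one]
    calc ‖(Heis.fundConst n : ℂ)‖ₑ * (C₂ * ENNReal.ofReal (δ ^ (-Heis.homDim n) * X)
          * ∫⁻ w, ‖a w‖ₑ)
        ≤ κ * (C₂ * ENNReal.ofReal (δ ^ (-Heis.homDim n) * X) * (B ^ (-(1 / p)) * B)) := by
          rw [hκe]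
          gcongr
      _ = κ * (C₂ * V) * B ^ (-(1 / p)) * (ENNReal.ofReal (δ ^ (-Heis.homDim n) * X)
            * ENNReal.ofReal (δ ^ Heis.homDim n)) := by
          conv_lhs => rw [hBV]
          rw [hBV]
          ring
      _ ≤ κ * (C₂ * V) * B ^ (-(1 / p)) *
            (Real.toNNReal (2 ^ (2 + Heis.homDim n / q)) * MB) := by
          rw [hcancel]
          gcongr
      _ = (D : ℝ≥0∞) * (B ^ (-(1 / p)) * MB) := by
          rw [hD, ENNReal.coe_mul, ENNReal.coe_mul, ENNReal.coe_mul,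
            ENNReal.coe_toNNReal Heis.volume_rball_one_lt_top.ne]
          ring
      _ ≤ _ := by
          refine mul_le_mul_left (ENNReal.coe_le_coe.2 ?_) _
          exact le_trans le_add_self le_self_add

end
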